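/- Let $|\alpha|\le 1$, $P>0$, let $U_0,U_1,\dots$ be i.i.d. $N(0,1)$, and consider the channel with feedback $Y_k=X_k+Z_k$, $k\ge 1$, with moving average noise $Z_k=\alpha U_{k-1}+U_k$. All logarithms are to base $2$. A feedback code with $M$ messages and block length $n$ consists of measurable encoders $X_i(W,Y_1,\dots,Y_{i-1})$, $i\le n$, with $\frac1n\sum_{i=1}^n E X_i^2\le P$, and a measurable decoder $\hat W(Y_1,\dots,Y_n)$, where $W$ is uniform on the $M$ messages and independent of the noise; its error probability is $P_e^{(n)}=\Pr(\hat W\ne W)$. A sequence $(C_n)$ is an $n$-block feedback capacity sequence if for every $\epsilon>0$ there are codes with at least $2^{n(C_n-\epsilon)}$ messages and $P_e^{(n)}\to0$, while for every $\epsilon>0$ every sequence of codes with at least $2^{n(C_n+\epsilon)}$ messages has $\inf_{n\ge 1}P_e^{(n)}>0$; the feedback capacity is $C_{FB}=\lim_n C_n$. If $U_0$ is revealed to transmitter and receiver, the encoders and the decoder may also depend on $U_0$. The equation $P x^2=(1-x^2)(1-|\alpha|x)^2$ has a unique positive root $x_0$. With $\operatorname{sgn}(0)=1$, put $\beta=-\operatorname{sgn}(\alpha)x_0$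 and $\sigma=\operatorname{sgn}(\alpha)\sqrt{P(1-\beta^2)}$. Then: (a) Let $X_1\sim N(0,P)$ be independent of $(U_k)_{k\ge 0}$ and $X_k=\beta X_{k-1}+\sigma U_{k-1}$ for $k\ge2$. Then $X_k\sim N(0,P)$ for all $k$, the output $(Y_k)_{k\ge1}$ is a Gaussian process, and $(Y_k)_{k\ge 2}$ is stationary, with mean zero and power spectral density $$S_Y(\omega)=\Bigl|1+\alpha e^{-j\omega}+\frac{\sigma e^{-j\omega}}{1-\beta e^{-j\omega}}\Bigr|^2=\beta^{-2}\,|1+\alpha\beta^2e^{-j\omega}|^2 .$$ (b) The entropy rate $\lim_n \frac1n h(Y_1,\dots,Y_n)$ exists and equals $\frac1{4\pi}\int_{-\pi}^{\pi}\log(2\pi e\,S_Y(\omega))\,d\omega=\frac12\log(2\pi e\,x_0^{-2})$. The entropy rate of $(Z_k)$ is $\frac12\log(2\pi e)$. Their difference is $-\log x_0$, and this is the feedback capacity $C_{FB}$ of the channel, both when $U_0$ is not revealed and when $U_0$ is revealed to transmitter and receiver beforehand. (c) Let $U_0$ be revealed to transmitter and receiver, let $0<R<C_{FB}$ and $M=\lceil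 2^{nR}\rceil$. Send as $X_1$ one of the $M$ equally spaced points $-\sqrt P+i\Delta$, $0\le i<M$, $\Delta=2\sqrt P/(M-1)$, and then $X_k=\beta X_{k-1}+\sigma U_{k-1}$; the receiver forms the maximum likelihood estimate $\hat\theta_n$ of $X_1\in\mathbb R$ from $(U_0,Y_1,\dots,Y_n)$ and decodes to a nearest signal point. For every $n\ge1$ the conditional density of $(Y_1,\dots,Y_n)$ given $U_0$ and $X_1=\theta$ has a unique maximizer $\hat\theta_n$ in $\theta$, the scheme is realized by a feedback code, and it satisfies the power constraint. Its error probability decays doubly exponentially: there are constants $a,b>0$ (depending on $\alpha,P,R$ only) such that for all large $n$ $$\exp\bigl(-b\,2^{2n(C_{FB}-R)}\bigr)\le P_e^{(n)}\le\exp\bigl(-a\,2^{2n(C_{FB}-R)}\bigr).$$ -/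

import Mathlib

open MeasureTheory ProbabilityTheory Filter Topology

namespace MA1Feedback

noncomputable section

/-! Time is indexed from `0`: index `i` stands for the transmission time `i + 1`. The innovations
`U 0, U 1, …` keep their own index, so that the noise at index `i` is `α U i + U (i + 1)`.
All logarithms are to base `2`, in accordance with `2 ^ (n R)` messages. -/

/-- The sign with `sgn 0 = 1`. -/
def sgn (ζ : ℝ) : ℝ := if 0 ≤ ζ then 1 else -1

/-- `x` is a positive root of `P x² = (1 - x²) (1 - |α| x)²`. -/
def IsPositiveRoot (α P x : ℝ) : Prop :=
  0 < x ∧ P * x ^ 2 = (1 - x ^ 2) * (1 - |α| * x) ^ 2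

/-- The moving average noise driven by the innovations `u`. -/
def maNoise (α : ℝ) (u : ℕ → ℝ) (i : ℕ) : ℝ := α * u i + u (i + 1)

/-- The law of the innovations `U 0, U 1, …`: independent standard Gaussians. -/
def innovationLaw : Measure (ℕ → ℝ) := Measure.infinitePi (fun _ : ℕ => gaussianReal 0 1)

/-! ### Feedback codes and the feedback capacity -/

/-- A feedback code with `M` messages and block length `n`. The type `S` holds whatever is revealed
to both transmitter and receiver before the transmission (`Unit` if nothing is). The encoder at
index `i` sees the message, the revealed value and the outputs with indices `< i`; only the encoders
at indices `i < n` are used. -/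
structure FeedbackCode (S : Type) [MeasurableSpace S] (M n : ℕ) where
  enc : (i : ℕ) → Fin M → S → (Fin i → ℝ) → ℝ
  dec : S → (Fin n → ℝ) → Fin M
  measurable_enc : ∀ i w, Measurable fun p : S × (Fin i → ℝ) => enc i w p.1 p.2
  measurable_dec : Measurable fun p : S × (Fin n → ℝ) => dec p.1 p.2

namespace FeedbackCode

variable {S : Type} [MeasurableSpace S] {M n : ℕ}

/-- The channel output at index `i`, for the message `w`, revealed value `s` and noise `z`. -/
def output (c : FeedbackCode S M n) (w : Fin M) (s : S) (z : ℕ → ℝ) (i : ℕ) : ℝ :=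
  c.enc i w s (fun j : Fin i => output c w s z j) + z i
termination_by i
decreasing_by exact j.isLt

/-- The channel input at index `i`. -/
def input (c : FeedbackCode S M n) (w : Fin M) (s : S) (z : ℕ → ℝ) (i : ℕ) : ℝ :=
  c.enc i w s (fun j : Fin i => c.output w s z j)

/-- The expected power constraint `E ∑ X_i² ≤ n P` over the channel with moving average noise,
where the message is uniform and independent of the innovations. -/
def PowerConstraint (c : FeedbackCode S M n) (side : (ℕ → ℝ) → S) (α P : ℝ) : Prop :=
  (M : ENNReal)⁻¹ * ∑ w : Fin M, ∑ i ∈ Finset.range n,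
      ∫⁻ u, ENNReal.ofReal (c.input w (side u) (maNoise α u) i ^ 2) ∂innovationLaw
    ≤ ENNReal.ofReal (n * P)

/-- The probability of a decoding error, for a uniform message independent of the innovations. -/
def errorProb (c : FeedbackCode S M n) (side : (ℕ → ℝ) → S) (α : ℝ) : ℝ :=
  (M : ℝ)⁻¹ * ∑ w : Fin M, innovationLaw.real
    {u | c.dec (side u) (fun i : Fin n => c.output w (side u) (maNoise α u) i) ≠ w}

end FeedbackCode

/-- `C 1, C 2, …` is a block feedback capacity sequence: rates `C n - ε` are achievable with
vanishing error, and at rates at least `C n + ε` the error is bounded away from zero. -/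
def IsBlockCapacitySeq {S : Type} [MeasurableSpace S] (side : (ℕ → ℝ) → S) (α P : ℝ)
    (C : ℕ → ℝ) : Prop :=
  (∀ ε : ℝ, 0 < ε → ∃ (M : ℕ → ℕ) (c : ∀ n, FeedbackCode S (M n) n),
    (∀ n, 1 ≤ n → (2 : ℝ) ^ (n * (C n - ε)) ≤ M n ∧ (c n).PowerConstraint side α P) ∧
    Tendsto (fun n => (c n).errorProb side α) atTop (𝓝 0)) ∧
  (∀ ε : ℝ, 0 < ε → ∀ (M : ℕ → ℕ) (c : ∀ n, FeedbackCode S (M n) n),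
    (∀ n, 1 ≤ n → (2 : ℝ) ^ (n * (C n + ε)) ≤ M n ∧ (c n).PowerConstraint side α P) →
    ∃ δ : ℝ, 0 < δ ∧ ∀ n, 1 ≤ n → δ ≤ (c n).errorProb side α)

/-- `C` is the feedback capacity (bits per transmission) under the power constraint `P`, when
`side U` is revealed to transmitter and receiver beforehand. -/
def IsFeedbackCapacity {S : Type} [MeasurableSpace S] (side : (ℕ → ℝ) → S) (α P C : ℝ) : Prop :=
  ∃ Cn : ℕ → ℝ, IsBlockCapacitySeq side α P Cn ∧ Tendsto Cn atTop (𝓝 C)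

/-- Nothing is revealed beforehand: the plain moving average channel with feedback. -/
def noSide : (ℕ → ℝ) → Unit := fun _ => ()

/-- The time-zero innovation is revealed beforehand to both ends. -/
def revealed : (ℕ → ℝ) → ℝ := fun u => u 0

/-! ### Stationarity, spectral density, entropy rate -/

section Processes

variable {Ω : Type*} [MeasurableSpace Ω]

/-- Strict stationarity. -/
def StationaryProcess (Y : ℕ → Ω → ℝ) (μ : Measure Ω) : Prop :=
  ∀ m : ℕ, IdentDistrib (fun ω k => Y (k + m) ω) (fun ω k => Y k ω) μ μ

/-- The centred process `Y` is weakly stationary with power spectral density `S`: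
`cov (Y j, Y k) = (2π)⁻¹ ∫ S(ω) e^{i(j-k)ω} dω` over `[-π, π]`. -/
def HasSpectralDensity (Y : ℕ → Ω → ℝ) (S : ℝ → ℝ) (μ : Measure Ω) : Prop :=
  (∀ k, MemLp (Y k) 2 μ) ∧ (∀ k, ∫ a, Y k a ∂μ = 0) ∧
  (∀ t, 0 ≤ S t) ∧ IntervalIntegrable S volume (-Real.pi) Real.pi ∧
  ∀ j k : ℕ, ((cov[Y j, Y k; μ] : ℝ) : ℂ) =
    (2 * (Real.pi : ℂ))⁻¹ * ∫ t in (-Real.pi)..Real.pi,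
      (S t : ℂ) * Complex.exp (Complex.I * ((j : ℂ) - (k : ℂ)) * (t : ℂ))

/-- The law `ν` on `ℝⁿ` has a density, and its differential entropy exists and equals `h` bits. -/
def HasDiffEntropy {n : ℕ} (ν : Measure (Fin n → ℝ)) (h : ℝ) : Prop :=
  ν ≪ volume ∧
  Integrable (fun y => Real.logb 2 (ν.rnDeriv volume y).toReal) ν ∧
  -∫ y, Real.logb 2 (ν.rnDeriv volume y).toReal ∂ν = h

/-- The process `Y` has entropy rate `r = lim n⁻¹ h(Y_1, …, Y_n)`. -/
def HasEntropyRate (Y : ℕ → Ω → ℝ) (r : ℝ) (μ : Measure Ω) : Prop :=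
  ∃ h : ℕ → ℝ, (∀ n, 1 ≤ n → HasDiffEntropy (μ.map fun ω (i : Fin n) => Y i ω) (h n)) ∧
    Tendsto (fun n : ℕ => h n / n) atTop (𝓝 r)

end Processes

/-! ### The autoregressive filter scheme -/

/-- `β = -sgn(α) x₀`. -/
def filterCoeff (α x₀ : ℝ) : ℝ := -sgn α * x₀

/-- `σ = sgn(α) √(P (1 - β²))`. -/
def filterGain (α P x₀ : ℝ) : ℝ := sgn α * Real.sqrt (P * (1 - filterCoeff α x₀ ^ 2))

/-- `X_1 = x`, `X_k = β X_{k-1} + σ U_{k-1}`. -/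
def arInput (β σ x : ℝ) (u : ℕ → ℝ) : ℕ → ℝ
  | 0 => x
  | k + 1 => β * arInput β σ x u k + σ * u (k + 1)

/-- `Y_k = X_k + Z_k`. -/
def arOutput (α β σ x : ℝ) (u : ℕ → ℝ) (k : ℕ) : ℝ := arInput β σ x u k + maNoise α u k

/-- The `M` equally spaced points from `-√P` to `√P`. -/
def signalPoint (P : ℝ) (M : ℕ) (w : Fin M) : ℝ :=
  -Real.sqrt P + (w : ℝ) * (2 * Real.sqrt P / ((M : ℝ) - 1))

/-- The pair (input at index `k`, innovation `U k`) that the first input `x`, the time-zero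
innovation `s` and the outputs `y` determine. -/
def filterState (α β σ x s : ℝ) (y : ℕ → ℝ) : ℕ → ℝ × ℝ
  | 0 => (x, s)
  | k + 1 =>
    let p := filterState α β σ x s y k
    let u := y k - p.1 - α * p.2
    (β * p.1 + σ * u, u)

/-- The likelihood of the first input `x`, given the time-zero innovation `s` and the first `n`
outputs `y`: the standard Gaussian density at the innovations `U 1, …, U n`. -/
def likelihood (α β σ : ℝ) {n : ℕ} (x s : ℝ) (y : Fin n → ℝ) : ℝ :=
  ∏ i : Fin n, gaussianPDFReal 0 1
    (filterState α β σ x s (fun k => if h : k < n then y ⟨k, h⟩ else 0) ((i : ℕ) + 1)).2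

/-- `t` is a maximum likelihood estimate of the real parameter `X_1`. -/
def IsMLEstimate (α β σ : ℝ) {n : ℕ} (s : ℝ) (y : Fin n → ℝ) (t : ℝ) : Prop :=
  ∀ x, likelihood α β σ x s y ≤ likelihood α β σ t s y

/-- The code (with the time-zero innovation revealed) sends a signal point first, then follows the
autoregressive filter, and decodes to a signal point nearest to the maximum likelihood estimate. -/
def IsFilterCode {M n : ℕ} (α P β σ : ℝ) (c : FeedbackCode ℝ M n) : Prop :=
  (∀ (w : Fin M) (u : ℕ → ℝ), ∀ i < n,
    c.input w (revealed u) (maNoise α u) i = arInput β σ (signalPoint P M w) u i) ∧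
  (∀ (s : ℝ) (y : Fin n → ℝ), ∃ t, IsMLEstimate α β σ s y t ∧
    ∀ w : Fin M, |t - signalPoint P M (c.dec s y)| ≤ |t - signalPoint P M w|)

/-- The number of messages at rate `R` and block length `n`. -/
def numMessages (R : ℝ) (n : ℕ) : ℕ := ⌈(2 : ℝ) ^ ((n : ℝ) * R)⌉₊

/-- The power transfer `|1 + α e^{-it} + σ e^{-it} / (1 - β e^{-it})|²` from the innovations to
the output. -/
def outputSpectrum (α β σ t : ℝ) : ℝ :=
  ‖1 + (α : ℂ) * Complex.exp (-Complex.I * t)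
    + (σ : ℂ) * Complex.exp (-Complex.I * t) / (1 - (β : ℂ) * Complex.exp (-Complex.I * t))‖ ^ 2

end

end MA1Feedback

open MA1Feedback

namespace MA1Feedback

/-! ### The positive root and the filter coefficients -/

/-! Achievability. Once X_1 and U_0 are fixed, the outputs determine the innovations by an affine
recursion on pairs (input, innovation). The gain σ is exactly what gives the homogeneous recursion
the eigenvalues 1/β and -αβ² (`gain_eq`), so the reconstructed innovations depend on X_1 with
sensitivities d_k of order x₀^(-k) (`inputSensitivity_eq`). The likelihood in X_1 is therefore a
Gaussian bell of precision D_n = ∑ d_k², of order x₀^(-2n), and the maximum likelihood error is N(0,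
1/D_n). With 2^(nR) points, the half spacing in units of this standard deviation has square of order
2^(2n(C-R)), where C = -log x₀; Gaussian tails on both sides give the double exponential.

Without side information the first m inputs are zero and U_m is estimated from the pure noise with
mean square error at most 1/(m+1). An error in that estimate only replaces the innovations by
another sequence producing the same noise, so the filter code runs unchanged with slightly perturbed
power; a slightly smaller design power (`rootPower_lt`) and Chebyshev's inequality finish
(`FilterRelations.achievable`).

Converse. All codes are compared with one reference law, the moving average of order one whose
prediction errors are i.i.d. N(0, x₀^(-2)). Since every code adds the fresh innovation to a function
of the past, the likelihood ratio is explicit (`lintegral_exp_neg_logRatio`), and its mean involves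
only the second moments of the prediction errors. A weighted Cauchy–Schwarz inequality and a
telescoping potential bound their sum linearly by the power used (`FilterRelations.sum_moment_le`),
the constants matching by the root equation. The inequality t + 1 ≤ exp t then plays the role of
Fano's inequality (`correct_mul_log_le`).

Output process. The identity βP + σ(1 + αβ) = 0 makes each input uncorrelated with the outputs
before it, from the second output on, so the output has the covariances of a moving average; in the
frequency domain this is an all-pass factor. For the entropy, the outputs are a volume preserving
image of a standard Gaussian vector plus X_1 and U_0 times two fixed vectors, so the covariance is a
twice rank-one perturbed identity (`exists_hasDiffEntropy_arOutput`). The X_1 factor contributes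
log(1 + P D_n)/2, which is about nC; the U_0 factor contributes only O(log n). -/

theorem IsPositiveRoot.lt_one {α P x : ℝ} (hP : 0 < P) (h : IsPositiveRoot α P x) : x < 1 := by
  obtain ⟨hx, he⟩ := h
  by_contra hle
  rw [not_lt] at hle
  have h1 : 0 < P * x ^ 2 := by positivity
  have h2 : (1 - x ^ 2) * (1 - |α| * x) ^ 2 ≤ 0 :=
    mul_nonpos_of_nonpos_of_nonneg (by nlinarith) (sq_nonneg _)
  linarith

/-- The power at which `x` is the positive root. -/
noncomputable def rootPower (α x : ℝ) : ℝ := (1 - x ^ 2) * (1 - |α| * x) ^ 2 / x ^ 2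

theorem isPositiveRoot_iff {α P x : ℝ} : IsPositiveRoot α P x ↔ 0 < x ∧ P = rootPower α x := by
  unfold IsPositiveRoot rootPower
  refine and_congr_right fun hx => ?_
  rw [eq_div_iff (by positivity)]

theorem one_sub_abs_mul_pos {α x : ℝ} (hα : |α| ≤ 1) (hx : 0 < x) (hx1 : x < 1) :
    0 < 1 - |α| * x := by
  nlinarith [abs_nonneg α]

/-- On (0, 1) the factors 1 - x² and (1 - |α|x)² are positive and nonincreasing, the first strictly,
while x² increases; |α| ≤ 1 keeps 1 - |α|x positive. This gives uniqueness of the root, and lets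
achievability trade a little power for a slightly larger root. -/
theorem rootPower_lt {α x y : ℝ} (hα : |α| ≤ 1) (hx : 0 < x) (hxy : x < y) (hy : y < 1) :
    rootPower α y < rootPower α x := by
  unfold rootPower
  have hy0 : 0 < y := hx.trans hxy
  have h1 := one_sub_abs_mul_pos hα hy0 hy
  have h2 : 1 - |α| * y ≤ 1 - |α| * x := by nlinarith [abs_nonneg α]
  have h3 : (1 - |α| * y) ^ 2 ≤ (1 - |α| * x) ^ 2 := by gcongr
  have h4 : 1 - y ^ 2 < 1 - x ^ 2 := by nlinarith
  have h5 : 0 < 1 - y ^ 2 := by nlinarith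
  apply div_lt_div₀ _ (by gcongr) _ (by positivity)
  · exact mul_lt_mul h4 h3 (by positivity) (by linarith)
  · exact mul_nonneg (by linarith) (sq_nonneg _)

theorem rootPower_pos {α x : ℝ} (hα : |α| ≤ 1) (hx : 0 < x) (hx1 : x < 1) : 0 < rootPower α x := by
  have h1 := one_sub_abs_mul_pos hα hx hx1
  have h2 : 0 < 1 - x ^ 2 := by nlinarith
  unfold rootPower
  positivity

theorem IsPositiveRoot.existsUnique {α P x : ℝ} (hα : |α| ≤ 1) (hP : 0 < P)
    (h : IsPositiveRoot α P x) : ∃! y, IsPositiveRoot α P y := by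
  refine ⟨x, h, fun y hy => ?_⟩
  have hx1 := h.lt_one hP
  have hy1 := IsPositiveRoot.lt_one hP hy
  rw [isPositiveRoot_iff] at h hy
  rcases lt_trichotomy x y with hxy | hxy | hxy
  · have := rootPower_lt hα h.1 hxy hy1
    linarith [h.2, hy.2]
  · exact hxy.symm
  · have := rootPower_lt hα hy.1 hxy hx1
    linarith [h.2, hy.2]

/-- The relations between the channel parameters and the coefficients of the optimal filter. -/
structure FilterRelations (α P x β σ : ℝ) : Prop where
  abs_le : |α| ≤ 1
  power_pos : 0 < P
  pos : 0 < x
  lt_one : x < 1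
  power_eq : P * x ^ 2 = (1 - x ^ 2) * (1 - |α| * x) ^ 2
  abs_coeff : |β| = x
  mul_coeff : α * β = -(|α| * x)
  gain_sq : σ ^ 2 = P * (1 - β ^ 2)
  gain_mul : σ * β = α * β ^ 3 - 1 - α * β + β ^ 2

theorem sgn_mul_sgn (a : ℝ) : sgn a * sgn a = 1 := by
  unfold sgn; split_ifs <;> norm_num

theorem mul_sgn (a : ℝ) : a * sgn a = |a| := by
  unfold sgn; split_ifs with h
  · rw [abs_of_nonneg h, mul_one]
  · rw [abs_of_neg (not_le.mp h)]; ring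

theorem abs_sgn (a : ℝ) : |sgn a| = 1 := by
  unfold sgn; split_ifs <;> norm_num

/-- The root equation turns P(1 - x²) into the square of (1 - x²)(1 - |α|x)/x, so the square root in
the gain disappears and σβ becomes a polynomial in α and β. Everything after this uses only the
polynomial relations. -/
theorem IsPositiveRoot.filterRelations {α P x : ℝ} (hα : |α| ≤ 1) (hP : 0 < P)
    (h : IsPositiveRoot α P x) :
    FilterRelations α P x (filterCoeff α x) (filterGain α P x) := by
  have hx1 := h.lt_one hP
  obtain ⟨hx, he⟩ := h
  have hb2 : filterCoeff α x ^ 2 = x ^ 2 := by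
    unfold filterCoeff
    linear_combination x ^ 2 * sgn_mul_sgn α
  have h1 := one_sub_abs_mul_pos hα hx hx1
  have h2 : 0 < 1 - x ^ 2 := by nlinarith
  have hs : Real.sqrt (P * (1 - x ^ 2)) * x = (1 - x ^ 2) * (1 - |α| * x) := by
    rw [show P * (1 - x ^ 2) = ((1 - x ^ 2) * (1 - |α| * x) / x) ^ 2 by
        field_simp; linear_combination he, Real.sqrt_sq (by positivity)]
    field_simp
  refine ⟨hα, hP, hx, hx1, he, ?_, ?_, ?_, ?_⟩
  · simp [filterCoeff, abs_mul, abs_sgn, abs_of_pos hx]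
  · unfold filterCoeff; linear_combination -x * mul_sgn α
  · unfold filterGain
    rw [mul_pow, hb2, Real.sq_sqrt (by positivity)]
    linear_combination (P * (1 - x ^ 2)) * sgn_mul_sgn α
  · unfold filterGain
    rw [hb2]
    unfold filterCoeff
    have := mul_sgn α
    have h3 := sgn_mul_sgn α
    linear_combination (-(sgn α * sgn α)) * hs +
      (-1 + x ^ 2 + |α| * x - |α| * x ^ 3 + sgn α * α * x ^ 3) * h3 - (x - x ^ 3) * this

namespace FilterRelations

variable {α P x β σ : ℝ}

theorem coeff_sq (h : FilterRelations α P x β σ) : β ^ 2 = x ^ 2 := by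
  rw [← sq_abs, h.abs_coeff]

theorem coeff_ne_zero (h : FilterRelations α P x β σ) : β ≠ 0 := by
  rw [← abs_pos, h.abs_coeff]; exact h.pos

/-- A trace identity: the homogeneous state recursion has trace β - σ - α and determinant -αβ, so
this value of σ gives it the eigenvalues 1/β and -αβ². -/
theorem gain_eq (h : FilterRelations α P x β σ) : σ = α * β ^ 2 - β⁻¹ - α + β := by
  have := h.gain_mul
  have hb := h.coeff_ne_zero
  field_simp
  linear_combination this

theorem sq_lt_one (h : FilterRelations α P x β σ) : x ^ 2 < 1 := by
  nlinarith [h.pos, h.lt_one]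

theorem one_sub_pos (h : FilterRelations α P x β σ) : 0 < 1 - |α| * x :=
  one_sub_abs_mul_pos h.abs_le h.pos h.lt_one

/-- The orthogonality condition of the scheme: it makes the covariance of an input with the
preceding output vanish, so that no power is spent on what the receiver can already predict
linearly. -/
theorem power_add (h : FilterRelations α P x β σ) : β * P + σ * (1 + α * β) = 0 := by
  have h1 := h.gain_mul
  have h2 := h.coeff_sq
  have h3 := h.mul_coeff
  have h4 := h.power_eq
  have hb := h.coeff_ne_zero
  refine (mul_right_inj' hb).mp ?_
  rw [mul_zero]
  have h5 : σ * β = -(1 - x ^ 2) * (1 - |α| * x) := by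
    rw [h1]; linear_combination h2 * (1 + α * β) + (x ^ 2 - 1) * h3
  linear_combination P * h2 + (1 + α * β) * h5 + h4 - (1 - x ^ 2) * (1 - |α| * x) * h3

theorem abs_mul_cube_lt (h : FilterRelations α P x β σ) : |α| * x ^ 3 < 1 := by
  have h1 : x ^ 3 < 1 := pow_lt_one₀ h.pos.le h.lt_one (by norm_num)
  have h2 : 0 < x ^ 3 := pow_pos h.pos 3
  nlinarith [abs_nonneg α, h.abs_le]

theorem mul_cube (h : FilterRelations α P x β σ) : α * β ^ 3 = -(|α| * x ^ 3) := by
  linear_combination α * β * h.coeff_sq + x ^ 2 * h.mul_coeff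

end FilterRelations

end MA1Feedback

namespace MA1Feedback

/-! ### Causal shears of `ℝⁿ` -/

/-- Extension of a finite sequence by zeros. -/
noncomputable def zeroExtend {n : ℕ} (y : Fin n → ℝ) : ℕ → ℝ :=
  fun k => if h : k < n then y ⟨k, h⟩ else 0

theorem zeroExtend_of_lt {n : ℕ} (y : Fin n → ℝ) {k : ℕ} (h : k < n) :
    zeroExtend y k = y ⟨k, h⟩ := dif_pos h

@[simp] theorem zeroExtend_val {n : ℕ} (y : Fin n → ℝ) (i : Fin n) : zeroExtend y i = y i :=
  dif_pos i.isLt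

theorem measurable_zeroExtend {n : ℕ} : Measurable (zeroExtend : (Fin n → ℝ) → ℕ → ℝ) := by
  refine measurable_pi_lambda _ fun k => ?_
  by_cases h : k < n
  · simp only [zeroExtend, h, dif_pos]; exact measurable_pi_apply _
  · simp only [zeroExtend, h, dif_neg, not_false_iff]; exact measurable_const

/-- A map of sequences which adds to every coordinate a function of the earlier coordinates. -/
def IsCausalShear (T : (ℕ → ℝ) → ℕ → ℝ) : Prop :=
  ∃ g : ℕ → (ℕ → ℝ) → ℝ, (∀ i, Measurable (g i)) ∧
    (∀ i u v, (∀ j < i, u j = v j) → g i u = g i v) ∧ ∀ u i, T u i = u i + g i u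

/-- The action of a map of sequences on the first `n` coordinates. -/
noncomputable def truncate (T : (ℕ → ℝ) → ℕ → ℝ) (n : ℕ) (x : Fin n → ℝ) : Fin n → ℝ :=
  fun i => T (zeroExtend x) i

namespace IsCausalShear

variable {T : (ℕ → ℝ) → ℕ → ℝ}

theorem congr (hT : IsCausalShear T) {u v : ℕ → ℝ} {i : ℕ} (h : ∀ j ≤ i, u j = v j) :
    T u i = T v i := by
  obtain ⟨g, -, hg, hTg⟩ := hT
  rw [hTg, hTg, h i le_rfl, hg i u v fun j hj => h j hj.le]

theorem measurable (hT : IsCausalShear T) : Measurable T := by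
  obtain ⟨g, hgm, -, hTg⟩ := hT
  refine measurable_pi_lambda _ fun i => ?_
  simp only [hTg]
  exact (measurable_pi_apply i).add (hgm i)

theorem measurable_truncate (hT : IsCausalShear T) (n : ℕ) : Measurable (truncate T n) :=
  measurable_pi_lambda _ fun i =>
    (measurable_pi_apply (i : ℕ)).comp (hT.measurable.comp measurable_zeroExtend)

theorem truncate_apply_of_eq (hT : IsCausalShear T) {n : ℕ} {x : Fin n → ℝ} {u : ℕ → ℝ}
    (h : ∀ i : Fin n, x i = u i) (i : Fin n) : truncate T n x i = T u i := by
  refine hT.congr fun j hj => ?_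
  rw [zeroExtend_of_lt x (hj.trans_lt i.isLt), h]

/-- The Jacobian is unit lower triangular. No differentiability is needed: by Fubini the last
coordinate is translated by a measurable function of the others, and translations preserve Lebesgue
measure. -/
theorem measurePreserving_truncate (hT : IsCausalShear T) (n : ℕ) :
    MeasurePreserving (truncate T n) volume volume := by
  induction n with
  | zero =>
    convert MeasurePreserving.id _
  | succ n ih =>
    have hT' := hT
    obtain ⟨g, hgm, hgc, hTg⟩ := hT
    have hsk : MeasurePreserving
        (fun p : (Fin n → ℝ) × ℝ => (truncate T n p.1, p.2 + g n (zeroExtend p.1)))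
        ((volume : Measure (Fin n → ℝ)).prod (volume : Measure ℝ))
        ((volume : Measure (Fin n → ℝ)).prod (volume : Measure ℝ)) := by
      refine ih.skew_product (g := fun x a => a + g n (zeroExtend x)) ?_ ?_
      · exact measurable_snd.add ((hgm n).comp (measurable_zeroExtend.comp measurable_fst))
      · exact ae_of_all _ fun x => (measurePreserving_add_right volume _).map_eq
    let e := MeasurableEquiv.piFinSuccAbove (fun _ : Fin (n + 1) => ℝ) (Fin.last n)
    have he : MeasurePreserving e := volume_preserving_piFinSuccAbove _ _
    have hsw : MeasurePreserving (Prod.swap : ℝ × (Fin n → ℝ) → (Fin n → ℝ) × ℝ)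
        ((volume : Measure ℝ).prod volume) (volume.prod volume) := Measure.measurePreserving_swap
    have hsw' : MeasurePreserving (Prod.swap : (Fin n → ℝ) × ℝ → ℝ × (Fin n → ℝ))
        (volume.prod volume) ((volume : Measure ℝ).prod volume) := Measure.measurePreserving_swap
    have hall := (he.symm e).comp (hsw'.comp (hsk.comp (hsw.comp he)))
    -- The last coordinate is split off and swapped into second place, where the skew product acts,
    -- and the splitting is then undone.
    have heq : truncate T (n + 1) = e.symm ∘ Prod.swap ∘
        (fun p : (Fin n → ℝ) × ℝ => (truncate T n p.1, p.2 + g n (zeroExtend p.1))) ∘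
          Prod.swap ∘ e := by
      funext x
      apply e.injective
      have hx : ∀ j < n, zeroExtend x j = zeroExtend (fun i : Fin n => x i.castSucc) j := by
        intro j hj
        rw [zeroExtend_of_lt x (hj.trans n.lt_succ_self), zeroExtend_of_lt _ hj]
        rfl
      simp only [Function.comp, MeasurableEquiv.apply_symm_apply]
      have hr : e x = (x (Fin.last n), fun i : Fin n => x i.castSucc) := by
        simp [e, MeasurableEquiv.piFinSuccAbove, Fin.insertNthEquiv]
        rfl
      have hl : e (truncate T (n + 1) x) =
          (truncate T (n + 1) x (Fin.last n), fun i : Fin n => truncate T (n + 1) x i.castSucc) := by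
        simp [e, MeasurableEquiv.piFinSuccAbove, Fin.insertNthEquiv]
        rfl
      rw [hl, hr]
      simp only [Prod.swap, Prod.mk.injEq]
      constructor
      · simp only [truncate, hTg, hgc _ _ _ hx, Fin.val_last]
        rw [zeroExtend_of_lt x n.lt_succ_self]
        rfl
      · funext i
        exact hT'.congr fun j hj => hx j (hj.trans_lt i.isLt)
    rw [heq]
    exact hall

/-- The image of a density under a causal shear with inverse `S`. -/
theorem map_withDensity (hT : IsCausalShear T) {n : ℕ} {S : (Fin n → ℝ) → Fin n → ℝ}
    (hS : Measurable S) (hST : ∀ x, S (truncate T n x) = x) {f : (Fin n → ℝ) → ENNReal}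
    (hf : Measurable f) :
    (volume.withDensity f).map (truncate T n) = volume.withDensity (fun y => f (S y)) := by
  have hmp := hT.measurePreserving_truncate n
  ext s hs
  rw [Measure.map_apply hmp.measurable hs, withDensity_apply _ (hmp.measurable hs),
    withDensity_apply _ hs]
  have h := hmp.setLIntegral_comp_preimage hs (hf.comp hS)
  simpa only [Function.comp, hST] using h

end IsCausalShear

/-! ### Product Gaussian measures -/

theorem lintegral_pi_prod {n : ℕ} (μ : Measure ℝ) [SigmaFinite μ] {f : Fin n → ℝ → ENNReal}
    (hf : ∀ i, Measurable (f i)) :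
    ∫⁻ x, ∏ i, f i (x i) ∂Measure.pi (fun _ : Fin n => μ) = ∏ i, ∫⁻ x, f i x ∂μ := by
  induction n with
  | zero => simp
  | succ n ih =>
    have hmp := (measurePreserving_piFinSuccAbove (fun _ : Fin (n + 1) => μ) 0).symm
    rw [← hmp.lintegral_comp_emb (MeasurableEquiv.measurableEmbedding _), Fin.prod_univ_succ,
      ← ih fun i => hf i.succ, ← lintegral_prod_mul (hf 0).aemeasurable]
    · refine lintegral_congr fun p => ?_
      simp [MeasurableEquiv.piFinSuccAbove, Fin.insertNthEquiv, Fin.prod_univ_succ]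
    · exact (Finset.measurable_fun_prod _ fun i _ =>
        (hf i.succ).comp (measurable_pi_apply i)).aemeasurable

theorem measurable_prod_gaussianPDF {n : ℕ} (m : ℝ) (v : NNReal) :
    Measurable fun x : Fin n → ℝ => ∏ i, gaussianPDF m v (x i) :=
  Finset.measurable_fun_prod _ fun i _ =>
    (measurable_gaussianPDF m v).comp (measurable_pi_apply i)

theorem pi_gaussianReal_eq_withDensity (n : ℕ) (m : ℝ) {v : NNReal} (hv : v ≠ 0) :
    Measure.pi (fun _ : Fin n => gaussianReal m v) =
      volume.withDensity fun x => ∏ i, gaussianPDF m v (x i) := by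
  refine Measure.pi_eq fun s hs => ?_
  rw [withDensity_apply _ (MeasurableSet.univ_pi hs),
    ← lintegral_indicator (MeasurableSet.univ_pi hs)]
  have h : ∀ x : Fin n → ℝ, (Set.univ.pi s).indicator (fun x => ∏ i, gaussianPDF m v (x i)) x =
      ∏ i, (s i).indicator (gaussianPDF m v) (x i) := by
    intro x
    by_cases hx : x ∈ Set.univ.pi s
    · rw [Set.indicator_of_mem hx]
      exact Finset.prod_congr rfl fun i _ => (Set.indicator_of_mem (hx i trivial) _).symm
    · rw [Set.indicator_of_notMem hx]
      simp only [Set.mem_pi, Set.mem_univ, true_imp_iff, not_forall] at hx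
      obtain ⟨i, hi⟩ := hx
      exact (Finset.prod_eq_zero (Finset.mem_univ i) (Set.indicator_of_notMem hi _)).symm
  simp only [h]
  rw [volume_pi, lintegral_pi_prod volume fun i => (measurable_gaussianPDF m v).indicator (hs i)]
  refine Finset.prod_congr rfl fun i _ => ?_
  rw [lintegral_indicator (hs i), gaussianReal_apply _ hv]

instance : IsProbabilityMeasure innovationLaw := by
  unfold innovationLaw; infer_instance

theorem innovationLaw_map_comp {ι : Type*} [Fintype ι] {f : ι → ℕ} (hf : Function.Injective f) :
    innovationLaw.map (fun u i => u (f i)) = Measure.pi fun _ : ι => gaussianReal 0 1 := by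
  unfold innovationLaw
  rw [Measure.map_infinitePi_infinitePi_of_inj hf, Measure.infinitePi_eq_pi]

theorem innovationLaw_map_shift (m : ℕ) :
    innovationLaw.map (fun u i => u (m + i)) = innovationLaw :=
  Measure.map_infinitePi_infinitePi_of_inj (add_right_injective m)

theorem innovationLaw_map_eval (i : ℕ) :
    innovationLaw.map (fun u => u i) = gaussianReal 0 1 := by
  unfold innovationLaw; exact Measure.infinitePi_map_eval _ i

theorem iIndepFun_innovationLaw : iIndepFun (fun (i : ℕ) (u : ℕ → ℝ) => u i) innovationLaw :=
  iIndepFun_infinitePi (X := fun _ ω => ω) (by fun_prop)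

/-- A function of the past factors through finitely many coordinates (the others may be set to
zero), and disjoint blocks of coordinates are independent. -/
theorem indepFun_innovation_of_past {D : (ℕ → ℝ) → ℝ} (hD : Measurable D) {i : ℕ}
    (hc : ∀ u v, (∀ j < i, u j = v j) → D u = D v) :
    IndepFun D (fun u => u i) innovationLaw := by
  have h := iIndepFun_innovationLaw.indepFun_finset (Finset.range i) {i}
    (by simp) (fun j => measurable_pi_apply j)
  let F : (Finset.range i → ℝ) → ℝ := fun x =>
    D fun k => if hk : k ∈ Finset.range i then x ⟨k, hk⟩ else 0
  have hF : Measurable F := by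
    refine hD.comp (measurable_pi_lambda _ fun k => ?_)
    by_cases hk : k ∈ Finset.range i
    · simp only [hk, dif_pos]; exact measurable_pi_apply _
    · simp only [hk, dif_neg, not_false_iff]; exact measurable_const
  have h' := h.comp hF (measurable_pi_apply (⟨i, by simp⟩ : ({i} : Finset ℕ)))
  have hF' : (F ∘ fun (a : ℕ → ℝ) (j : Finset.range i) => a j) = D := by
    funext u
    refine hc _ _ fun j hj => ?_
    simp [hj]
  rwa [hF'] at h'

theorem memLp_innovation (i : ℕ) : MemLp (fun u : ℕ → ℝ => u i) 2 innovationLaw := by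
  have h : MemLp id 2 (innovationLaw.map fun u => u i) := by
    rw [innovationLaw_map_eval]; exact memLp_id_gaussianReal' 2 (by simp)
  exact (memLp_map_measure_iff measurable_id.aestronglyMeasurable
    (measurable_pi_apply i).aemeasurable).mp h

theorem integral_innovation (i : ℕ) : ∫ u, u i ∂innovationLaw = 0 := by
  rw [← integral_map (φ := fun u : ℕ → ℝ => u i) (f := fun x => x)
    (measurable_pi_apply i).aemeasurable (by fun_prop), innovationLaw_map_eval, integral_id_gaussianReal]

theorem integral_innovation_sq (i : ℕ) : ∫ u, u i ^ 2 ∂innovationLaw = 1 := by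
  have h := variance_fun_id_gaussianReal (μ := 0) (v := 1)
  rw [variance_of_integral_eq_zero (by fun_prop) integral_id_gaussianReal] at h
  rw [← integral_map (φ := fun u : ℕ → ℝ => u i) (f := fun x => x ^ 2)
    (measurable_pi_apply i).aemeasurable (by fun_prop), innovationLaw_map_eval]
  simpa using h

/-- A linear combination of a function of the past and of the present innovation. -/
theorem integral_past_add_innovation_sq {D : (ℕ → ℝ) → ℝ} (hD : Measurable D) {i : ℕ}
    (hc : ∀ u v, (∀ j < i, u j = v j) → D u = D v) (hL : MemLp D 2 innovationLaw) (a b : ℝ) :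
    ∫ u, (a * D u + b * u i) ^ 2 ∂innovationLaw = a ^ 2 * ∫ u, D u ^ 2 ∂innovationLaw + b ^ 2 := by
  have hind := indepFun_innovation_of_past hD hc
  have h1 : Integrable (fun u => D u ^ 2) innovationLaw := hL.integrable_sq
  have h2 : Integrable (fun u : ℕ → ℝ => u i ^ 2) innovationLaw := (memLp_innovation i).integrable_sq
  have h3 : Integrable (fun u => D u * u i) innovationLaw := hL.integrable_mul (memLp_innovation i)
  have h4 : ∫ u, D u * u i ∂innovationLaw = 0 := by
    rw [hind.integral_fun_mul_eq_mul_integral hD.aestronglyMeasurable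
      (measurable_pi_apply i).aestronglyMeasurable,
      integral_innovation, mul_zero]
  have h5 : ∀ u : ℕ → ℝ, (a * D u + b * u i) ^ 2 =
      a ^ 2 * D u ^ 2 + (2 * a * b) * (D u * u i) + b ^ 2 * u i ^ 2 := fun u => by ring
  have h6 : Integrable (fun u => a ^ 2 * D u ^ 2 + (2 * a * b) * (D u * u i)) innovationLaw :=
    (h1.const_mul _).add (h3.const_mul _)
  simp only [h5]
  rw [integral_add h6 (h2.const_mul _),
    integral_add (h1.const_mul _) (h3.const_mul _), integral_const_mul, integral_const_mul,
    integral_const_mul, h4, integral_innovation_sq]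
  ring

end MA1Feedback

namespace MA1Feedback

/-! ### Outputs of feedback codes -/

namespace FeedbackCode

variable {S : Type} [MeasurableSpace S] {M n : ℕ}

theorem output_eq (c : FeedbackCode S M n) (w : Fin M) (s : S) (z : ℕ → ℝ) (i : ℕ) :
    c.output w s z i = c.input w s z i + z i := by
  rw [output, input]

theorem output_congr (c : FeedbackCode S M n) (w : Fin M) (s : S) {z z' : ℕ → ℝ} {i : ℕ}
    (h : ∀ j ≤ i, z j = z' j) : c.output w s z i = c.output w s z' i := by
  induction i using Nat.strong_induction_on with
  | _ i ih =>
    rw [output, output, h i le_rfl]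
    congr 2
    funext j
    exact ih j j.isLt fun k hk => h k (hk.trans j.isLt.le)

theorem input_congr (c : FeedbackCode S M n) (w : Fin M) (s : S) {z z' : ℕ → ℝ} {i : ℕ}
    (h : ∀ j < i, z j = z' j) : c.input w s z i = c.input w s z' i := by
  unfold input
  congr 1
  funext j
  exact c.output_congr w s fun k hk => h k (hk.trans_lt j.isLt)

theorem measurable_output (c : FeedbackCode S M n) (w : Fin M) {Ω : Type*} [MeasurableSpace Ω]
    {s : Ω → S} {z : Ω → ℕ → ℝ} (hs : Measurable s) (hz : Measurable z) (i : ℕ) :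
    Measurable fun ω => c.output w (s ω) (z ω) i := by
  induction i using Nat.strong_induction_on with
  | _ i ih =>
    have h : (fun ω => c.output w (s ω) (z ω) i) =
        fun ω => c.enc i w (s ω) (fun j : Fin i => c.output w (s ω) (z ω) j) + z ω i := by
      funext ω; rw [output]
    rw [h]
    refine ((c.measurable_enc i w).comp (hs.prodMk (measurable_pi_lambda _ fun j => ?_))).add
      ((measurable_pi_apply i).comp hz)
    exact ih j j.isLt

theorem measurable_input (c : FeedbackCode S M n) (w : Fin M) {Ω : Type*} [MeasurableSpace Ω]
    {s : Ω → S} {z : Ω → ℕ → ℝ} (hs : Measurable s) (hz : Measurable z) (i : ℕ) :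
    Measurable fun ω => c.input w (s ω) (z ω) i :=
  (c.measurable_enc i w).comp (hs.prodMk (measurable_pi_lambda _ fun j =>
    c.measurable_output w hs hz j))

/-- A code which ignores what is revealed. -/
def forget (c : FeedbackCode Unit M n) : FeedbackCode S M n where
  enc i w _ y := c.enc i w () y
  dec _ y := c.dec () y
  measurable_enc i w := (c.measurable_enc i w).comp (measurable_const.prodMk measurable_snd)
  measurable_dec := c.measurable_dec.comp (measurable_const.prodMk measurable_snd)

theorem forget_output (c : FeedbackCode Unit M n) (w : Fin M) (s : S) (z : ℕ → ℝ) (i : ℕ) :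
    (c.forget : FeedbackCode S M n).output w s z i = c.output w () z i := by
  induction i using Nat.strong_induction_on with
  | _ i ih =>
    rw [output, output]
    simp only [forget]
    congr 2
    funext j
    exact ih j j.isLt

theorem forget_input (c : FeedbackCode Unit M n) (w : Fin M) (s : S) (z : ℕ → ℝ) (i : ℕ) :
    (c.forget : FeedbackCode S M n).input w s z i = c.input w () z i := by
  unfold input
  simp only [forget_output]
  rfl

theorem forget_powerConstraint (c : FeedbackCode Unit M n) (side : (ℕ → ℝ) → S) (α P : ℝ) :
    (c.forget : FeedbackCode S M n).PowerConstraint side α P ↔ c.PowerConstraint noSide α P := by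
  simp only [PowerConstraint, forget_input, noSide]

theorem forget_errorProb (c : FeedbackCode Unit M n) (side : (ℕ → ℝ) → S) (α : ℝ) :
    (c.forget : FeedbackCode S M n).errorProb side α = c.errorProb noSide α := by
  simp only [errorProb, forget_output, noSide]
  rfl

end FeedbackCode

theorem measurable_maNoise (α : ℝ) : Measurable (maNoise α) := by
  unfold maNoise; fun_prop

theorem measurable_revealed : Measurable revealed := measurable_pi_apply 0

/-- The sequence consisting of `U 0` and the channel outputs. -/
noncomputable def codeShear {M n : ℕ} (c : FeedbackCode ℝ M n) (α : ℝ) (w : Fin M) (u : ℕ → ℝ) : ℕ → ℝ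
  | 0 => u 0
  | i + 1 => c.output w (revealed u) (maNoise α u) i

/-- The output at index i is the fresh innovation U (i + 1) plus an input and an echo α U i that
depend only on earlier innovations. No regularity of the encoder beyond measurability is required,
so every code gives (U 0, outputs) a positive density. -/
theorem isCausalShear_codeShear {M n : ℕ} (c : FeedbackCode ℝ M n) (α : ℝ) (w : Fin M) :
    IsCausalShear (codeShear c α w) := by
  refine ⟨fun i => Nat.casesOn i (fun _ => 0) fun i u =>
    c.input w (revealed u) (maNoise α u) i + α * u i, ?_, ?_, ?_⟩
  · rintro (_ | i)
    · exact measurable_const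
    · exact (c.measurable_input w measurable_revealed (measurable_maNoise α) i).add (by fun_prop)
  · rintro (_ | i) u v h
    · rfl
    · simp only [revealed, h 0 i.succ_pos, h i i.lt_succ_self]
      rw [c.input_congr]
      intro j hj
      simp only [maNoise, h j (by omega), h (j + 1) (by omega)]
  · rintro u (_ | i)
    · simp [codeShear]
    · simp only [codeShear, c.output_eq, maNoise]; ring

/-- The recursive estimate of the latest innovation from `U 0` and the outputs. -/
def innovationEstimate (α s : ℝ) (v : ℕ → ℝ) : ℕ → ℝ
  | 0 => v 0
  | i + 1 => s * (v (i + 1) - α * innovationEstimate α s v i)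

/-- The prediction errors belonging to `innovationEstimate`. -/
def predictionError (α s : ℝ) (v : ℕ → ℝ) : ℕ → ℝ
  | 0 => v 0
  | i + 1 => v (i + 1) - α * innovationEstimate α s v i

theorem innovationEstimate_congr (α s : ℝ) {u v : ℕ → ℝ} {i : ℕ} (h : ∀ j ≤ i, u j = v j) :
    innovationEstimate α s u i = innovationEstimate α s v i := by
  induction i with
  | zero => exact h 0 le_rfl
  | succ i ih =>
    simp only [innovationEstimate, h (i + 1) le_rfl, ih fun j hj => h j (by omega)]

theorem measurable_innovationEstimate (α s : ℝ) (i : ℕ) :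
    Measurable fun v => innovationEstimate α s v i := by
  induction i with
  | zero => exact measurable_pi_apply 0
  | succ i ih => simp only [innovationEstimate]; fun_prop

theorem isCausalShear_predictionError (α s : ℝ) : IsCausalShear (predictionError α s) := by
  refine ⟨fun i => Nat.casesOn i (fun _ => 0) fun i v => -(α * innovationEstimate α s v i),
    ?_, ?_, ?_⟩
  · rintro (_ | i)
    · exact measurable_const
    · exact ((measurable_innovationEstimate α s i).const_mul α).neg
  · rintro (_ | i) u v h
    · rfl
    · simp only [innovationEstimate_congr α s fun j hj => h j (Nat.lt_succ_of_le hj)]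
  · rintro u (_ | i)
    · simp [predictionError]
    · simp only [predictionError]; ring

/-! ### The change of measure bound -/

/-- The sum of the second moments of the prediction errors is controlled by the power. -/
theorem FilterRelations.sum_moment_le {α P x β σ : ℝ} (h : FilterRelations α P x β σ)
    {m e p : ℕ → ℝ} {n : ℕ} (he : ∀ i, 0 ≤ e i) (he0 : e 0 = 0)
    (hm : ∀ i < n, m i ≤ (1 - |α| * x)⁻¹ * p i + |α| / x * e i)
    (hes : ∀ i < n, e (i + 1) = (1 - x ^ 2) ^ 2 + (x ^ 2) ^ 2 * m i) :
    (1 - |α| * x ^ 3) * ∑ i ∈ Finset.range n, (m i - ((x ^ 2)⁻¹ - 1)) ≤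
      (1 - |α| * x)⁻¹ * ∑ i ∈ Finset.range n, (p i - P) := by
  have hx := h.pos
  have hax := h.one_sub_pos
  -- The term |α|/x · e k is a potential: it stores the estimation error that the next prediction
  -- error inherits, and makes the bound telescope. It starts at zero because U 0 is known and is
  -- dropped at the end because it is nonnegative.
  suffices H : ∀ k ≤ n, (1 - |α| * x ^ 3) * ∑ i ∈ Finset.range k, (m i - ((x ^ 2)⁻¹ - 1)) +
      |α| / x * e k ≤ (1 - |α| * x)⁻¹ * ∑ i ∈ Finset.range k, (p i - P) by
    have h1 := H n le_rfl
    have h2 : 0 ≤ |α| / x * e n := mul_nonneg (by positivity) (he n)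
    linarith
  intro k hk
  induction k with
  | zero => simp [he0]
  | succ k ih =>
    have h1 := ih (by omega)
    have h2 := hm k (by omega)
    have h3 := hes k (by omega)
    rw [Finset.sum_range_succ, Finset.sum_range_succ, mul_add, mul_add, h3]
    -- The stationary values are m = x⁻² - 1, e = 1 - x² and p = P; that they balance is the root
    -- equation divided by x²(1 - |α|x).
    have h4 : (1 - |α| * x)⁻¹ * P + |α| / x * (1 - x ^ 2) = (x ^ 2)⁻¹ - 1 := by
      have := h.power_eq
      field_simp
      linear_combination this
    have h5 : (1 - |α| * x ^ 3) * (m k - ((x ^ 2)⁻¹ - 1)) +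
        |α| / x * ((1 - x ^ 2) ^ 2 + (x ^ 2) ^ 2 * m k) =
        m k - ((x ^ 2)⁻¹ - 1) + |α| / x * (1 - x ^ 2) := by
      field_simp
      ring
    have h6 : (1 - |α| * x)⁻¹ * (p k - P) = (1 - |α| * x)⁻¹ * p k - (1 - |α| * x)⁻¹ * P := by ring
    linarith

/-- Cauchy–Schwarz with the weights 1 - |α|x and |α|x, which add up to one. They are the weights for
which the stationary second moments balance through the root equation. The bound is linear in a² and
b², so it survives averaging over noise, time and messages. -/
theorem FilterRelations.sq_add_le {α P x β σ : ℝ} (h : FilterRelations α P x β σ) (a b : ℝ) :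
    (a + α * b) ^ 2 ≤ (1 - |α| * x)⁻¹ * a ^ 2 + |α| / x * b ^ 2 := by
  have hx := h.pos
  have hax := h.one_sub_pos
  set r := 1 - |α| * x with hr
  have h1 : 0 ≤ |α| * (x * a) ^ 2 - 2 * α * (x * a) * (r * b) + |α| * (r * b) ^ 2 := by
    have h2 : 2 * α * (x * a) * (r * b) ≤ |α| * (2 * |x * a| * |r * b|) := by
      calc 2 * α * (x * a) * (r * b) ≤ |2 * α * (x * a) * (r * b)| := le_abs_self _
        _ = _ := by simp only [abs_mul, abs_two]; ring
    have h3 : |α| * (2 * |x * a| * |r * b|) ≤ |α| * (|x * a| ^ 2 + |r * b| ^ 2) :=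
      mul_le_mul_of_nonneg_left (two_mul_le_add_sq _ _) (abs_nonneg α)
    rw [sq_abs, sq_abs] at h3
    linarith
  have h2 : r⁻¹ * a ^ 2 + |α| / x * b ^ 2 - (a + α * b) ^ 2 =
      (|α| * (x * a) ^ 2 - 2 * α * (x * a) * (r * b) + |α| * (r * b) ^ 2) / (x * r) := by
    field_simp
    have : α ^ 2 = |α| ^ 2 := (sq_abs α).symm
    linear_combination (-x * r * b ^ 2) * this + (-|α| * r * b ^ 2 + a ^ 2) * hr
  have h3 := div_nonneg h1 (mul_pos hx hax).le
  linarith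

end MA1Feedback

namespace MA1Feedback

/-! ### Prediction errors of an arbitrary feedback code. -/

section CodeMoments

variable {M n : ℕ} (c : FeedbackCode ℝ M n) (w : Fin M) (α s : ℝ)

/-- The part of the prediction error of the output which is known to the transmitter. -/
noncomputable def knownError (i : ℕ) (u : ℕ → ℝ) : ℝ :=
  c.input w (revealed u) (maNoise α u) i +
    α * (u i - innovationEstimate α s (codeShear c α w u) i)

theorem predictionError_codeShear_succ (u : ℕ → ℝ) (i : ℕ) :
    predictionError α s (codeShear c α w u) (i + 1) = knownError c w α s i u + u (i + 1) := by
  simp only [predictionError, codeShear, c.output_eq, maNoise, knownError]; ring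

theorem measurable_knownError (i : ℕ) : Measurable (knownError c w α s i) := by
  refine (c.measurable_input w measurable_revealed (measurable_maNoise α) i).add ?_
  have hu : Measurable fun u : ℕ → ℝ => u i := measurable_pi_apply i
  refine (hu.sub ?_).const_mul α
  exact (measurable_innovationEstimate α s i).comp (isCausalShear_codeShear c α w).measurable

theorem knownError_congr {i : ℕ} {u v : ℕ → ℝ} (h : ∀ j < i + 1, u j = v j) :
    knownError c w α s i u = knownError c w α s i v := by
  unfold knownError
  rw [innovationEstimate_congr α s (v := codeShear c α w v), h i i.lt_succ_self]
  · simp only [revealed, h 0 i.succ_pos]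
    rw [c.input_congr]
    intro j hj
    simp only [maNoise, h j (by omega), h (j + 1) (by omega)]
  · intro j hj
    exact (isCausalShear_codeShear c α w).congr fun k hk => h k (by omega)

/-- The two summands are independent, since the known error depends on the past only; hence the
second moments obey e ↦ (1 - s)² + s² m, the recursion needed in `FilterRelations.sum_moment_le`. -/
theorem estimate_error_succ (u : ℕ → ℝ) (i : ℕ) :
    u (i + 1) - innovationEstimate α s (codeShear c α w u) (i + 1) =
      -s * knownError c w α s i u + (1 - s) * u (i + 1) := by
  have h := predictionError_codeShear_succ c w α s u i
  simp only [predictionError] at h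
  simp only [innovationEstimate, h]
  ring

theorem memLp_estimate_error
    (hX : ∀ i < n, MemLp (fun u => c.input w (revealed u) (maNoise α u) i) 2 innovationLaw)
    {i : ℕ} (hi : i ≤ n) :
    MemLp (fun u => u i - innovationEstimate α s (codeShear c α w u) i) 2 innovationLaw := by
  induction i with
  | zero => simp [innovationEstimate, codeShear]
  | succ i ih =>
    simp only [estimate_error_succ]
    have h1 : MemLp (knownError c w α s i) 2 innovationLaw :=
      (hX i (by omega)).add ((ih (by omega)).const_mul α)
    exact (h1.const_mul (-s)).add ((memLp_innovation (i + 1)).const_mul (1 - s))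

theorem memLp_knownError
    (hX : ∀ i < n, MemLp (fun u => c.input w (revealed u) (maNoise α u) i) 2 innovationLaw)
    {i : ℕ} (hi : i < n) : MemLp (knownError c w α s i) 2 innovationLaw :=
  (hX i hi).add ((memLp_estimate_error c w α s hX hi.le).const_mul α)

theorem memLp_predictionError
    (hX : ∀ i < n, MemLp (fun u => c.input w (revealed u) (maNoise α u) i) 2 innovationLaw)
    {i : ℕ} (hi : i < n + 1) :
    MemLp (fun u => predictionError α s (codeShear c α w u) i) 2 innovationLaw := by
  cases i with
  | zero => exact memLp_innovation 0
  | succ i =>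
    simp only [predictionError_codeShear_succ]
    exact (memLp_knownError c w α s hX (by omega)).add (memLp_innovation _)

variable {α}

/-- The single place where the power constraint meets the code structure. Since it is linear in the
power, it can be summed over messages, which need not satisfy the constraint individually. -/
theorem FilterRelations.sum_predictionError_sq_le {P x β σ : ℝ} (h : FilterRelations α P x β σ)
    (hX : ∀ i < n, MemLp (fun u => c.input w (revealed u) (maNoise α u) i) 2 innovationLaw) :
    (1 - |α| * x ^ 3) * (∑ i ∈ Finset.range (n + 1),
        ∫ u, predictionError α (x ^ 2) (codeShear c α w u) i ^ 2 ∂innovationLaw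
          - (n + 1) * (x ^ 2)⁻¹) ≤
      (1 - |α| * x)⁻¹ * (∑ i ∈ Finset.range n,
        ∫ u, c.input w (revealed u) (maNoise α u) i ^ 2 ∂innovationLaw - n * P) := by
  set D := knownError c w α (x ^ 2)
  set m : ℕ → ℝ := fun i => ∫ u, D i u ^ 2 ∂innovationLaw with hm
  have hD : ∀ i < n, MemLp (D i) 2 innovationLaw := fun i hi => memLp_knownError c w α _ hX hi
  have hDm : ∀ i, Measurable (D i) := measurable_knownError c w α _
  have hk : ∀ i < n, ∫ u, predictionError α (x ^ 2) (codeShear c α w u) (i + 1) ^ 2 ∂innovationLaw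
      = m i + 1 := by
    intro i hi
    have := integral_past_add_innovation_sq (hDm i) (i := i + 1)
      (fun u v huv => knownError_congr c w α _ huv) (hD i hi) 1 1
    simp only [predictionError_codeShear_succ]
    simpa using this
  have hsum := h.sum_moment_le (n := n) (m := m)
    (e := fun i => ∫ u, (u i - innovationEstimate α (x ^ 2) (codeShear c α w u) i) ^ 2
      ∂innovationLaw)
    (p := fun i => ∫ u, c.input w (revealed u) (maNoise α u) i ^ 2 ∂innovationLaw)
    (fun i => integral_nonneg fun u => sq_nonneg _)
    (by simp [innovationEstimate, codeShear]) ?_ ?_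
  · simp only [Finset.sum_sub_distrib, Finset.sum_const, Finset.card_range, nsmul_eq_mul] at hsum
    refine le_trans ?_ hsum
    have h1 : 0 < 1 - |α| * x ^ 3 := by linarith [h.abs_mul_cube_lt]
    refine mul_le_mul_of_nonneg_left ?_ h1.le
    rw [Finset.sum_range_succ', Finset.sum_congr rfl fun i hi => hk i (Finset.mem_range.mp hi),
      Finset.sum_add_distrib]
    simp only [predictionError, codeShear, integral_innovation_sq, Finset.sum_const,
      Finset.card_range, nsmul_eq_mul]
    -- The error at index 0 is U 0 itself, of variance 1, which is below the reference variance x⁻²;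
    -- this pays for comparing with n + 1 terms.
    have h2 : 1 ≤ (x ^ 2)⁻¹ := (one_le_inv₀ (pow_pos h.pos 2)).mpr h.sq_lt_one.le
    linarith
  · intro i hi
    have h1 := (hX i hi).integrable_sq
    have h2 := (memLp_estimate_error c w α (x ^ 2) hX hi.le).integrable_sq
    rw [← integral_const_mul, ← integral_const_mul, ← integral_add (h1.const_mul _) (h2.const_mul _)]
    exact integral_mono (hD i hi).integrable_sq ((h1.const_mul _).add (h2.const_mul _))
      fun u => h.sq_add_le _ _
  · intro i hi
    simp only [estimate_error_succ]
    rw [integral_past_add_innovation_sq (hDm i) (fun u v huv => knownError_congr c w α _ huv)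
      (hD i hi)]
    simp only [hm]
    ring

end CodeMoments

/-! ### Change of measure -/

/-- The contribution of one coordinate to the likelihood ratio: a is the true innovation and b the
prediction error. -/
theorem gaussianPDFReal_mul_exp (v : NNReal) (hv : v ≠ 0) (a b : ℝ) :
    gaussianPDFReal 0 1 a * Real.exp (-(Real.log v / 2 - a ^ 2 / 2 + b ^ 2 / (2 * v))) =
      gaussianPDFReal 0 v b := by
  have hv' : (0 : ℝ) < v := by positivity
  have h1 : Real.exp (-(Real.log v / 2)) = (Real.sqrt v)⁻¹ := by
    rw [Real.exp_neg, Real.sqrt_eq_rpow, Real.rpow_def_of_pos hv']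
    ring_nf
  simp only [gaussianPDFReal, sub_zero, NNReal.coe_one, mul_one]
  rw [Real.sqrt_mul (by positivity) (v : ℝ), mul_inv (Real.sqrt (2 * Real.pi)), ← h1, mul_assoc, mul_assoc, ← Real.exp_add,
    ← Real.exp_add]
  congr 2
  ring

/-- The logarithm of the likelihood ratio between the outputs of a code and the reference law. -/
noncomputable def logRatio {M n : ℕ} (c : FeedbackCode ℝ M n) (α s : ℝ) (v : NNReal) (w : Fin M)
    (u : ℕ → ℝ) : ℝ :=
  ∑ i ∈ Finset.range (n + 1), (Real.log v / 2 - u i ^ 2 / 2 +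
    predictionError α s (codeShear c α w u) i ^ 2 / (2 * v))

/-- The reference law of `U 0` and the outputs. -/
noncomputable def referenceLaw (α s : ℝ) (v : NNReal) (n : ℕ) : Measure (Fin (n + 1) → ℝ) :=
  volume.withDensity fun y => ∏ i, gaussianPDF 0 v (truncate (predictionError α s) (n + 1) y i)

theorem measurable_logRatio {M n : ℕ} (c : FeedbackCode ℝ M n) (α s : ℝ) (v : NNReal) (w : Fin M) :
    Measurable (logRatio c α s v w) := by
  refine Finset.measurable_fun_sum _ fun i _ => ?_
  have h : Measurable fun u => predictionError α s (codeShear c α w u) i :=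
    (measurable_pi_apply i).comp ((isCausalShear_predictionError α s).measurable.comp
      (isCausalShear_codeShear c α w).measurable)
  fun_prop

theorem measurable_referenceDensity (α s : ℝ) (v : NNReal) (n : ℕ) : Measurable fun y : Fin n → ℝ =>
    ∏ i, gaussianPDF 0 v (truncate (predictionError α s) n y i) :=
  (measurable_prod_gaussianPDF 0 v).comp
    ((isCausalShear_predictionError α s).measurable_truncate n)

theorem referenceLaw_univ (α s : ℝ) {v : NNReal} (hv : v ≠ 0) (n : ℕ) :
    referenceLaw α s v n Set.univ = 1 := by
  rw [referenceLaw, withDensity_apply _ MeasurableSet.univ, Measure.restrict_univ,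
    ((isCausalShear_predictionError α s).measurePreserving_truncate (n + 1)).lintegral_comp
      (f := fun x => ∏ i, gaussianPDF 0 v (x i)) (measurable_prod_gaussianPDF 0 v), volume_pi,
    lintegral_pi_prod volume fun _ => measurable_gaussianPDF 0 v]
  simp [lintegral_gaussianPDF_eq_one 0 hv]

/-- Weighting the innovations by exp(-L) turns the law of (U 0, outputs) into the reference law, the
same one for every message and encoder. Both the code and the prediction error map are causal
shears, so no Jacobian enters and only the Gaussian densities are compared. -/
theorem lintegral_exp_neg_logRatio {M n : ℕ} (c : FeedbackCode ℝ M n) (α s : ℝ) {v : NNReal}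
    (hv : v ≠ 0) (w : Fin M) {F : (Fin (n + 1) → ℝ) → ENNReal} (hF : Measurable F) :
    ∫⁻ u, ENNReal.ofReal (Real.exp (-logRatio c α s v w u)) *
        F (fun i => codeShear c α w u i) ∂innovationLaw = ∫⁻ y, F y ∂referenceLaw α s v n := by
  set T := codeShear c α w with hTdef
  have hT : IsCausalShear T := isCausalShear_codeShear c α w
  have hK := isCausalShear_predictionError α s
  have hpt : ∀ u : ℕ → ℝ, logRatio c α s v w u =
      logRatio c α s v w (zeroExtend fun i : Fin (n + 1) => u i) := by
    intro u
    refine Finset.sum_congr rfl fun i hi => ?_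
    rw [Finset.mem_range] at hi
    have h1 : ∀ j ≤ i, u j = zeroExtend (fun i : Fin (n + 1) => u i) j := by
      intro j hj
      rw [zeroExtend_of_lt _ (hj.trans_lt hi)]
    rw [← h1 i le_rfl, hK.congr fun j hj => hT.congr fun k hk => h1 k (hk.trans hj)]
  have hG : Measurable fun x : Fin (n + 1) → ℝ =>
      ENNReal.ofReal (Real.exp (-logRatio c α s v w (zeroExtend x))) * F (truncate T (n + 1) x) :=
    ((Real.measurable_exp.comp ((measurable_logRatio c α s v w).comp
      measurable_zeroExtend).neg).ennreal_ofReal).mul (hF.comp (hT.measurable_truncate _))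
  have h1 : ∫⁻ u, ENNReal.ofReal (Real.exp (-logRatio c α s v w u)) *
        F (fun i => T u i) ∂innovationLaw =
      ∫⁻ x, ENNReal.ofReal (Real.exp (-logRatio c α s v w (zeroExtend x))) *
        F (truncate T (n + 1) x) ∂Measure.pi fun _ : Fin (n + 1) => gaussianReal 0 1 := by
    rw [← innovationLaw_map_comp Fin.val_injective, lintegral_map hG (by fun_prop)]
    refine lintegral_congr fun u => ?_
    rw [← hpt]
    congr 2
    funext i
    exact (hT.truncate_apply_of_eq (fun _ => rfl) i).symm
  rw [h1, pi_gaussianReal_eq_withDensity _ _ one_ne_zero,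
    lintegral_withDensity_eq_lintegral_mul _ (measurable_prod_gaussianPDF 0 1) hG, referenceLaw,
    lintegral_withDensity_eq_lintegral_mul _ (measurable_referenceDensity α s v _) hF,
    ← (hT.measurePreserving_truncate (n + 1)).lintegral_comp
      ((measurable_referenceDensity α s v _).mul hF)]
  refine lintegral_congr fun x => ?_
  simp only [Pi.mul_apply]
  rw [← mul_assoc]
  congr 1
  simp only [gaussianPDF]
  rw [← ENNReal.ofReal_prod_of_nonneg fun i _ => gaussianPDFReal_nonneg _ _ _,
    ← ENNReal.ofReal_prod_of_nonneg fun i _ => gaussianPDFReal_nonneg _ _ _,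
    ← ENNReal.ofReal_mul (Finset.prod_nonneg fun i _ => gaussianPDFReal_nonneg _ _ _)]
  congr 1
  rw [logRatio, ← Finset.sum_neg_distrib, Real.exp_sum, Finset.prod_range, ← Finset.prod_mul_distrib]
  refine Finset.prod_congr rfl fun i _ => ?_
  rw [zeroExtend_val, gaussianPDFReal_mul_exp v hv, truncate]
  congr 1
  refine hK.congr fun j hj => ?_
  rw [zeroExtend_of_lt _ (hj.trans_lt i.isLt)]
  rfl

end MA1Feedback

namespace MA1Feedback

/-! ### The converse: a Fano-type bound and positivity of the error. -/

section Converse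

variable {M n : ℕ} (c : FeedbackCode ℝ M n) {α P x β σ : ℝ}

theorem FeedbackCode.PowerConstraint.memLp {c : FeedbackCode ℝ M n}
    (hc : c.PowerConstraint revealed α P) (w : Fin M) {i : ℕ} (hi : i < n) :
    MemLp (fun u => c.input w (revealed u) (maNoise α u) i) 2 innovationLaw := by
  have hm := c.measurable_input w measurable_revealed (measurable_maNoise α) i
  rw [memLp_two_iff_integrable_sq hm.aestronglyMeasurable]
  refine ⟨(hm.pow_const 2).aestronglyMeasurable, ?_⟩
  rw [hasFiniteIntegral_iff_ofReal (ae_of_all _ fun u => sq_nonneg _)]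
  have h1 : (M : ENNReal)⁻¹ ≠ 0 := ENNReal.inv_ne_zero.mpr (ENNReal.natCast_ne_top M)
  have h2 := ne_top_of_le_ne_top ENNReal.ofReal_ne_top hc
  have h3 := ENNReal.lt_top_of_mul_ne_top_right h2 h1
  exact ENNReal.sum_lt_top.mp (ENNReal.sum_lt_top.mp h3 w (Finset.mem_univ w)) i
    (Finset.mem_range.mpr hi)

theorem FeedbackCode.PowerConstraint.sum_integral_le {c : FeedbackCode ℝ M n} (hM : M ≠ 0)
    (hP : 0 < P) (hc : c.PowerConstraint revealed α P) :
    ∑ w : Fin M, ∑ i ∈ Finset.range n,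
      ∫ u, c.input w (revealed u) (maNoise α u) i ^ 2 ∂innovationLaw ≤ M * (n * P) := by
  have h0 : ∀ w : Fin M, ∀ i ∈ Finset.range n,
      ENNReal.ofReal (∫ u, c.input w (revealed u) (maNoise α u) i ^ 2 ∂innovationLaw) =
      ∫⁻ u, ENNReal.ofReal (c.input w (revealed u) (maNoise α u) i ^ 2) ∂innovationLaw := by
    intro w i hi
    exact ofReal_integral_eq_lintegral_ofReal (hc.memLp w (Finset.mem_range.mp hi)).integrable_sq
      (ae_of_all _ fun u => sq_nonneg _)
  have h1 : ENNReal.ofReal (∑ w : Fin M, ∑ i ∈ Finset.range n,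
      ∫ u, c.input w (revealed u) (maNoise α u) i ^ 2 ∂innovationLaw) ≤
      ENNReal.ofReal (M * (n * P)) := by
    have hnn : ∀ (w : Fin M) (i : ℕ),
        0 ≤ ∫ u, c.input w (revealed u) (maNoise α u) i ^ 2 ∂innovationLaw :=
      fun w i => integral_nonneg fun u => sq_nonneg _
    rw [ENNReal.ofReal_sum_of_nonneg fun w _ => Finset.sum_nonneg fun i _ => hnn w i]
    simp only [ENNReal.ofReal_sum_of_nonneg fun i (_ : i ∈ Finset.range n) => hnn _ i]
    rw [Finset.sum_congr rfl fun w _ => Finset.sum_congr rfl (h0 w),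
      ENNReal.ofReal_mul (by positivity), ENNReal.ofReal_natCast]
    have := mul_le_mul_right hc (M : ENNReal)
    rwa [← mul_assoc, ENNReal.mul_inv_cancel (by exact_mod_cast hM) (ENNReal.natCast_ne_top M),
      one_mul] at this
  exact (ENNReal.ofReal_le_ofReal_iff (by positivity)).mp h1

/-- The decoding region of a message, as a set of values of `U 0` and the outputs. -/
def decodingRegion (w : Fin M) : Set (Fin (n + 1) → ℝ) :=
  {y | c.dec (y 0) (fun i => y i.succ) = w}

theorem measurableSet_decodingRegion (w : Fin M) : MeasurableSet (decodingRegion c w) := by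
  have h : Measurable fun y : Fin (n + 1) → ℝ => c.dec (y 0) (fun i => y i.succ) :=
    c.measurable_dec.comp (f := fun y : Fin (n + 1) → ℝ => (y 0, fun i : Fin n => y i.succ))
      ((measurable_pi_apply 0).prodMk (measurable_pi_lambda _ fun i => measurable_pi_apply _))
  exact h (measurableSet_singleton w)

variable (α) in
/-- The event that the message `w` is decoded correctly. -/
def correctEvent (w : Fin M) : Set (ℕ → ℝ) :=
  {u | (fun i : Fin (n + 1) => codeShear c α w u i) ∈ decodingRegion c w}

theorem measurableSet_correctEvent (w : Fin M) : MeasurableSet (correctEvent c α w) := by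
  refine measurableSet_preimage ?_ (measurableSet_decodingRegion c w)
  exact measurable_pi_lambda _ fun i =>
    (measurable_pi_apply (i : ℕ)).comp (isCausalShear_codeShear c α w).measurable

theorem errorProb_revealed :
    c.errorProb revealed α = (M : ℝ)⁻¹ * ∑ w : Fin M, innovationLaw.real (correctEvent c α w)ᶜ :=
  rfl

theorem integrable_logRatio (hc : c.PowerConstraint revealed α P) (s : ℝ) (v : NNReal) (w : Fin M) :
    Integrable (logRatio c α s v w) innovationLaw := by
  refine integrable_finsetSum _ fun i hi => ?_
  have h1 := (memLp_predictionError c w α s (fun i hi => hc.memLp w hi)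
    (Finset.mem_range.mp hi)).integrable_sq
  have h2 := (memLp_innovation i).integrable_sq
  exact ((integrable_const _).sub (h2.div_const _)).add (h1.div_const _)

/-- The mean log-likelihood ratio exceeds (n + 1) log v / 2 only by the excess of the prediction
error energy over (n + 1) v, and this excess is nonpositive after summing over the messages. -/
theorem integral_logRatio (hc : c.PowerConstraint revealed α P) (s : ℝ) {v : NNReal} (hv : v ≠ 0)
    (w : Fin M) :
    ∫ u, logRatio c α s v w u ∂innovationLaw = (n + 1) * (Real.log v / 2) +
      (2 * (v : ℝ))⁻¹ * (∑ i ∈ Finset.range (n + 1),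
        ∫ u, predictionError α s (codeShear c α w u) i ^ 2 ∂innovationLaw - (n + 1) * v) := by
  have hv' : (v : ℝ) ≠ 0 := by exact_mod_cast hv
  have h1 := fun i (hi : i ∈ Finset.range (n + 1)) =>
    (memLp_predictionError c w α s (fun i hi => hc.memLp w hi)
      (Finset.mem_range.mp hi)).integrable_sq
  have h2 := fun i => (memLp_innovation i).integrable_sq
  have h0 : ∀ i ∈ Finset.range (n + 1), Integrable (fun u : ℕ → ℝ => Real.log v / 2 - u i ^ 2 / 2 +
      predictionError α s (codeShear c α w u) i ^ 2 / (2 * v)) innovationLaw := fun i hi =>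
    ((integrable_const _).sub ((h2 i).div_const _)).add ((h1 i hi).div_const _)
  unfold logRatio
  rw [integral_finsetSum _ h0]
  have h3 : ∀ i ∈ Finset.range (n + 1), ∫ u, (Real.log v / 2 - u i ^ 2 / 2 +
      predictionError α s (codeShear c α w u) i ^ 2 / (2 * v)) ∂innovationLaw =
      Real.log v / 2 - 1 / 2 + (2 * (v : ℝ))⁻¹ *
        ∫ u, predictionError α s (codeShear c α w u) i ^ 2 ∂innovationLaw := by
    intro i hi
    have h4 : Integrable (fun u : ℕ → ℝ => Real.log v / 2 - u i ^ 2 / 2) innovationLaw :=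
      (integrable_const _).sub ((h2 i).div_const _)
    rw [integral_add h4 ((h1 i hi).div_const _),
      integral_sub (integrable_const _) ((h2 i).div_const _), integral_const, probReal_univ,
      one_smul, integral_div, integral_div, integral_innovation_sq]
    ring
  rw [Finset.sum_congr rfl h3, Finset.sum_add_distrib, ← Finset.mul_sum]
  simp
  field_simp
  ring

/-- A one-sided Fano inequality for a single message: t + 1 ≤ exp t at t = 1_E log M - L,
integrated. Since exp(-L) has mean one and restricts on the correct event to the reference mass of
the decoding region, only that mass survives on the right. The regions are disjoint, so the sum over
messages is at most M - 1. -/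
theorem correct_mul_log_le (hc : c.PowerConstraint revealed α P) (hM : 1 ≤ M) (s : ℝ) {v : NNReal}
    (hv : v ≠ 0) (w : Fin M) :
    innovationLaw.real (correctEvent c α w) * Real.log M -
        ∫ u, logRatio c α s v w u ∂innovationLaw ≤
      (M - 1) * (referenceLaw α s v n).real (decodingRegion c w) := by
  have hM1 : (1 : ℝ) ≤ M := by exact_mod_cast hM
  have hE := measurableSet_correctEvent (α := α) c w
  have hA := measurableSet_decodingRegion c w
  have hfin : IsFiniteMeasure (referenceLaw α s v n) := ⟨by rw [referenceLaw_univ _ _ hv]; simp⟩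
  set L := logRatio c α s v w
  have hLm : Measurable L := measurable_logRatio c α s v w
  set E := correctEvent c α w
  have h1 : ∫⁻ u, ENNReal.ofReal (Real.exp (-L u)) ∂innovationLaw = 1 := by
    have := lintegral_exp_neg_logRatio c α s hv w (F := fun _ => 1) measurable_const
    simpa [referenceLaw_univ _ _ hv] using this
  have h2 : ∫⁻ u in E, ENNReal.ofReal (Real.exp (-L u)) ∂innovationLaw =
      referenceLaw α s v n (decodingRegion c w) := by
    have := lintegral_exp_neg_logRatio c α s hv w (F := (decodingRegion c w).indicator 1)
      (measurable_one.indicator hA)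
    rw [lintegral_indicator_one hA] at this
    rw [← this, ← lintegral_indicator hE]
    refine lintegral_congr fun u => ?_
    by_cases hu : u ∈ E
    · rw [Set.indicator_of_mem hu, Set.indicator_of_mem (show _ ∈ decodingRegion c w from hu)]
      simp [L]
    · rw [Set.indicator_of_notMem hu, Set.indicator_of_notMem (show _ ∉ decodingRegion c w from hu)]
      simp
  have hem : Measurable fun u => Real.exp (-L u) := Real.measurable_exp.comp hLm.neg
  have hI : Integrable (fun u => Real.exp (-L u)) innovationLaw := by
    refine ⟨hem.aestronglyMeasurable, ?_⟩
    rw [hasFiniteIntegral_iff_ofReal (ae_of_all _ fun u => (Real.exp_pos _).le), h1]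
    simp
  have h1' : ∫ u, Real.exp (-L u) ∂innovationLaw = 1 := by
    rw [integral_eq_lintegral_of_nonneg_ae (ae_of_all _ fun u => (Real.exp_pos _).le)
      hem.aestronglyMeasurable, h1]; simp
  have h2' : ∫ u in E, Real.exp (-L u) ∂innovationLaw =
      (referenceLaw α s v n).real (decodingRegion c w) := by
    rw [integral_eq_lintegral_of_nonneg_ae (ae_of_all _ fun u => (Real.exp_pos _).le)
      hem.aestronglyMeasurable, h2]; rfl
  have hLi : Integrable L innovationLaw := integrable_logRatio c hc s v w
  have hgi : Integrable (E.indicator fun _ => Real.log M) innovationLaw :=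
    (integrable_const _).indicator hE
  -- On E the factor M = exp(log M) is split as 1 + (M - 1).
  have key : ∀ u, E.indicator (fun _ => Real.log M) u - L u ≤
      Real.exp (-L u) + (M - 1) * E.indicator (fun u => Real.exp (-L u)) u - 1 := by
    intro u
    by_cases hu : u ∈ E
    · rw [Set.indicator_of_mem hu, Set.indicator_of_mem hu]
      have h3 := Real.add_one_le_exp (Real.log M - L u)
      rw [sub_eq_add_neg, Real.exp_add, Real.exp_log (by linarith)] at h3
      linarith
    · rw [Set.indicator_of_notMem hu, Set.indicator_of_notMem hu]
      have h3 := Real.add_one_le_exp (-L u)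
      linarith
  have hIE : Integrable (E.indicator fun u => Real.exp (-L u)) innovationLaw := hI.indicator hE
  have hs : Integrable (fun u => Real.exp (-L u) +
      (M - 1) * E.indicator (fun u => Real.exp (-L u)) u) innovationLaw :=
    hI.add (hIE.const_mul _)
  have h4 := integral_mono (hgi.sub hLi) (hs.sub (integrable_const 1)) key
  simp only [Pi.sub_apply] at h4
  rw [integral_sub hgi hLi, integral_sub hs (integrable_const 1),
    integral_add hI (hIE.const_mul _), integral_const_mul, integral_indicator hE,
    integral_indicator hE, h1', h2', setIntegral_const] at h4
  simp at h4
  linarith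

/-- A bound on the number of messages in terms of the error probability. -/
theorem FilterRelations.one_sub_errorProb_mul_log_le (h : FilterRelations α P x β σ) (hM : 1 ≤ M)
    (hc : c.PowerConstraint revealed α P) :
    (1 - c.errorProb revealed α) * Real.log M ≤ (n + 1) * (-Real.log x) + 1 := by
  have hM0 : M ≠ 0 := by omega
  have hM1 : (1 : ℝ) ≤ M := by exact_mod_cast hM
  have hx := h.pos
  -- The reference variance is that of the stationary prediction error, so log v / 2 = -log x. The
  -- coordinate U 0 is also given variance v, which costs one extra term, hence the factor n + 1.
  set v : NNReal := ⟨(x ^ 2)⁻¹, by positivity⟩ with hvdef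
  have hvc : (v : ℝ) = (x ^ 2)⁻¹ := rfl
  have hv : v ≠ 0 := by
    have : (v : ℝ) ≠ 0 := by rw [hvc]; positivity
    exact_mod_cast this
  have hfin : IsFiniteMeasure (referenceLaw α (x ^ 2) v n) :=
    ⟨by rw [referenceLaw_univ _ _ hv]; simp⟩
  have hlog : Real.log v / 2 = -Real.log x := by
    rw [hvc, Real.log_inv, Real.log_pow]; push_cast; ring
  have hQ : ∑ w : Fin M, (referenceLaw α (x ^ 2) v n).real (decodingRegion c w) ≤ 1 := by
    rw [← measureReal_iUnion_fintype]
    · refine measureReal_mono (Set.subset_univ _) |>.trans ?_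
      simp [Measure.real, referenceLaw_univ _ _ hv]
    · intro w w' hw
      refine Set.disjoint_left.mpr fun y hy hy' => hw ?_
      exact (show _ = w from hy).symm.trans hy'
    · exact measurableSet_decodingRegion c
  have hL : ∑ w : Fin M, ∫ u, logRatio c α (x ^ 2) v w u ∂innovationLaw ≤
      M * ((n + 1) * (-Real.log x)) := by
    have h1 : 0 < 1 - |α| * x ^ 3 := by linarith [h.abs_mul_cube_lt]
    have h2 : ∑ w : Fin M, (∑ i ∈ Finset.range (n + 1),
        ∫ u, predictionError α (x ^ 2) (codeShear c α w u) i ^ 2 ∂innovationLaw - (n + 1) * v) ≤ 0 := by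
      have h3 := Finset.sum_le_sum fun w (_ : w ∈ Finset.univ) =>
        h.sum_predictionError_sq_le c w (fun i hi => hc.memLp w hi)
      rw [← Finset.mul_sum, ← Finset.mul_sum] at h3
      have h4 : ∑ w : Fin M, (∑ i ∈ Finset.range n,
          ∫ u, c.input w (revealed u) (maNoise α u) i ^ 2 ∂innovationLaw - n * P) ≤ 0 := by
        rw [Finset.sum_sub_distrib]
        have := hc.sum_integral_le hM0 h.power_pos
        simp
        linarith
      have h5 := h3.trans (mul_nonpos_of_nonneg_of_nonpos (inv_nonneg.mpr h.one_sub_pos.le) h4)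
      exact nonpos_of_mul_nonpos_right h5 h1
    simp only [integral_logRatio c hc _ hv, hlog]
    rw [Finset.sum_add_distrib, ← Finset.mul_sum, ← Finset.mul_sum]
    have h6 := mul_nonpos_of_nonneg_of_nonpos (show 0 ≤ (2 * (v : ℝ))⁻¹ by positivity) h2
    simp only [Finset.sum_const, Finset.card_univ, Fintype.card_fin, nsmul_eq_mul]
    linarith
  have hsum := Finset.sum_le_sum fun w (_ : w ∈ Finset.univ) =>
    correct_mul_log_le c hc hM (x ^ 2) hv w
  rw [Finset.sum_sub_distrib, ← Finset.sum_mul, ← Finset.mul_sum] at hsum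
  have hcomp : ∑ w : Fin M, innovationLaw.real (correctEvent c α w) =
      M * (1 - c.errorProb revealed α) := by
    rw [errorProb_revealed, mul_sub, ← mul_assoc, mul_inv_cancel₀ (by positivity), one_mul,
      Finset.sum_congr rfl fun w _ => (probReal_compl_eq_one_sub
        (μ := innovationLaw) (measurableSet_correctEvent (α := α) c w)), Finset.sum_sub_distrib]
    simp
  rw [hcomp] at hsum
  have h7 : ((M : ℝ) - 1) * ∑ w : Fin M, (referenceLaw α (x ^ 2) v n).real (decodingRegion c w) ≤
      (M - 1) * 1 := mul_le_mul_of_nonneg_left hQ (by linarith)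
  refine le_of_mul_le_mul_left ?_ (show (0 : ℝ) < M by linarith)
  linarith

/-- With two messages or more, errors occur with positive probability. -/
theorem errorProb_revealed_pos (hM : 2 ≤ M) : 0 < c.errorProb revealed α := by
  have hM0 : (0 : ℝ) < M := by exact_mod_cast (by omega : 0 < M)
  have hnn : ∀ w ∈ Finset.univ, 0 ≤ innovationLaw.real (correctEvent c α w)ᶜ :=
    fun w _ => measureReal_nonneg
  rw [errorProb_revealed]
  refine mul_pos (inv_pos.mpr hM0) (lt_of_le_of_ne (Finset.sum_nonneg hnn) fun h0 => ?_)
  have hz := (Finset.sum_eq_zero_iff_of_nonneg hnn).mp h0.symm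
  -- The positive density makes an error set of probability zero Lebesgue null. All decoding regions
  -- would then be conull, although two of them are disjoint.
  have hvol : ∀ w : Fin M, volume (decodingRegion c w)ᶜ = 0 := by
    intro w
    have h1 : innovationLaw (correctEvent c α w)ᶜ = 0 := by
      have := hz w (Finset.mem_univ w)
      rwa [measureReal_eq_zero_iff] at this
    have hT := isCausalShear_codeShear c α w
    have hA := (measurableSet_decodingRegion c w).compl
    have h2 : (correctEvent c α w)ᶜ = (fun (u : ℕ → ℝ) (i : Fin (n + 1)) => u i) ⁻¹'
        (truncate (codeShear c α w) (n + 1) ⁻¹' (decodingRegion c w)ᶜ) := by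
      ext u
      have : truncate (codeShear c α w) (n + 1) (fun i : Fin (n + 1) => u i) =
          fun i : Fin (n + 1) => codeShear c α w u i :=
        funext fun i => hT.truncate_apply_of_eq (fun _ => rfl) i
      simp only [correctEvent, Set.mem_compl_iff, Set.mem_ofPred_eq, Set.mem_preimage, this]
    have hpre := hT.measurable_truncate (n + 1) hA
    rw [h2, ← Measure.map_apply (by fun_prop) hpre, innovationLaw_map_comp Fin.val_injective,
      pi_gaussianReal_eq_withDensity _ _ one_ne_zero,
      withDensity_apply_eq_zero (measurable_prod_gaussianPDF 0 1)] at h1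
    have h3 : {x : Fin (n + 1) → ℝ | ∏ i, gaussianPDF 0 1 (x i) ≠ 0} = Set.univ := by
      refine Set.eq_univ_of_forall fun y => ?_
      exact Finset.prod_ne_zero_iff.mpr fun i _ => (gaussianPDF_pos 0 one_ne_zero _).ne'
    rw [h3, Set.univ_inter, (hT.measurePreserving_truncate _).measure_preimage
      hA.nullMeasurableSet] at h1
    exact h1
  have hu : (Set.univ : Set (Fin (n + 1) → ℝ)) ⊆
      (decodingRegion c ⟨0, by omega⟩)ᶜ ∪ (decodingRegion c ⟨1, by omega⟩)ᶜ := by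
    intro y _
    by_contra hy
    simp only [Set.mem_union, Set.mem_compl_iff, not_or, not_not] at hy
    have := (show _ = _ from hy.1).symm.trans (show _ = _ from hy.2)
    simp at this
  have h4 := measure_mono_null hu (measure_union_null (hvol _) (hvol _))
  simp at h4

end Converse

/-- For large n the Fano-type bound keeps the error above half of 1 - C/(C + ε). The finitely many
remaining block lengths are covered by positivity of each error probability, available because C > 0
forces at least two messages. -/
theorem FilterRelations.converse {α P x β σ : ℝ} (h : FilterRelations α P x β σ) {ε : ℝ}
    (hε : 0 < ε) (M : ℕ → ℕ) (c : ∀ n, FeedbackCode ℝ (M n) n)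
    (hc : ∀ n : ℕ, 1 ≤ n → (2 : ℝ) ^ (n * (-Real.logb 2 x + ε)) ≤ M n ∧
      (c n).PowerConstraint revealed α P) :
    ∃ δ : ℝ, 0 < δ ∧ ∀ n, 1 ≤ n → δ ≤ (c n).errorProb revealed α := by
  have hx := h.pos
  have hC : 0 < -Real.logb 2 x := by
    rw [neg_pos]; exact Real.logb_neg (by norm_num) hx h.lt_one
  set C := -Real.logb 2 x
  have hM2 : ∀ n, 1 ≤ n → 2 ≤ M n := by
    intro n hn
    have h1 := (hc n hn).1
    have h2 : (1 : ℝ) < 2 ^ (n * (C + ε)) :=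
      Real.one_lt_rpow (by norm_num) (mul_pos (by exact_mod_cast hn) (by linarith))
    have h3 : (1 : ℝ) < M n := h2.trans_le h1
    exact_mod_cast h3
  have hl2 : 0 < Real.log 2 := Real.log_pos (by norm_num)
  have hCl : -Real.log x = C * Real.log 2 := by
    simp only [C, Real.logb]; field_simp
  have hbound : ∀ n : ℕ, 1 ≤ n → 1 - ((n + 1) * (C * Real.log 2) + 1) / (n * ((C + ε) * Real.log 2)) ≤
      (c n).errorProb revealed α := by
    intro n hn
    have hn' : (0 : ℝ) < n := by exact_mod_cast hn
    have hMn := hM2 n hn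
    have h1 := h.one_sub_errorProb_mul_log_le (c n) (by omega) (hc n hn).2
    have h2 : n * ((C + ε) * Real.log 2) ≤ Real.log (M n) := by
      have := Real.log_le_log (by positivity) (hc n hn).1
      rw [Real.log_rpow (by norm_num)] at this
      linarith
    have h3 : 0 < n * ((C + ε) * Real.log 2) := by positivity
    rw [hCl] at h1
    by_contra hlt
    rw [not_le, lt_sub_comm, div_lt_iff₀ h3] at hlt
    have hle : (1 - (c n).errorProb revealed α) * (n * ((C + ε) * Real.log 2)) ≤
        (1 - (c n).errorProb revealed α) * Real.log (M n) := by
      refine mul_le_mul_of_nonneg_left h2 ?_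
      by_contra hneg
      rw [not_le] at hneg
      have := mul_neg_of_neg_of_pos hneg h3
      have h5 : 0 ≤ ((n : ℝ) + 1) * (C * Real.log 2) + 1 := by positivity
      linarith
    linarith
  have hlim : Tendsto (fun n : ℕ => 1 - (((n : ℝ) + 1) * (C * Real.log 2) + 1) /
      (n * ((C + ε) * Real.log 2))) atTop (𝓝 (1 - C / (C + ε))) := by
    have h1 : Tendsto (fun n : ℕ => 1 - (C / (C + ε) + (C * Real.log 2 + 1) /
        ((C + ε) * Real.log 2) * (1 / (n : ℝ)))) atTop
        (𝓝 (1 - (C / (C + ε) + (C * Real.log 2 + 1) / ((C + ε) * Real.log 2) * 0))) :=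
      (tendsto_one_div_atTop_nhds_zero_nat.const_mul _ |>.const_add _).const_sub _
    rw [mul_zero, add_zero] at h1
    refine h1.congr' ?_
    filter_upwards [eventually_ge_atTop 1] with n hn
    have hn' : (n : ℝ) ≠ 0 := by positivity
    have hCe : C + ε ≠ 0 := by positivity
    field_simp
    ring
  have hpos : 0 < 1 - C / (C + ε) := by
    rw [sub_pos, div_lt_one (by linarith)]; linarith
  obtain ⟨N, hN⟩ := eventually_atTop.mp
    (hlim.eventually (lt_mem_nhds (half_lt_self hpos)))
  -- Nothing is assumed at block length 0, so the value there is replaced by 1 before taking the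
  -- minimum.
  let err : ℕ → ℝ := fun n => if 1 ≤ n then (c n).errorProb revealed α else 1
  have herr : ∀ n, 0 < err n := by
    intro n
    simp only [err]
    split_ifs with hn
    · exact errorProb_revealed_pos (c n) (hM2 n hn)
    · exact one_pos
  obtain ⟨k, -, hk⟩ := Finset.exists_min_image (Finset.range (N + 1)) err ⟨0, by simp⟩
  refine ⟨min (err k) ((1 - C / (C + ε)) / 2), lt_min (herr k) (by linarith), fun n hn => ?_⟩
  rcases lt_or_ge n N with hlt | hge
  · have := hk n (Finset.mem_range.mpr (by omega))
    refine (min_le_left _ _).trans (this.trans_eq ?_)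
    simp [err, hn]
  · exact (min_le_right _ _).trans ((hN n hge).le.trans (hbound n hn))

end MA1Feedback

namespace MA1Feedback

/-! ### The filter state and the maximum likelihood estimate -/

theorem filterState_congr {α β σ x s : ℝ} {y y' : ℕ → ℝ} {k : ℕ} (h : ∀ j < k, y j = y' j) :
    filterState α β σ x s y k = filterState α β σ x s y' k := by
  induction k with
  | zero => rfl
  | succ k ih =>
    simp only [filterState, ih fun j hj => h j (by omega), h k k.lt_succ_self]

theorem filterState_arOutput (α β σ x : ℝ) (u : ℕ → ℝ) (k : ℕ) :
    filterState α β σ x (u 0) (arOutput α β σ x u) k = (arInput β σ x u k, u k) := by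
  induction k with
  | zero => rfl
  | succ k ih =>
    have h : arOutput α β σ x u k - arInput β σ x u k - α * u k = u (k + 1) := by
      simp only [arOutput, maNoise]; ring
    simp only [filterState, ih, h, arInput]

/-- The sensitivity of the reconstructed innovations to the first input. -/
noncomputable def inputSensitivity (α β σ : ℝ) (k : ℕ) : ℝ := (filterState α β σ 1 0 0 k).2

/-- The sensitivity of the reconstructed innovations to the time-zero innovation. -/
noncomputable def initialSensitivity (α β σ : ℝ) (k : ℕ) : ℝ := (filterState α β σ 0 1 0 k).2

/-- The reconstruction is linear in (x, s, y) jointly. So the innovations reconstructed from a wrong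
first input are off by a deterministic multiple of the sensitivity, and the log-likelihood is
quadratic in x. -/
theorem filterState_eq_add (α β σ x s : ℝ) (y : ℕ → ℝ) (k : ℕ) :
    filterState α β σ x s y k = filterState α β σ 0 0 y k + x • filterState α β σ 1 0 0 k +
      s • filterState α β σ 0 1 0 k := by
  induction k with
  | zero => simp [filterState]
  | succ k ih =>
    have h1 := congrArg Prod.fst ih
    have h2 := congrArg Prod.snd ih
    simp only [Prod.fst_add, Prod.snd_add, Prod.smul_fst, Prod.smul_snd, smul_eq_mul] at h1 h2
    refine Prod.ext ?_ ?_
    · simp only [filterState, h1, h2, Prod.fst_add, Prod.smul_fst, smul_eq_mul, Pi.zero_apply]; ring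
    · simp only [filterState, h1, h2, Prod.snd_add, Prod.smul_snd, smul_eq_mul, Pi.zero_apply]; ring

theorem filterState_snd (α β σ x s : ℝ) (y : ℕ → ℝ) (k : ℕ) :
    (filterState α β σ x s y k).2 = (filterState α β σ 0 s y k).2 + x * inputSensitivity α β σ k := by
  rw [filterState_eq_add α β σ x, filterState_eq_add α β σ 0 s]
  simp [inputSensitivity]
  ring

theorem inputSensitivity_one (α β σ : ℝ) : inputSensitivity α β σ 1 = -1 := by
  simp [inputSensitivity, filterState]

/-- The energy of the sensitivity over `n` outputs, the precision of the estimate. -/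
noncomputable def precision (α β σ : ℝ) (n : ℕ) : ℝ :=
  ∑ i : Fin n, inputSensitivity α β σ ((i : ℕ) + 1) ^ 2

/-- The first reconstructed innovation has slope -1 in the first input, so one output already
suffices for a strictly concave log-likelihood. -/
theorem one_le_precision (α β σ : ℝ) {n : ℕ} (hn : 1 ≤ n) : 1 ≤ precision α β σ n := by
  have h := Finset.single_le_sum (f := fun i : Fin n => inputSensitivity α β σ ((i : ℕ) + 1) ^ 2)
    (fun i _ => sq_nonneg _) (Finset.mem_univ (⟨0, hn⟩ : Fin n))
  simpa [precision, inputSensitivity_one] using h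

/-- The maximum likelihood estimate of the first input. -/
noncomputable def mlEstimate (α β σ : ℝ) {n : ℕ} (s : ℝ) (y : Fin n → ℝ) : ℝ :=
  -(∑ i : Fin n, (filterState α β σ 0 s (zeroExtend y) ((i : ℕ) + 1)).2 *
    inputSensitivity α β σ ((i : ℕ) + 1)) / precision α β σ n

/-- Completing the square in x: the product of standard Gaussian densities at b_i + x d_i has total
curvature ∑ d_i² and its vertex at the least squares solution. -/
theorem likelihood_eq_exp {α β σ : ℝ} {n : ℕ} (hn : 1 ≤ n) (s : ℝ) (y : Fin n → ℝ) :
    ∃ C, 0 < C ∧ ∀ x, likelihood α β σ x s y =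
      C * Real.exp (-(precision α β σ n * (x - mlEstimate α β σ s y) ^ 2 / 2)) := by
  set b : Fin n → ℝ := fun i => (filterState α β σ 0 s (zeroExtend y) ((i : ℕ) + 1)).2 with hb
  set d : Fin n → ℝ := fun i => inputSensitivity α β σ ((i : ℕ) + 1) with hd
  set D := precision α β σ n with hD
  have hDpos : 0 < D := one_pos.trans_le (one_le_precision α β σ hn)
  set t := mlEstimate α β σ s y with ht
  have htD : t * D = -∑ i, b i * d i := by
    rw [ht, mlEstimate, div_mul_cancel₀ _ hDpos.ne']
  refine ⟨((Real.sqrt (2 * Real.pi * (1 : NNReal)))⁻¹) ^ n *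
    Real.exp (-((∑ i, b i ^ 2 - D * t ^ 2) / 2)), by positivity, fun x => ?_⟩
  have h1 : likelihood α β σ x s y = ∏ i, gaussianPDFReal 0 1 (b i + x * d i) := by
    refine Finset.prod_congr rfl fun i _ => ?_
    rw [filterState_snd]; rfl
  have h2 : ∑ i, (b i + x * d i) ^ 2 = (∑ i, b i ^ 2 - D * t ^ 2) + D * (x - t) ^ 2 := by
    have h3 : ∀ i, (b i + x * d i) ^ 2 = b i ^ 2 + 2 * x * (b i * d i) + x ^ 2 * d i ^ 2 :=
      fun i => by ring
    simp only [h3]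
    rw [Finset.sum_add_distrib, Finset.sum_add_distrib, ← Finset.mul_sum, ← Finset.mul_sum,
      show ∑ i, d i ^ 2 = D from rfl]
    linear_combination (2 * x) * htD
  rw [h1]
  simp only [gaussianPDFReal, sub_zero, Finset.prod_mul_distrib, Finset.prod_const,
    Finset.card_univ, Fintype.card_fin]
  rw [mul_assoc (_ ^ n), ← Real.exp_add, ← Real.exp_sum]
  congr 2
  simp only [neg_div, NNReal.coe_one, mul_one]
  rw [Finset.sum_neg_distrib, ← Finset.sum_div, h2]
  ring

theorem isMLEstimate_iff {α β σ : ℝ} {n : ℕ} (hn : 1 ≤ n) (s : ℝ) (y : Fin n → ℝ) (t : ℝ) :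
    IsMLEstimate α β σ s y t ↔ t = mlEstimate α β σ s y := by
  obtain ⟨C, hC, h⟩ := likelihood_eq_exp (α := α) (β := β) (σ := σ) hn s y
  have hDpos : 0 < precision α β σ n := one_pos.trans_le (one_le_precision α β σ hn)
  unfold IsMLEstimate
  simp only [h, mul_le_mul_iff_right₀ hC, Real.exp_le_exp, neg_le_neg_iff]
  constructor
  · intro h1
    have h2 := h1 (mlEstimate α β σ s y)
    rw [sub_self] at h2
    have h3 : (t - mlEstimate α β σ s y) ^ 2 ≤ 0 := by
      by_contra hlt
      rw [not_le] at hlt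
      have := mul_pos hDpos hlt
      linarith
    have h4 := pow_eq_zero_iff (two_ne_zero) |>.mp (le_antisymm h3 (sq_nonneg _))
    linarith
  · rintro rfl x
    rw [sub_self]
    have := mul_nonneg hDpos.le (sq_nonneg (x - mlEstimate α β σ s y))
    linarith

theorem existsUnique_isMLEstimate {α β σ : ℝ} {n : ℕ} (hn : 1 ≤ n) (s : ℝ) (y : Fin n → ℝ) :
    ∃! t, IsMLEstimate α β σ s y t :=
  ⟨mlEstimate α β σ s y, (isMLEstimate_iff hn s y _).mpr rfl,
    fun _ ht => (isMLEstimate_iff hn s y _).mp ht⟩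

/-- The noise in the maximum likelihood estimate, before normalization. -/
noncomputable def estimateNoise (α β σ : ℝ) (n : ℕ) (u : ℕ → ℝ) : ℝ :=
  ∑ i : Fin n, inputSensitivity α β σ ((i : ℕ) + 1) * u ((i : ℕ) + 1)

/-- At the true first input the reconstruction returns the true innovations, so the estimate misses
x by a fixed linear functional of U 1, …, U n. Neither x nor U 0 affects the error. -/
theorem mlEstimate_arOutput {α β σ : ℝ} {n : ℕ} (hn : 1 ≤ n) (x : ℝ) (u : ℕ → ℝ) :
    mlEstimate α β σ (u 0) (fun i : Fin n => arOutput α β σ x u i) =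
      x - estimateNoise α β σ n u / precision α β σ n := by
  have hDpos : 0 < precision α β σ n := one_pos.trans_le (one_le_precision α β σ hn)
  have h1 : ∀ i : Fin n, (filterState α β σ 0 (u 0)
      (zeroExtend fun i : Fin n => arOutput α β σ x u i) ((i : ℕ) + 1)).2 =
      u ((i : ℕ) + 1) - x * inputSensitivity α β σ ((i : ℕ) + 1) := by
    intro i
    have h2 : filterState α β σ x (u 0) (zeroExtend fun i : Fin n => arOutput α β σ x u i)
        ((i : ℕ) + 1) = filterState α β σ x (u 0) (arOutput α β σ x u) ((i : ℕ) + 1) :=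
      filterState_congr fun j hj => zeroExtend_of_lt _ (by omega)
    have h3 := filterState_snd α β σ x (u 0) (zeroExtend fun i : Fin n => arOutput α β σ x u i)
      ((i : ℕ) + 1)
    rw [h2, filterState_arOutput] at h3
    simp only at h3
    linarith
  unfold mlEstimate estimateNoise
  simp only [h1, sub_mul, Finset.sum_sub_distrib]
  rw [show ∑ i : Fin n, x * inputSensitivity α β σ ((i : ℕ) + 1) *
    inputSensitivity α β σ ((i : ℕ) + 1) = x * precision α β σ n by
      rw [precision, Finset.mul_sum]; exact Finset.sum_congr rfl fun i _ => by ring]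
  field_simp
  rw [neg_sub]
  congr 1
  exact Finset.sum_congr rfl fun i _ => mul_comm _ _

/-! ### The conditional density of the outputs -/

/-- Prepend a value to a sequence. -/
def consSeq (s : ℝ) (v : ℕ → ℝ) : ℕ → ℝ
  | 0 => s
  | k + 1 => v k

theorem measurable_consSeq (s : ℝ) : Measurable (consSeq s) :=
  measurable_pi_lambda _ fun k => by
    cases k with
    | zero => exact measurable_const
    | succ k => exact measurable_pi_apply k

theorem arInput_congr {β σ x : ℝ} {u v : ℕ → ℝ} {k : ℕ} (h : ∀ j, 1 ≤ j → j ≤ k → u j = v j) :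
    arInput β σ x u k = arInput β σ x v k := by
  induction k with
  | zero => rfl
  | succ k ih =>
    simp only [arInput, ih fun j h1 h2 => h j h1 (by omega), h (k + 1) (by omega) le_rfl]

theorem measurable_arInput (β σ x : ℝ) (k : ℕ) : Measurable fun u => arInput β σ x u k := by
  induction k with
  | zero => exact measurable_const
  | succ k ih => simp only [arInput]; fun_prop

theorem isCausalShear_arOutput (α β σ x s : ℝ) :
    IsCausalShear fun v => arOutput α β σ x (consSeq s v) := by
  refine ⟨fun i v => arInput β σ x (consSeq s v) i + α * consSeq s v i, fun i => ?_, ?_, ?_⟩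
  · have h := measurable_consSeq s
    exact ((measurable_arInput β σ x i).comp h).add
      (((measurable_pi_apply i).comp h).const_mul α)
  · intro i u v h
    have h' : ∀ j ≤ i, consSeq s u j = consSeq s v j := by
      rintro (_ | j) hj
      · rfl
      · exact h j (by omega)
    simp only [arInput_congr fun j _ hj => h' j hj, h' i le_rfl]
  · intro v i
    simp only [arOutput, maNoise, consSeq]; ring

theorem measurable_filterState {α β σ x : ℝ} {Ω : Type*} [MeasurableSpace Ω] {s : Ω → ℝ}
    {y : Ω → ℕ → ℝ} (hs : Measurable s) (hy : Measurable y) (k : ℕ) :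
    Measurable fun ω => filterState α β σ x (s ω) (y ω) k := by
  induction k with
  | zero => exact measurable_const.prodMk hs
  | succ k ih =>
    have h : Measurable fun ω => y ω k := (measurable_pi_apply k).comp hy
    simp only [filterState]
    fun_prop

theorem filterState_truncate (α β σ x s : ℝ) {n : ℕ} (v : Fin n → ℝ) :
    (fun i : Fin n => (filterState α β σ x s (zeroExtend
      (truncate (fun v => arOutput α β σ x (consSeq s v)) n v)) ((i : ℕ) + 1)).2) = v := by
  funext i
  rw [filterState_congr (y' := arOutput α β σ x (consSeq s (zeroExtend v)))
    fun j hj => zeroExtend_of_lt _ (by omega)]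
  have := filterState_arOutput α β σ x (consSeq s (zeroExtend v)) ((i : ℕ) + 1)
  rw [show consSeq s (zeroExtend v) 0 = s from rfl] at this
  rw [this]
  simp [consSeq]

/-- Conditioning on U 0 = s amounts to overwriting coordinate 0, as it is independent of the others.
For fixed x and s the outputs are a causal shear of U 1, …, U n with inverse `filterState`, so the
density is the product density at the reconstructed innovations. -/
theorem map_arOutput_eq_withDensity (α β σ : ℝ) (n : ℕ) (x s : ℝ) :
    innovationLaw.map (fun u (i : Fin n) => arOutput α β σ x (Function.update u 0 s) i) =
      volume.withDensity (fun y => ENNReal.ofReal (likelihood α β σ x s y)) := by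
  have hT := isCausalShear_arOutput α β σ x s
  set T := fun v => arOutput α β σ x (consSeq s v) with hTdef
  have h1 : (fun (u : ℕ → ℝ) (i : Fin n) => arOutput α β σ x (Function.update u 0 s) i) =
      truncate T n ∘ fun (u : ℕ → ℝ) (i : Fin n) => u ((i : ℕ) + 1) := by
    funext u i
    have h2 : Function.update u 0 s = consSeq s fun k => u (k + 1) := by
      funext k
      cases k <;> simp [consSeq]
    rw [Function.comp, hT.truncate_apply_of_eq (u := fun k => u (k + 1)) (fun _ => rfl), h2]
  have hinj : Function.Injective fun i : Fin n => (i : ℕ) + 1 :=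
    fun i j hij => Fin.ext (Nat.succ_injective hij)
  rw [h1, ← Measure.map_map (hT.measurable_truncate n) (by fun_prop), innovationLaw_map_comp hinj,
    pi_gaussianReal_eq_withDensity _ _ one_ne_zero,
    hT.map_withDensity (S := fun y i => (filterState α β σ x s (zeroExtend y) ((i : ℕ) + 1)).2)
      (measurable_pi_lambda _ fun i => (measurable_filterState measurable_const
        measurable_zeroExtend _).snd) (filterState_truncate α β σ x s)
      (measurable_prod_gaussianPDF 0 1)]
  congr 1
  funext y
  simp only [gaussianPDF]
  rw [← ENNReal.ofReal_prod_of_nonneg fun i _ => gaussianPDFReal_nonneg _ _ _]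
  rfl

end MA1Feedback

namespace MA1Feedback

/-! ### Growth of the sensitivities -/

namespace FilterRelations

variable {α P x β σ : ℝ}

/-- Diagonalization of the two-dimensional recursion with eigenvalues 1/β and -αβ², cleared of the
difference of the eigenvalues. The input component has to be carried along in the induction. -/
theorem inputSensitivity_eq (h : FilterRelations α P x β σ) (k : ℕ) :
    (β⁻¹ + α * β ^ 2) * inputSensitivity α β σ k = -(β⁻¹ ^ k - (-(α * β ^ 2)) ^ k) := by
  have hb := h.coeff_ne_zero
  suffices H : (β⁻¹ + α * β ^ 2) * (filterState α β σ 1 0 0 k).2 =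
        -(β⁻¹ ^ k - (-(α * β ^ 2)) ^ k) ∧
      (β⁻¹ + α * β ^ 2) * (filterState α β σ 1 0 0 k).1 =
        (β⁻¹ + α) * β⁻¹ ^ k - (α - α * β ^ 2) * (-(α * β ^ 2)) ^ k from H.1
  induction k with
  | zero => simp only [filterState, pow_zero]; constructor <;> ring
  | succ k ih =>
    obtain ⟨h1, h2⟩ := ih
    simp only [filterState, Pi.zero_apply, pow_succ _ k]
    have hpb : β⁻¹ * β = 1 := inv_mul_cancel₀ hb
    have hg := h.gain_eq
    generalize β⁻¹ = p at *
    generalize (filterState α β σ 1 0 0 k).1 = a at *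
    generalize (filterState α β σ 1 0 0 k).2 = d at *
    generalize (-(α * β ^ 2)) ^ k = rk at *
    generalize p ^ k = pk at *
    have h3 : (p + α * β ^ 2) * (0 - a - α * d) = -(pk * p - rk * -(α * β ^ 2)) := by
      linear_combination -h2 - α * h1
    refine ⟨h3, ?_⟩
    linear_combination β * h2 + σ * h3 + (α * β * rk - α * β * pk) * hpb -
      (pk * p + rk * (α * β ^ 2)) * hg

/-- The combination with first input -α(1 - β²) and U 0 = 1 lies in the contracting eigenspace. So U
0 disturbs the outputs along the same growing direction as X_1, up to a bounded remainder, and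
averaging over it costs no entropy rate. -/
theorem initialSensitivity_eq (h : FilterRelations α P x β σ) (k : ℕ) :
    initialSensitivity α β σ k =
      (-(α * β ^ 2)) ^ k + (α - α * β ^ 2) * inputSensitivity α β σ k := by
  have hb := h.coeff_ne_zero
  suffices H : (filterState α β σ 0 1 0 k).2 =
        (-(α * β ^ 2)) ^ k + (α - α * β ^ 2) * (filterState α β σ 1 0 0 k).2 ∧
      (filterState α β σ 0 1 0 k).1 = -(α - α * β ^ 2) * (-(α * β ^ 2)) ^ k +
        (α - α * β ^ 2) * (filterState α β σ 1 0 0 k).1 from H.1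
  induction k with
  | zero => simp [filterState]
  | succ k ih =>
    obtain ⟨h1, h2⟩ := ih
    simp only [filterState, Pi.zero_apply, pow_succ _ k, h1, h2]
    refine ⟨by ring, ?_⟩
    linear_combination (-(α * β * (-(α * β ^ 2)) ^ k)) * h.gain_mul

theorem abs_mode (h : FilterRelations α P x β σ) :
    |β⁻¹ + α * β ^ 2| = (1 - |α| * x ^ 3) / x := by
  have hb := h.coeff_ne_zero
  rw [show β⁻¹ + α * β ^ 2 = (1 + α * β ^ 3) / β by field_simp, abs_div, h.abs_coeff, h.mul_cube,
    abs_of_pos (by linarith [h.abs_mul_cube_lt])]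
  rfl

theorem abs_decay (h : FilterRelations α P x β σ) : |(-(α * β ^ 2))| = |α| * x ^ 2 := by
  rw [abs_neg, abs_mul, abs_pow, h.abs_coeff]

/-- The decaying mode satisfies |α|x² = |α|x³ · x⁻¹ with |α|x³ < 1, so for k ≥ 1 it takes away at
most the fraction |α|x³ of the growing mode, the very factor that the difference of the eigenvalues
supplies. -/
theorem le_abs_inputSensitivity (h : FilterRelations α P x β σ) {k : ℕ} (hk : 1 ≤ k) :
    x * x⁻¹ ^ k ≤ |inputSensitivity α β σ k| := by
  have hx := h.pos
  have h1 := h.abs_mul_cube_lt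
  have h2 := congrArg abs (h.inputSensitivity_eq k)
  rw [abs_mul, h.abs_mode, abs_neg] at h2
  have h3 : x⁻¹ ^ k - (|α| * x ^ 2) ^ k ≤ |β⁻¹ ^ k - (-(α * β ^ 2)) ^ k| := by
    refine le_trans (le_of_eq ?_) (abs_sub_abs_le_abs_sub _ _)
    rw [abs_pow, abs_pow, h.abs_decay, abs_inv, h.abs_coeff]
  have h4 : (|α| * x ^ 2) ^ k ≤ |α| * x ^ 3 * x⁻¹ ^ k := by
    rw [show |α| * x ^ 2 = |α| * x ^ 3 * x⁻¹ by field_simp, mul_pow]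
    refine mul_le_mul_of_nonneg_right ?_ (by positivity)
    exact pow_le_of_le_one (by positivity) h1.le (by omega)
  rw [← h2] at h3
  have h5 : (1 - |α| * x ^ 3) * (x * x⁻¹ ^ k) ≤ (1 - |α| * x ^ 3) * |inputSensitivity α β σ k| := by
    have : (1 - |α| * x ^ 3) / x * |inputSensitivity α β σ k| * x =
        (1 - |α| * x ^ 3) * |inputSensitivity α β σ k| := by field_simp
    rw [← this]
    have := mul_le_mul_of_nonneg_right (h3.trans' (sub_le_sub_left h4 _)) hx.le
    linarith
  exact le_of_mul_le_mul_left h5 (by linarith)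

theorem abs_inputSensitivity_le (h : FilterRelations α P x β σ) (k : ℕ) :
    |inputSensitivity α β σ k| ≤ 2 * x / (1 - |α| * x ^ 3) * x⁻¹ ^ k := by
  have hx := h.pos
  have h1 : 0 < 1 - |α| * x ^ 3 := by linarith [h.abs_mul_cube_lt]
  have h2 := congrArg abs (h.inputSensitivity_eq k)
  rw [abs_mul, h.abs_mode, abs_neg] at h2
  have h3 : |β⁻¹ ^ k - (-(α * β ^ 2)) ^ k| ≤ x⁻¹ ^ k + (|α| * x ^ 2) ^ k := by
    refine (abs_sub _ _).trans (le_of_eq ?_)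
    rw [abs_pow, abs_pow, h.abs_decay, abs_inv, h.abs_coeff]
  have h4 : (|α| * x ^ 2) ^ k ≤ x⁻¹ ^ k := by
    refine pow_le_pow_left₀ (by positivity) ?_ k
    rw [show |α| * x ^ 2 = |α| * x ^ 3 * x⁻¹ by field_simp]
    exact mul_le_of_le_one_left (by positivity) h.abs_mul_cube_lt.le
  rw [← h2] at h3
  rw [div_mul_eq_mul_div, le_div_iff₀ h1]
  have : (1 - |α| * x ^ 3) / x * |inputSensitivity α β σ k| * x =
        (1 - |α| * x ^ 3) * |inputSensitivity α β σ k| := by field_simp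
  have h5 := mul_le_mul_of_nonneg_right (h3.trans (add_le_add_right h4 _)) hx.le
  linarith

theorem le_precision (h : FilterRelations α P x β σ) {n : ℕ} (hn : 1 ≤ n) :
    x ^ 2 * (x⁻¹ ^ n) ^ 2 ≤ precision α β σ n := by
  have h1 := h.le_abs_inputSensitivity hn
  have hx := h.pos
  have h2 : (x * x⁻¹ ^ n) ^ 2 ≤ inputSensitivity α β σ n ^ 2 := by
    rw [← sq_abs (inputSensitivity α β σ n)]
    exact pow_le_pow_left₀ (by positivity) h1 2
  rw [← mul_pow]
  refine h2.trans ?_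
  have h3 := Finset.single_le_sum (f := fun i : Fin n => inputSensitivity α β σ ((i : ℕ) + 1) ^ 2)
    (fun i _ => sq_nonneg _) (Finset.mem_univ (⟨n - 1, by omega⟩ : Fin n))
  simpa [precision, Nat.sub_add_cancel hn] using h3

theorem precision_le (h : FilterRelations α P x β σ) :
    ∃ K, 0 < K ∧ ∀ n, precision α β σ n ≤ K * (x⁻¹ ^ n) ^ 2 := by
  have hx := h.pos
  have h1 : 0 < 1 - |α| * x ^ 3 := by linarith [h.abs_mul_cube_lt]
  have h2 : 0 < 1 - x ^ 2 := by linarith [h.sq_lt_one]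
  set c := (2 * x / (1 - |α| * x ^ 3)) ^ 2 with hc
  have hcpos : 0 < c := by positivity
  -- This constant bounds the geometric sum and is reproduced exactly by the induction step, since c
  -- x²/(1 - x²) + c = c/(1 - x²).
  refine ⟨c / (1 - x ^ 2), by positivity, fun n => ?_⟩
  induction n with
  | zero => simp [precision]; positivity
  | succ n ih =>
    have h3 : precision α β σ (n + 1) = precision α β σ n + inputSensitivity α β σ (n + 1) ^ 2 := by
      simp [precision, Fin.sum_univ_castSucc]
    have h4 : inputSensitivity α β σ (n + 1) ^ 2 ≤ c * (x⁻¹ ^ (n + 1)) ^ 2 := by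
      rw [← sq_abs, hc, ← mul_pow]
      exact pow_le_pow_left₀ (abs_nonneg _) (h.abs_inputSensitivity_le _) 2
    rw [h3]
    refine (add_le_add ih h4).trans (le_of_eq ?_)
    rw [show (x⁻¹ ^ n) ^ 2 = x ^ 2 * (x⁻¹ ^ (n + 1)) ^ 2 by
      rw [pow_succ _ n, mul_pow, inv_pow x 2, mul_left_comm, mul_inv_cancel₀ (by positivity),
        mul_one]]
    field_simp
    ring

end FilterRelations

end MA1Feedback

namespace MA1Feedback

/-! ### Filter codes -/

/-- Nearest-point decoding needs a rule for ties that is measurable; comparing with the last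
candidate recursively provides one. -/
theorem exists_measurable_argmin {Ω : Type*} [MeasurableSpace Ω] {M : ℕ} (f : Fin (M + 1) → Ω → ℝ)
    (hf : ∀ w, Measurable (f w)) :
    ∃ g : Ω → Fin (M + 1), Measurable g ∧ ∀ ω w, f (g ω) ω ≤ f w ω := by
  induction M with
  | zero => exact ⟨fun _ => 0, measurable_const, fun ω w => by rw [Fin.fin_one_eq_zero w]⟩
  | succ M ih =>
    obtain ⟨g, hg, hmin⟩ := ih (fun w => f w.castSucc) fun w => hf _
    have hfg : Measurable fun ω => f (g ω).castSucc ω := by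
      have h : Measurable fun p : Ω × Fin (M + 1) => f p.2.castSucc p.1 :=
        measurable_from_prod_countable_left fun w => by exact hf (Fin.castSucc w)
      exact h.comp (measurable_id.prodMk hg)
    classical
    refine ⟨fun ω => if f (g ω).castSucc ω ≤ f (Fin.last _) ω then (g ω).castSucc else Fin.last _,
      ?_, fun ω w => ?_⟩
    · exact Measurable.ite (measurableSet_le hfg (hf _)) ((measurable_of_finite _).comp hg)
        measurable_const
    · dsimp only
      split_ifs with h
      · induction w using Fin.lastCases with
        | last => exact h
        | cast w => exact hmin ω w
      · rw [not_le] at h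
        induction w using Fin.lastCases with
        | last => exact le_rfl
        | cast w => exact h.le.trans (hmin ω w)

theorem measurable_mlEstimate (α β σ : ℝ) (n : ℕ) :
    Measurable fun p : ℝ × (Fin n → ℝ) => mlEstimate α β σ p.1 p.2 := by
  unfold mlEstimate
  refine Measurable.div_const (Measurable.neg (Finset.measurable_fun_sum _ fun i _ => ?_)) _
  exact (measurable_filterState measurable_fst
    (measurable_zeroExtend.comp measurable_snd) _).snd.mul_const _

/-- Feedback lets the transmitter, who knows X_1 and U 0, run the reconstruction on the past outputs
and read off the next input of the autoregression. -/
theorem exists_isFilterCode {M n : ℕ} (α P β σ : ℝ) (hM : 1 ≤ M) (hn : 1 ≤ n) :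
    ∃ c : FeedbackCode ℝ M n, IsFilterCode α P β σ c := by
  obtain ⟨M, rfl⟩ : ∃ m, M = m + 1 := ⟨M - 1, by omega⟩
  obtain ⟨g, hg, hmin⟩ := exists_measurable_argmin
    (fun (w : Fin (M + 1)) (p : ℝ × (Fin n → ℝ)) =>
      |mlEstimate α β σ p.1 p.2 - signalPoint P (M + 1) w|)
    (fun w => ((measurable_mlEstimate α β σ n).sub_const _).abs)
  let c : FeedbackCode ℝ (M + 1) n :=
    { enc := fun i w s y => (filterState α β σ (signalPoint P (M + 1) w) s (zeroExtend y) i).1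
      dec := fun s y => g (s, y)
      measurable_enc := fun i w => (measurable_filterState measurable_fst
        (measurable_zeroExtend.comp measurable_snd) i).fst
      measurable_dec := hg }
  have hin : ∀ (w : Fin (M + 1)) (u : ℕ → ℝ) (i : ℕ),
      c.input w (revealed u) (maNoise α u) i = arInput β σ (signalPoint P (M + 1) w) u i := by
    intro w u i
    induction i using Nat.strong_induction_on with
    | _ i ih =>
      have hout : ∀ j < i, c.output w (revealed u) (maNoise α u) j =
          arOutput α β σ (signalPoint P (M + 1) w) u j := by
        intro j hj
        rw [c.output_eq, ih j hj, arOutput]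
      have h1 : filterState α β σ (signalPoint P (M + 1) w) (u 0)
          (zeroExtend fun j : Fin i => c.output w (revealed u) (maNoise α u) j) i =
          filterState α β σ (signalPoint P (M + 1) w) (u 0)
            (arOutput α β σ (signalPoint P (M + 1) w) u) i := by
        refine filterState_congr fun j hj => ?_
        rw [zeroExtend_of_lt _ hj, hout j hj]
      rw [filterState_arOutput] at h1
      exact congrArg Prod.fst h1
  exact ⟨c, fun w u i _ => hin w u i, fun s y => ⟨mlEstimate α β σ s y,
    (isMLEstimate_iff hn s y _).mpr rfl, fun w => hmin (s, y) w⟩⟩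

theorem IsFilterCode.output_eq {M n : ℕ} {α P β σ : ℝ} {c : FeedbackCode ℝ M n}
    (hc : IsFilterCode α P β σ c) (w : Fin M) (u : ℕ → ℝ) (i : Fin n) :
    c.output w (revealed u) (maNoise α u) i = arOutput α β σ (signalPoint P M w) u i := by
  rw [c.output_eq, hc.1 w u i i.isLt, arOutput]

/-- The spacing of the signal points. -/
noncomputable def signalSpacing (P : ℝ) (M : ℕ) : ℝ := 2 * Real.sqrt P / ((M : ℝ) - 1)

theorem signalSpacing_pos {P : ℝ} (hP : 0 < P) {M : ℕ} (hM : 2 ≤ M) : 0 < signalSpacing P M := by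
  have h : (2 : ℝ) ≤ M := by exact_mod_cast hM
  have := Real.sqrt_pos.mpr hP
  exact div_pos (by linarith) (by linarith)

theorem signalPoint_sub (P : ℝ) (M : ℕ) (w w' : Fin M) :
    signalPoint P M w - signalPoint P M w' = (((w : ℕ) : ℝ) - ((w' : ℕ) : ℝ)) * signalSpacing P M := by
  unfold signalPoint signalSpacing; ring

theorem signalPoint_sq_le {P : ℝ} (hP : 0 < P) {M : ℕ} (hM : 2 ≤ M) (w : Fin M) :
    signalPoint P M w ^ 2 ≤ P := by
  have h : (2 : ℝ) ≤ M := by exact_mod_cast hM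
  have h1 : (0 : ℝ) < M - 1 := by linarith
  have hw : ((w : ℕ) : ℝ) ≤ M - 1 := by
    have : (w : ℕ) + 1 ≤ M := w.isLt
    have : (((w : ℕ) + 1 : ℕ) : ℝ) ≤ M := by exact_mod_cast this
    push_cast at this; linarith
  have h2 : signalPoint P M w = Real.sqrt P * (2 * (((w : ℕ) : ℝ) / (M - 1)) - 1) := by
    unfold signalPoint; ring
  have h3 : ((w : ℕ) : ℝ) / (M - 1) ≤ 1 := (div_le_one h1).mpr hw
  have h4 : 0 ≤ ((w : ℕ) : ℝ) / (M - 1) := by positivity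
  rw [h2, mul_pow, Real.sq_sqrt hP.le]
  refine mul_le_of_le_one_right hP.le ?_
  nlinarith

/-- An error of a filter code requires a large estimation error. -/
theorem IsFilterCode.spacing_le_of_error {M n : ℕ} {α P β σ : ℝ} {c : FeedbackCode ℝ M n}
    (hc : IsFilterCode α P β σ c) (hP : 0 < P) (hM : 2 ≤ M) (hn : 1 ≤ n) {w : Fin M} {u : ℕ → ℝ}
    (he : c.dec (revealed u) (fun i : Fin n => c.output w (revealed u) (maNoise α u) i) ≠ w) :
    signalSpacing P M / 2 ≤ |estimateNoise α β σ n u / precision α β σ n| := by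
  obtain ⟨t, ht, hmin⟩ := hc.2 (revealed u)
    (fun i : Fin n => c.output w (revealed u) (maNoise α u) i)
  simp only [hc.output_eq] at ht hmin he
  rw [isMLEstimate_iff hn, revealed, mlEstimate_arOutput hn] at ht
  set w' := c.dec (revealed u) (fun i : Fin n => arOutput α β σ (signalPoint P M w) u i)
  have h1 := hmin w
  have h2 : t - signalPoint P M w = -(estimateNoise α β σ n u / precision α β σ n) := by
    rw [ht]; ring
  have h3 : |signalPoint P M w' - signalPoint P M w| ≤
      |t - signalPoint P M w'| + |t - signalPoint P M w| := by
    rw [abs_sub_comm t (signalPoint P M w')]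
    exact abs_sub_le _ _ _
  have hs := signalSpacing_pos hP hM
  have h4 : signalSpacing P M ≤ |signalPoint P M w' - signalPoint P M w| := by
    rw [signalPoint_sub, abs_mul, abs_of_pos hs]
    refine le_mul_of_one_le_left hs.le ?_
    have h5 : ((w' : ℕ) : ℤ) - ((w : ℕ) : ℤ) ≠ 0 := by
      intro h
      exact he (Fin.ext (by omega))
    have h6 := Int.one_le_abs h5
    have h7 : (1 : ℝ) ≤ ((|((w' : ℕ) : ℤ) - ((w : ℕ) : ℤ)| : ℤ) : ℝ) := by exact_mod_cast h6
    push_cast at h7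
    exact h7
  rw [h2, abs_neg] at h1 h3
  linarith

/-- A large estimation error towards the interior of the constellation is a decoding error. -/
theorem IsFilterCode.error_of_spacing_lt {M n : ℕ} {α P β σ : ℝ} {c : FeedbackCode ℝ M n}
    (hc : IsFilterCode α P β σ c) (hP : 0 < P) (hM : 2 ≤ M) (hn : 1 ≤ n) (w : Fin M) :
    ∃ r : ℝ, (r = 1 ∨ r = -1) ∧ ∀ u : ℕ → ℝ,
      signalSpacing P M / 2 < r * (estimateNoise α β σ n u / precision α β σ n) →
      c.dec (revealed u) (fun i : Fin n => c.output w (revealed u) (maNoise α u) i) ≠ w := by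
  have hs := signalSpacing_pos hP hM
  -- The right neighbour is used, except for the last point, whose left neighbour exists because M ≥
  -- 2. The sign r records the direction; a one-sided tail suffices.
  obtain ⟨w', r, hr, hww⟩ : ∃ (w' : Fin M) (r : ℝ), (r = 1 ∨ r = -1) ∧
      signalPoint P M w' - signalPoint P M w = -r * signalSpacing P M := by
    by_cases hw : (w : ℕ) + 1 < M
    · refine ⟨⟨w + 1, hw⟩, -1, Or.inr rfl, ?_⟩
      rw [signalPoint_sub]; push_cast; ring
    · refine ⟨⟨w - 1, by omega⟩, 1, Or.inl rfl, ?_⟩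
      rw [signalPoint_sub, Nat.cast_sub (by omega)]; push_cast; ring
  refine ⟨r, hr, fun u hu he => ?_⟩
  obtain ⟨t, ht, hmin⟩ := hc.2 (revealed u)
    (fun i : Fin n => c.output w (revealed u) (maNoise α u) i)
  rw [he] at hmin
  simp only [hc.output_eq] at ht
  rw [isMLEstimate_iff hn, revealed, mlEstimate_arOutput hn] at ht
  have h1 := hmin w'
  set N := estimateNoise α β σ n u / precision α β σ n
  have h2 : t - signalPoint P M w = -N := by rw [ht]; ring
  have h3 : t - signalPoint P M w' = -N + r * signalSpacing P M := by linarith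
  rw [h2, h3, ← sq_le_sq] at h1
  rcases hr with rfl | rfl <;> nlinarith

/-! ### Power of the filter scheme -/

theorem integral_arInput_sq (β σ x : ℝ) (k : ℕ) :
    MemLp (fun u => arInput β σ x u k) 2 innovationLaw ∧
    ∫ u, arInput β σ x u (k + 1) ^ 2 ∂innovationLaw =
      β ^ 2 * ∫ u, arInput β σ x u k ^ 2 ∂innovationLaw + σ ^ 2 := by
  have hL : MemLp (fun u => arInput β σ x u k) 2 innovationLaw := by
    induction k with
    | zero => exact memLp_const x
    | succ k ih =>
      simp only [arInput]
      exact (ih.const_mul β).add ((memLp_innovation _).const_mul σ)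
  exact ⟨hL, integral_past_add_innovation_sq (measurable_arInput β σ x k)
    (fun u v h => arInput_congr fun j _ hj => h j (by omega)) hL β σ⟩

/-- P is the fixed point of the affine variance recursion q ↦ β² q + P(1 - β²), so every message,
having initial energy at most P, stays below P at all times. -/
theorem FilterRelations.integral_arInput_sq_le {α P x β σ θ : ℝ} (h : FilterRelations α P x β σ)
    (hθ : θ ^ 2 ≤ P) (k : ℕ) : ∫ u, arInput β σ θ u k ^ 2 ∂innovationLaw ≤ P := by
  induction k with
  | zero => simpa [arInput] using hθ
  | succ k ih =>
    rw [(integral_arInput_sq β σ θ k).2, h.gain_sq]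
    nlinarith [sq_nonneg β]

theorem lintegral_sq_le_of_integral_le {f : (ℕ → ℝ) → ℝ} (hf : MemLp f 2 innovationLaw) {P : ℝ}
    (h : ∫ u, f u ^ 2 ∂innovationLaw ≤ P) :
    ∫⁻ u, ENNReal.ofReal (f u ^ 2) ∂innovationLaw ≤ ENNReal.ofReal P := by
  rw [← ofReal_integral_eq_lintegral_ofReal hf.integrable_sq (ae_of_all _ fun u => sq_nonneg _)]
  exact ENNReal.ofReal_le_ofReal h

theorem powerConstraint_of_forall_le {S : Type} [MeasurableSpace S] {M n : ℕ}
    {c : FeedbackCode S M n} {side : (ℕ → ℝ) → S} {α P : ℝ} (hM : M ≠ 0)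
    (h : ∀ w, ∀ i < n, ∫⁻ u, ENNReal.ofReal (c.input w (side u) (maNoise α u) i ^ 2)
      ∂innovationLaw ≤ ENNReal.ofReal P) : c.PowerConstraint side α P := by
  have h1 : ∑ w : Fin M, ∑ i ∈ Finset.range n,
      ∫⁻ u, ENNReal.ofReal (c.input w (side u) (maNoise α u) i ^ 2) ∂innovationLaw ≤
      M * (n * ENNReal.ofReal P) := by
    refine (Finset.sum_le_sum fun w _ => Finset.sum_le_sum fun i hi =>
      h w i (Finset.mem_range.mp hi)).trans ?_
    simp
  refine (mul_le_mul_right h1 _).trans ?_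
  rw [← mul_assoc, ENNReal.inv_mul_cancel (by exact_mod_cast hM) (ENNReal.natCast_ne_top M),
    one_mul, ENNReal.ofReal_mul (by positivity), ENNReal.ofReal_natCast]

theorem FilterRelations.powerConstraint {α P x β σ : ℝ} (h : FilterRelations α P x β σ) {M n : ℕ}
    (hM : 2 ≤ M) {c : FeedbackCode ℝ M n} (hc : IsFilterCode α P β σ c) :
    c.PowerConstraint revealed α P := by
  refine powerConstraint_of_forall_le (by omega) fun w i hi => ?_
  simp only [hc.1 w _ i hi]
  exact lintegral_sq_le_of_integral_le (integral_arInput_sq _ _ _ i).1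
    (h.integral_arInput_sq_le (signalPoint_sq_le h.power_pos hM w) i)

end MA1Feedback

namespace MA1Feedback

/-! ### Gaussian tails -/

/-- Chernoff's bound in both directions, with the optimal parameter ρ. -/
theorem gaussian_tail_le {ρ : ℝ} (hρ : 0 ≤ ρ) :
    (gaussianReal 0 1).real {x | ρ ≤ |x|} ≤ 2 * Real.exp (-(ρ ^ 2 / 2)) := by
  have hmgf : mgf id (gaussianReal 0 1) ρ = Real.exp (ρ ^ 2 / 2) := by
    rw [mgf_id_gaussianReal]; simp
  have h1 : (gaussianReal 0 1).real {x | ρ ≤ id x} ≤ Real.exp (-(ρ ^ 2 / 2)) := by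
    have h := measure_ge_le_exp_mul_mgf (μ := gaussianReal 0 1) (X := id) ρ hρ
      (integrable_exp_mul_gaussianReal ρ)
    rw [hmgf, ← Real.exp_add] at h
    refine h.trans_eq (congrArg Real.exp ?_)
    ring
  have hmgf' : mgf id (gaussianReal 0 1) (-ρ) = Real.exp (ρ ^ 2 / 2) := by
    rw [mgf_id_gaussianReal]; simp
  have h2 : (gaussianReal 0 1).real {x | id x ≤ -ρ} ≤ Real.exp (-(ρ ^ 2 / 2)) := by
    have h := measure_le_le_exp_mul_mgf (μ := gaussianReal 0 1) (X := id) (-ρ)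
      (neg_nonpos.mpr hρ) (integrable_exp_mul_gaussianReal (-ρ))
    rw [hmgf', ← Real.exp_add] at h
    refine h.trans_eq (congrArg Real.exp ?_)
    ring
  have h3 : {x : ℝ | ρ ≤ |x|} ⊆ {x | ρ ≤ id x} ∪ {x | id x ≤ -ρ} := by
    intro x hx
    rcases le_abs.mp (show ρ ≤ |x| from hx) with h | h
    · exact Or.inl h
    · exact Or.inr (show x ≤ -ρ by linarith)
  refine (measureReal_mono h3).trans ((measureReal_union_le _ _).trans ?_)
  linarith

/-- The mass of (ρ, ρ + 1] alone suffices: the density there is at least exp(-1 - (ρ + 1)²/2)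
because 2π < e², and for ρ ≥ 1 this is at least exp(-3ρ²). -/
theorem le_gaussian_tail {ρ : ℝ} (hρ : 1 ≤ ρ) :
    Real.exp (-(3 * ρ ^ 2)) ≤ (gaussianReal 0 1).real (Set.Ioi ρ) := by
  have hsub : Set.Ioc ρ (ρ + 1) ⊆ Set.Ioi ρ := fun x hx => hx.1
  refine le_trans ?_ (measureReal_mono hsub)
  have h1 : (gaussianReal 0 1).real (Set.Ioc ρ (ρ + 1)) =
      ∫ x in Set.Ioc ρ (ρ + 1), gaussianPDFReal 0 1 x := by
    rw [Measure.real, gaussianReal_apply_eq_integral _ one_ne_zero,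
      ENNReal.toReal_ofReal (integral_nonneg fun x => gaussianPDFReal_nonneg _ _ _)]
  have h2 : ∀ x ∈ Set.Ioc ρ (ρ + 1), Real.exp (-(3 * ρ ^ 2)) ≤ gaussianPDFReal 0 1 x := by
    intro x hx
    have h3 : Real.exp (-1) ≤ (Real.sqrt (2 * Real.pi * (1 : NNReal)))⁻¹ := by
      rw [Real.exp_neg]
      refine inv_anti₀ (by positivity) ?_
      rw [Real.sqrt_le_left (Real.exp_pos 1).le]
      have h4 := Real.exp_one_gt_d9
      have h5 := Real.pi_lt_d2
      rw [NNReal.coe_one]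
      nlinarith
    calc Real.exp (-(3 * ρ ^ 2)) ≤ Real.exp (-1) * Real.exp (-(ρ + 1) ^ 2 / 2) := by
          rw [← Real.exp_add, Real.exp_le_exp]; nlinarith
      _ ≤ _ := by
          unfold gaussianPDFReal
          refine mul_le_mul h3 ?_ (Real.exp_pos _).le (by positivity)
          rw [Real.exp_le_exp]
          have h6 : x ^ 2 ≤ (ρ + 1) ^ 2 := by
            have := hx.1; have := hx.2
            exact pow_le_pow_left₀ (by linarith) this 2
          simp
          linarith
  rw [h1]
  have h7 := setIntegral_mono_on (integrableOn_const (C := Real.exp (-(3 * ρ ^ 2))) (by simp))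
    (integrable_gaussianPDFReal 0 1).integrableOn measurableSet_Ioc h2
  simpa using h7

/-! ### The error probability of filter codes -/

theorem measurable_estimateNoise (α β σ : ℝ) (n : ℕ) : Measurable (estimateNoise α β σ n) :=
  Finset.measurable_fun_sum _ fun _ _ => (measurable_pi_apply _).const_mul _

theorem map_estimateNoise (α β σ : ℝ) (n : ℕ) :
    innovationLaw.map (estimateNoise α β σ n) = gaussianReal 0 (precision α β σ n).toNNReal := by
  induction n with
  | zero =>
    have : estimateNoise α β σ 0 = fun _ => 0 := by funext u; simp [estimateNoise]
    simp [this, precision]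
  | succ n ih =>
    set d := inputSensitivity α β σ (n + 1)
    have h1 : estimateNoise α β σ (n + 1) =
        estimateNoise α β σ n + fun u => d * u (n + 1) := by
      funext u; simp [estimateNoise, Fin.sum_univ_castSucc, d]
    have h2 : precision α β σ (n + 1) = precision α β σ n + d ^ 2 := by
      simp [precision, Fin.sum_univ_castSucc, d]
    have hind : IndepFun (estimateNoise α β σ n) (fun u => d * u (n + 1)) innovationLaw := by
      have h := indepFun_innovation_of_past (measurable_estimateNoise α β σ n) (i := n + 1)
        fun u v h => Finset.sum_congr rfl fun i _ => by rw [h _ (by omega)]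
      exact h.comp measurable_id (measurable_id.const_mul d)
    have h3 : innovationLaw.map (fun u => d * u (n + 1)) = gaussianReal 0 (d ^ 2).toNNReal := by
      have h4 := gaussianReal_map_const_mul (μ := 0) (v := 1) d
      rw [← innovationLaw_map_eval (n + 1), Measure.map_map (by fun_prop) (by fun_prop)] at h4
      rw [show (fun u : ℕ → ℝ => d * u (n + 1)) = (fun x => d * x) ∘ fun u => u (n + 1) from rfl, h4]
      congr 1
      · simp
      · ext; simp [sq_nonneg]
    have hnn : 0 ≤ precision α β σ n := Finset.sum_nonneg fun i _ => sq_nonneg _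
    have := gaussianReal_add_gaussianReal_of_indepFun hind ih h3
    rw [h1, h2, this, Real.toNNReal_add hnn (sq_nonneg d), add_zero]

/-- The sign r comes for free by symmetry, so one tail estimate serves errors towards either
neighbour. -/
theorem map_normalized_estimateNoise (α β σ : ℝ) {n : ℕ} (hn : 1 ≤ n) {r : ℝ}
    (hr : r = 1 ∨ r = -1) :
    innovationLaw.map (fun u => r / Real.sqrt (precision α β σ n) * estimateNoise α β σ n u) =
      gaussianReal 0 1 := by
  have hD : 0 < precision α β σ n := one_pos.trans_le (one_le_precision α β σ hn)
  have h := gaussianReal_map_const_mul (μ := 0) (v := (precision α β σ n).toNNReal)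
    (r / Real.sqrt (precision α β σ n))
  rw [← map_estimateNoise, Measure.map_map (by fun_prop) (measurable_estimateNoise α β σ n)] at h
  refine h.trans ?_
  have hr2 : r ^ 2 = 1 := by rcases hr with rfl | rfl <;> norm_num
  congr 1
  · simp
  · ext
    simp [hD.le, div_pow, hr2, hD.ne']

/-- Half the spacing of the signal points in units of the standard deviation of the estimate. -/
noncomputable def normalizedSpacing (α β σ P : ℝ) (M n : ℕ) : ℝ :=
  signalSpacing P M / 2 * Real.sqrt (precision α β σ n)

section ErrorProb

variable {M n : ℕ} {α P β σ : ℝ} {c : FeedbackCode ℝ M n}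

theorem div_precision_eq (hn : 1 ≤ n) (a : ℝ) :
    a / Real.sqrt (precision α β σ n) = a / precision α β σ n * Real.sqrt (precision α β σ n) := by
  have hD : 0 < precision α β σ n := one_pos.trans_le (one_le_precision α β σ hn)
  rw [div_mul_eq_mul_div, div_eq_div_iff (Real.sqrt_pos.mpr hD).ne' hD.ne', mul_assoc,
    Real.mul_self_sqrt hD.le]

theorem IsFilterCode.errorProb_le (hc : IsFilterCode α P β σ c) (hP : 0 < P) (hM : 2 ≤ M)
    (hn : 1 ≤ n) : c.errorProb revealed α ≤
      2 * Real.exp (-(normalizedSpacing α β σ P M n ^ 2 / 2)) := by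
  have hD : 0 < precision α β σ n := one_pos.trans_le (one_le_precision α β σ hn)
  have hM0 : (0 : ℝ) < M := by positivity
  have hρ : 0 ≤ normalizedSpacing α β σ P M n :=
    mul_nonneg (half_pos (signalSpacing_pos hP hM)).le (Real.sqrt_nonneg _)
  have key : ∀ w : Fin M, innovationLaw.real
      {u | c.dec (revealed u) (fun i : Fin n => c.output w (revealed u) (maNoise α u) i) ≠ w} ≤
      2 * Real.exp (-(normalizedSpacing α β σ P M n ^ 2 / 2)) := by
    intro w
    refine le_trans ?_ (gaussian_tail_le hρ)
    have hm : Measurable fun u => 1 / Real.sqrt (precision α β σ n) * estimateNoise α β σ n u :=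
      (measurable_estimateNoise α β σ n).const_mul _
    rw [← map_normalized_estimateNoise α β σ hn (Or.inl rfl),
      map_measureReal_apply hm (measurableSet_le measurable_const measurable_abs)]
    refine measureReal_mono fun u hu => ?_
    have h1 := hc.spacing_le_of_error hP hM hn hu
    have h2 := mul_le_mul_of_nonneg_right h1 (Real.sqrt_nonneg (precision α β σ n))
    rw [← abs_of_nonneg (Real.sqrt_nonneg (precision α β σ n)), ← abs_mul,
      abs_of_nonneg (Real.sqrt_nonneg (precision α β σ n)), ← div_precision_eq hn] at h2
    change normalizedSpacing α β σ P M n ≤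
      |1 / Real.sqrt (precision α β σ n) * estimateNoise α β σ n u|
    rwa [one_div_mul_eq_div]
  unfold FeedbackCode.errorProb
  rw [inv_mul_le_iff₀ hM0]
  refine (Finset.sum_le_sum fun w _ => key w).trans (le_of_eq ?_)
  simp

theorem IsFilterCode.le_errorProb (hc : IsFilterCode α P β σ c) (hP : 0 < P) (hM : 2 ≤ M)
    (hn : 1 ≤ n) (hρ : 1 ≤ normalizedSpacing α β σ P M n) :
    Real.exp (-(3 * normalizedSpacing α β σ P M n ^ 2)) ≤ c.errorProb revealed α := by
  have hD : 0 < precision α β σ n := one_pos.trans_le (one_le_precision α β σ hn)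
  have hM0 : (0 : ℝ) < M := by positivity
  have key : ∀ w : Fin M, Real.exp (-(3 * normalizedSpacing α β σ P M n ^ 2)) ≤ innovationLaw.real
      {u | c.dec (revealed u) (fun i : Fin n => c.output w (revealed u) (maNoise α u) i) ≠ w} := by
    intro w
    obtain ⟨r, hr, hw⟩ := hc.error_of_spacing_lt hP hM hn w
    refine (le_gaussian_tail hρ).trans ?_
    have hm : Measurable fun u => r / Real.sqrt (precision α β σ n) * estimateNoise α β σ n u :=
      (measurable_estimateNoise α β σ n).const_mul _
    rw [← map_normalized_estimateNoise α β σ hn hr,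
      map_measureReal_apply hm measurableSet_Ioi]
    refine measureReal_mono fun u hu => hw u ?_
    have h1 : normalizedSpacing α β σ P M n <
        r / Real.sqrt (precision α β σ n) * estimateNoise α β σ n u := hu
    rw [div_mul_eq_mul_div, div_precision_eq hn, mul_div_assoc] at h1
    exact lt_of_mul_lt_mul_right h1 (Real.sqrt_nonneg _)
  unfold FeedbackCode.errorProb
  rw [le_inv_mul_iff₀ hM0]
  refine le_trans (le_of_eq ?_) (Finset.sum_le_sum fun w _ => key w)
  simp

end ErrorProb

theorem normalizedSpacing_sq {α β σ P : ℝ} (hP : 0 < P) (M : ℕ) (n : ℕ) :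
    normalizedSpacing α β σ P M n ^ 2 = P * precision α β σ n / ((M : ℝ) - 1) ^ 2 := by
  have hD : 0 ≤ precision α β σ n := Finset.sum_nonneg fun i _ => sq_nonneg _
  unfold normalizedSpacing signalSpacing
  rw [mul_pow, Real.sq_sqrt hD, div_pow, div_pow, mul_pow, Real.sq_sqrt hP.le]
  ring

theorem two_le_ceil_rpow {r : ℝ} (hr : 0 < r) : 2 ≤ ⌈(2 : ℝ) ^ r⌉₊ :=
  Nat.lt_ceil.mpr (by simpa using Real.one_lt_rpow one_lt_two hr)

theorem ceil_rpow_bounds {r : ℝ} (hr : 0 < r) :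
    (2 : ℝ) ^ r / 2 ≤ (⌈(2 : ℝ) ^ r⌉₊ : ℝ) - 1 ∧ (⌈(2 : ℝ) ^ r⌉₊ : ℝ) - 1 ≤ (2 : ℝ) ^ r := by
  have h1 : (2 : ℝ) ≤ ⌈(2 : ℝ) ^ r⌉₊ := by exact_mod_cast two_le_ceil_rpow hr
  have h2 := Nat.le_ceil ((2 : ℝ) ^ r)
  have h3 := Nat.ceil_lt_add_one (Real.rpow_nonneg zero_le_two r)
  constructor <;> linarith

theorem inv_pow_eq_rpow {x : ℝ} (hx : 0 < x) (n : ℕ) :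
    x⁻¹ ^ n = (2 : ℝ) ^ ((n : ℝ) * -Real.logb 2 x) := by
  rw [mul_comm, Real.rpow_mul zero_le_two, Real.rpow_neg zero_le_two,
    Real.rpow_logb two_pos (by norm_num) hx, Real.rpow_natCast]

/-- The normalized spacing grows exponentially at rates below capacity. -/
theorem FilterRelations.normalizedSpacing_bounds {α P x β σ : ℝ} (h : FilterRelations α P x β σ) :
    ∃ A B : ℝ, 0 < A ∧ 0 < B ∧ ∀ (r : ℝ) (n : ℕ), 0 < r → 1 ≤ n →
      A * (2 : ℝ) ^ (2 * (n * -Real.logb 2 x - r)) ≤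
        normalizedSpacing α β σ P ⌈(2 : ℝ) ^ r⌉₊ n ^ 2 ∧
      normalizedSpacing α β σ P ⌈(2 : ℝ) ^ r⌉₊ n ^ 2 ≤
        B * (2 : ℝ) ^ (2 * (n * -Real.logb 2 x - r)) := by
  obtain ⟨K, hK, hKn⟩ := h.precision_le
  have hx := h.pos
  have hP := h.power_pos
  -- The two bounds on the precision, combined with 2^r / 2 ≤ M - 1 ≤ 2^r; the factor 4 comes from
  -- squaring the lower bound on M - 1.
  refine ⟨P * x ^ 2, 4 * P * K, by positivity, by positivity, fun r n hr hn => ?_⟩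
  have h1 := ceil_rpow_bounds hr
  have h2 := two_le_ceil_rpow hr
  set M := ⌈(2 : ℝ) ^ r⌉₊
  have hM : (2 : ℝ) ≤ M := by exact_mod_cast h2
  have hpos : (0 : ℝ) < (2 : ℝ) ^ r := by positivity
  have hM1 : (0 : ℝ) < (M : ℝ) - 1 := by linarith
  have hE : (2 : ℝ) ^ (2 * (n * -Real.logb 2 x - r)) = (x⁻¹ ^ n) ^ 2 / ((2 : ℝ) ^ r) ^ 2 := by
    rw [inv_pow_eq_rpow hx, mul_comm, Real.rpow_mul zero_le_two, Real.rpow_sub two_pos, ← div_pow]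
    norm_cast
  have hD1 := h.le_precision hn
  have hD2 := hKn n
  rw [normalizedSpacing_sq hP, hE]
  constructor
  · rw [mul_div_assoc']
    refine div_le_div₀ ?_ ?_ (by positivity) (pow_le_pow_left₀ hM1.le h1.2 2)
    · exact mul_nonneg hP.le (zero_le_one.trans (one_le_precision α β σ hn))
    · calc P * x ^ 2 * (x⁻¹ ^ n) ^ 2 = P * (x ^ 2 * (x⁻¹ ^ n) ^ 2) := by ring
        _ ≤ _ := mul_le_mul_of_nonneg_left hD1 hP.le
  · rw [show 4 * P * K * ((x⁻¹ ^ n) ^ 2 / ((2 : ℝ) ^ r) ^ 2) =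
      P * (K * (x⁻¹ ^ n) ^ 2) / ((2 : ℝ) ^ r / 2) ^ 2 by field_simp; ring]
    refine div_le_div₀ (by positivity) (mul_le_mul_of_nonneg_left hD2 hP.le) (by positivity)
      (pow_le_pow_left₀ (by positivity) h1.1 2)

theorem tendsto_two_rpow_atTop {a : ℝ} (ha : 0 < a) :
    Tendsto (fun n : ℕ => (2 : ℝ) ^ (2 * (n : ℝ) * a)) atTop atTop := by
  have h1 : ∀ n : ℕ, (2 : ℝ) ^ (2 * (n : ℝ) * a) = ((2 : ℝ) ^ (2 * a)) ^ n := by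
    intro n
    rw [← Real.rpow_natCast, ← Real.rpow_mul zero_le_two]
    congr 1; ring
  simp only [h1]
  exact tendsto_pow_atTop_atTop_of_one_lt (Real.one_lt_rpow one_lt_two (by linarith))

theorem FilterRelations.doubly_exponential {α P x β σ : ℝ} (h : FilterRelations α P x β σ) {R : ℝ}
    (hR : 0 < R) (hRC : R < -Real.logb 2 x) :
    ∃ a b : ℝ, 0 < a ∧ 0 < b ∧ ∀ᶠ n : ℕ in atTop,
      ∀ c : FeedbackCode ℝ (numMessages R n) n, IsFilterCode α P β σ c →
        Real.exp (-(b * (2 : ℝ) ^ (2 * (n : ℝ) * (-Real.logb 2 x - R)))) ≤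
            c.errorProb revealed α ∧
        c.errorProb revealed α ≤
          Real.exp (-(a * (2 : ℝ) ^ (2 * (n : ℝ) * (-Real.logb 2 x - R)))) := by
  obtain ⟨A, B, hA, hB, hAB⟩ := h.normalizedSpacing_bounds
  -- The 3 is the exponent of the lower tail, applicable once AE ≥ 1. In the upper bound the
  -- prefactor 2 ≤ e is absorbed by half of the exponent AE/2 once AE ≥ 4.
  refine ⟨A / 4, 3 * B, by positivity, by positivity, ?_⟩
  have hE := tendsto_two_rpow_atTop (sub_pos.mpr hRC)
  filter_upwards [eventually_ge_atTop 1, hE.eventually_ge_atTop (A⁻¹),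
    hE.eventually_ge_atTop (4 / A)] with n hn h1 h2 c hc
  have hn0 : (0 : ℝ) < n := by exact_mod_cast hn
  have hr : 0 < (n : ℝ) * R := mul_pos hn0 hR
  have hM : 2 ≤ numMessages R n := two_le_ceil_rpow hr
  obtain ⟨h3, h4⟩ := hAB (n * R) n hr hn
  rw [show 2 * ((n : ℝ) * -Real.logb 2 x - n * R) = 2 * (n : ℝ) * (-Real.logb 2 x - R) by ring]
    at h3 h4
  set E := (2 : ℝ) ^ (2 * (n : ℝ) * (-Real.logb 2 x - R))
  change A * E ≤ normalizedSpacing α β σ P (numMessages R n) n ^ 2 at h3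
  change normalizedSpacing α β σ P (numMessages R n) n ^ 2 ≤ B * E at h4
  have hρ0 : 0 ≤ normalizedSpacing α β σ P (numMessages R n) n :=
    mul_nonneg (half_pos (signalSpacing_pos h.power_pos hM)).le (Real.sqrt_nonneg _)
  constructor
  · refine le_trans ?_ (hc.le_errorProb h.power_pos hM hn ?_)
    · rw [Real.exp_le_exp]; linarith
    · rw [← one_le_sq_iff₀ hρ0]
      refine le_trans ?_ h3
      rwa [← inv_le_iff_one_le_mul₀' hA]
  · refine (hc.errorProb_le h.power_pos hM hn).trans ?_
    have h5 : (2 : ℝ) ≤ Real.exp 1 := by linarith [Real.exp_one_gt_d9]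
    have h6 : 4 ≤ A * E := by rwa [div_le_iff₀' hA] at h2
    calc 2 * Real.exp (-(normalizedSpacing α β σ P (numMessages R n) n ^ 2 / 2))
        ≤ Real.exp 1 * Real.exp (-(A * E / 2)) := by
          refine mul_le_mul h5 ?_ (Real.exp_pos _).le (Real.exp_pos _).le
          rw [Real.exp_le_exp]; linarith
      _ ≤ _ := by rw [← Real.exp_add, Real.exp_le_exp]; linarith

end MA1Feedback

namespace MA1Feedback

/-! ### Codes without side information -/

/-- Send zeros at the first `m` times, and then use a code with revealed initial innovation,
which is replaced by an estimate from the first `m` outputs. -/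
noncomputable def delayedCode {M n : ℕ} (m : ℕ) (est : (ℕ → ℝ) → ℝ) (hest : Measurable est)
    (c : FeedbackCode ℝ M (n - m)) : FeedbackCode Unit M n where
  enc i w _ y := if i < m then 0 else
    c.enc (i - m) w (est (zeroExtend y)) fun j => zeroExtend y (m + j)
  dec _ y := c.dec (est (zeroExtend y)) fun j => zeroExtend y (m + j)
  measurable_enc i w := by
    split_ifs with h
    · exact measurable_const
    · have hz : Measurable fun p : Unit × (Fin i → ℝ) => zeroExtend p.2 :=
        measurable_zeroExtend.comp measurable_snd
      exact (c.measurable_enc (i - m) w).comp ((hest.comp hz).prodMk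
        (measurable_pi_lambda _ fun j => (measurable_pi_apply (m + (j : ℕ))).comp hz))
  measurable_dec := by
    have hz : Measurable fun p : Unit × (Fin n → ℝ) => zeroExtend p.2 :=
      measurable_zeroExtend.comp measurable_snd
    exact c.measurable_dec.comp ((hest.comp hz).prodMk
      (measurable_pi_lambda _ fun j => (measurable_pi_apply (m + (j : ℕ))).comp hz))

section DelayedCode

variable {M n m : ℕ} {est : (ℕ → ℝ) → ℝ} {hest : Measurable est} {c : FeedbackCode ℝ M (n - m)}

theorem delayedCode_input_of_lt (w : Fin M) (z : ℕ → ℝ) {i : ℕ} (hi : i < m) :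
    (delayedCode m est hest c).input w () z i = 0 := by
  simp [FeedbackCode.input, delayedCode, hi]

theorem delayedCode_output_of_lt (w : Fin M) (z : ℕ → ℝ) {i : ℕ} (hi : i < m) :
    (delayedCode m est hest c).output w () z i = z i := by
  rw [FeedbackCode.output_eq, delayedCode_input_of_lt w z hi, zero_add]

theorem enc_congr {N k k' : ℕ} (c : FeedbackCode ℝ M N) (hk : k' = k) (w : Fin M) (s : ℝ)
    (f : ℕ → ℝ) : c.enc k' w s (fun j => f j) = c.enc k w s fun j => f j := by
  subst hk; rfl

/-- During the silent phase the outputs are the noise itself, so the estimate is computed from the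
true noise and is common to both ends. Afterwards the code behaves pathwise like the inner code with
that estimate as the revealed value and the time-shifted noise. -/
theorem delayedCode_input_add (hc : ∀ y y' : ℕ → ℝ, (∀ j < m, y j = y' j) → est y = est y')
    (w : Fin M) (z : ℕ → ℝ) (k : ℕ) :
    (delayedCode m est hest c).input w () z (m + k) =
      c.input w (est z) (fun j => z (m + j)) k := by
  induction k using Nat.strong_induction_on with
  | _ k ih =>
    have hout : ∀ j < k, (delayedCode m est hest c).output w () z (m + j) =
        c.output w (est z) (fun j => z (m + j)) j := by
      intro j hj
      rw [FeedbackCode.output_eq, FeedbackCode.output_eq, ih j hj]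
    set out := fun j : Fin (m + k) => (delayedCode m est hest c).output w () z j with houtdef
    have h1 : (delayedCode m est hest c).input w () z (m + k) =
        c.enc (m + k - m) w (est (zeroExtend out)) fun j => zeroExtend out (m + j) := by
      simp [FeedbackCode.input, delayedCode, out]
    have h2 : est (zeroExtend out) = est z := by
      refine hc _ _ fun j hj => ?_
      rw [zeroExtend_of_lt _ (by omega)]
      exact delayedCode_output_of_lt w z hj
    rw [h1, h2, enc_congr c (Nat.add_sub_cancel_left m k) w _ fun j => zeroExtend out (m + j),
      FeedbackCode.input]
    congr 1
    funext j
    rw [zeroExtend_of_lt _ (Nat.add_lt_add_left j.isLt m)]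
    exact hout j j.isLt

theorem delayedCode_output_add (hc : ∀ y y' : ℕ → ℝ, (∀ j < m, y j = y' j) → est y = est y')
    (w : Fin M) (z : ℕ → ℝ) (k : ℕ) :
    (delayedCode m est hest c).output w () z (m + k) =
      c.output w (est z) (fun j => z (m + j)) k := by
  rw [FeedbackCode.output_eq, FeedbackCode.output_eq, delayedCode_input_add hc]

theorem delayedCode_dec (hmn : m ≤ n)
    (hc : ∀ y y' : ℕ → ℝ, (∀ j < m, y j = y' j) → est y = est y') (w : Fin M) (z : ℕ → ℝ) :
    (delayedCode m est hest c).dec ()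
        (fun i : Fin n => (delayedCode m est hest c).output w () z i) =
      c.dec (est z) fun i : Fin (n - m) => c.output w (est z) (fun j => z (m + j)) i := by
  set out := fun j : Fin n => (delayedCode m est hest c).output w () z j with houtdef
  have h2 : est (zeroExtend out) = est z := by
    refine hc _ _ fun j hj => ?_
    rw [zeroExtend_of_lt _ (by omega)]
    exact delayedCode_output_of_lt w z hj
  change c.dec (est (zeroExtend out)) (fun j => zeroExtend out (m + j)) = _
  rw [h2]
  congr 1
  funext j
  rw [zeroExtend_of_lt _ (by omega)]
  exact delayedCode_output_add hc w z j

end DelayedCode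

/-! ### Estimating an innovation from the noise -/

/-- The innovations reconstructed from the noise with the initial value zero. -/
def pseudoInnovation (α : ℝ) (z : ℕ → ℝ) : ℕ → ℝ
  | 0 => 0
  | k + 1 => z k - α * pseudoInnovation α z k

/-- The noise determines the innovations exactly up to the solutions (-α)^k of the homogeneous
recursion. For |α| = 1 these do not decay, so starting from zero is not a good estimate and a
projection is needed. -/
theorem pseudoInnovation_maNoise (α : ℝ) (u : ℕ → ℝ) (k : ℕ) :
    pseudoInnovation α (maNoise α u) k = u k - (-α) ^ k * u 0 := by
  induction k with
  | zero => simp [pseudoInnovation]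
  | succ k ih => simp only [pseudoInnovation, ih, maNoise, pow_succ]; ring

theorem pseudoInnovation_congr (α : ℝ) {z z' : ℕ → ℝ} {k : ℕ} (h : ∀ j < k, z j = z' j) :
    pseudoInnovation α z k = pseudoInnovation α z' k := by
  induction k with
  | zero => rfl
  | succ k ih =>
    simp only [pseudoInnovation, h k k.lt_succ_self, ih fun j hj => h j (by omega)]

theorem measurable_pseudoInnovation (α : ℝ) (k : ℕ) :
    Measurable fun z => pseudoInnovation α z k := by
  induction k with
  | zero => exact measurable_const
  | succ k ih => simp only [pseudoInnovation]; fun_prop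

/-- The weight of the projection onto the direction which the noise does not reveal. -/
noncomputable def projectionWeight (α : ℝ) (m : ℕ) : ℝ :=
  (-α) ^ m / ∑ j ∈ Finset.range (m + 1), ((-α) ^ j) ^ 2

/-- The best linear estimate of `U m` from the first `m` values of the noise. -/
noncomputable def noiseEstimate (α : ℝ) (m : ℕ) (z : ℕ → ℝ) : ℝ :=
  pseudoInnovation α z m - projectionWeight α m *
    ∑ j ∈ Finset.range (m + 1), (-α) ^ j * pseudoInnovation α z j

/-- The error of `noiseEstimate`. -/
noncomputable def noiseEstimateError (α : ℝ) (m : ℕ) (u : ℕ → ℝ) : ℝ :=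
  projectionWeight α m * ∑ j ∈ Finset.range (m + 1), (-α) ^ j * u j

theorem measurable_noiseEstimate (α : ℝ) (m : ℕ) : Measurable (noiseEstimate α m) := by
  have h := measurable_pseudoInnovation α
  unfold noiseEstimate
  refine (h m).sub ((Finset.measurable_fun_sum _ fun j _ => (h j).const_mul _).const_mul _)

theorem noiseEstimate_congr (α : ℝ) {m : ℕ} {z z' : ℕ → ℝ} (h : ∀ j < m, z j = z' j) :
    noiseEstimate α m z = noiseEstimate α m z' := by
  unfold noiseEstimate
  rw [pseudoInnovation_congr α h]
  congr 2
  refine Finset.sum_congr rfl fun j hj => ?_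
  rw [pseudoInnovation_congr α fun i hi => h i (by have := Finset.mem_range.mp hj; omega)]

theorem sum_neg_pow_sq_pos (α : ℝ) (m : ℕ) :
    0 < ∑ j ∈ Finset.range (m + 1), ((-α) ^ j) ^ 2 := by
  rw [Finset.sum_range_succ']
  have : 0 ≤ ∑ k ∈ Finset.range m, ((-α) ^ (k + 1)) ^ 2 := Finset.sum_nonneg fun _ _ => sq_nonneg _
  simp only [pow_zero, one_pow]
  linarith

/-- Subtracting the projection onto ((-α)^j)_j cancels the unknown multiple of U 0; what remains as
error is the projection of the true innovations, at coordinate m. -/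
theorem noiseEstimate_maNoise (α : ℝ) (m : ℕ) (u : ℕ → ℝ) :
    noiseEstimate α m (maNoise α u) = u m - noiseEstimateError α m u := by
  have hw := (sum_neg_pow_sq_pos α m).ne'
  unfold noiseEstimate noiseEstimateError
  simp only [pseudoInnovation_maNoise]
  have h1 : ∑ j ∈ Finset.range (m + 1), (-α) ^ j * (u j - (-α) ^ j * u 0) =
      ∑ j ∈ Finset.range (m + 1), (-α) ^ j * u j -
        (∑ j ∈ Finset.range (m + 1), ((-α) ^ j) ^ 2) * u 0 := by
    rw [Finset.sum_mul, ← Finset.sum_sub_distrib]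
    exact Finset.sum_congr rfl fun j _ => by ring
  rw [h1, projectionWeight]
  field_simp
  ring

theorem integral_linear_sq (v : ℕ → ℝ) (k : ℕ) :
    MemLp (fun u : ℕ → ℝ => ∑ j ∈ Finset.range k, v j * u j) 2 innovationLaw ∧
    ∫ u, (∑ j ∈ Finset.range k, v j * u j) ^ 2 ∂innovationLaw = ∑ j ∈ Finset.range k, v j ^ 2 := by
  have hL : ∀ k, MemLp (fun u : ℕ → ℝ => ∑ j ∈ Finset.range k, v j * u j) 2 innovationLaw :=
    fun k => memLp_finsetSum _ fun j _ => (memLp_innovation j).const_mul _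
  refine ⟨hL k, ?_⟩
  induction k with
  | zero => simp
  | succ k ih =>
    have hm : Measurable fun u : ℕ → ℝ => ∑ j ∈ Finset.range k, v j * u j := by fun_prop
    have h := integral_past_add_innovation_sq hm (i := k)
      (fun u u' h => Finset.sum_congr rfl fun j hj => by rw [h j (Finset.mem_range.mp hj)])
      (hL k) 1 (v k)
    simp only [one_mul, one_pow] at h
    simp only [Finset.sum_range_succ]
    rw [h, ih]

theorem memLp_noiseEstimateError (α : ℝ) (m : ℕ) :
    MemLp (noiseEstimateError α m) 2 innovationLaw :=
  (integral_linear_sq _ _).1.const_mul _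

/-- The error variance is α^(2m) divided by ∑ α^(2j) over j ≤ m, and for |α| ≤ 1 the numerator is
the smallest of the m + 1 summands. -/
theorem integral_noiseEstimateError_sq_le {α : ℝ} (hα : |α| ≤ 1) (m : ℕ) :
    ∫ u, noiseEstimateError α m u ^ 2 ∂innovationLaw ≤ 1 / ((m : ℝ) + 1) := by
  have hw := sum_neg_pow_sq_pos α m
  simp only [noiseEstimateError, mul_pow]
  rw [integral_const_mul, (integral_linear_sq _ _).2, projectionWeight, div_pow]
  set W := ∑ j ∈ Finset.range (m + 1), ((-α) ^ j) ^ 2 with hW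
  have h1 : ((m : ℝ) + 1) * ((-α) ^ m) ^ 2 ≤ W := by
    have h2 : ∑ j ∈ Finset.range (m + 1), ((-α) ^ m) ^ 2 ≤ W := by
      refine Finset.sum_le_sum fun j hj => ?_
      rw [← sq_abs, ← sq_abs ((-α) ^ j), abs_pow, abs_pow, abs_neg]
      have : j ≤ m := by have := Finset.mem_range.mp hj; omega
      exact pow_le_pow_left₀ (by positivity) (pow_le_pow_of_le_one (abs_nonneg α) hα this) 2
    simpa using h2
  have hm : (0 : ℝ) < m + 1 := by positivity
  rw [show ((-α) ^ m) ^ 2 / W ^ 2 * W = ((-α) ^ m) ^ 2 / W by field_simp,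
    div_le_div_iff₀ hw hm]
  linarith

/-- The innovations as they appear to the users of a delayed code. -/
noncomputable def shiftedInnovation (α : ℝ) (m : ℕ) (u : ℕ → ℝ) (k : ℕ) : ℝ :=
  u (m + k) - (-α) ^ k * noiseEstimateError α m u

/-- The correction (-α)^k is annihilated by the moving average filter. Hence the modified
innovations generate the actual noise, while their value at 0 is the estimate: all pathwise facts
about filter codes apply to them, and only their law differs. -/
theorem maNoise_shiftedInnovation (α : ℝ) (m : ℕ) (u : ℕ → ℝ) :
    maNoise α (shiftedInnovation α m u) = fun k => maNoise α u (m + k) := by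
  funext k
  simp only [maNoise, shiftedInnovation, pow_succ, add_assoc]
  ring

theorem revealed_shiftedInnovation (α : ℝ) (m : ℕ) (u : ℕ → ℝ) :
    revealed (shiftedInnovation α m u) = noiseEstimate α m (maNoise α u) := by
  simp [revealed, shiftedInnovation, noiseEstimate_maNoise]

theorem memLp_shiftedInnovation (α : ℝ) (m k : ℕ) :
    MemLp (fun u => shiftedInnovation α m u k) 2 innovationLaw :=
  (memLp_innovation _).sub ((memLp_noiseEstimateError α m).const_mul _)

theorem integral_shiftedInnovation_sq_le {α : ℝ} (hα : |α| ≤ 1) (m k : ℕ) :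
    ∫ u, shiftedInnovation α m u k ^ 2 ∂innovationLaw ≤ 4 := by
  have h1 := (memLp_innovation (m + k)).integrable_sq
  have h2 := (memLp_noiseEstimateError α m).integrable_sq
  have h3 : ∀ u, shiftedInnovation α m u k ^ 2 ≤
      2 * u (m + k) ^ 2 + 2 * noiseEstimateError α m u ^ 2 := by
    intro u
    have h4 : ((-α) ^ k * noiseEstimateError α m u) ^ 2 ≤ noiseEstimateError α m u ^ 2 := by
      rw [mul_pow]
      refine mul_le_of_le_one_left (sq_nonneg _) ?_
      rw [← sq_abs, abs_pow, abs_neg]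
      exact pow_le_one₀ (by positivity) (pow_le_one₀ (abs_nonneg α) hα)
    unfold shiftedInnovation
    nlinarith [sq_nonneg (u (m + k) + (-α) ^ k * noiseEstimateError α m u)]
  have h5 := integral_mono (memLp_shiftedInnovation α m k).integrable_sq
    ((h1.const_mul 2).add (h2.const_mul 2)) h3
  simp only [Pi.add_apply] at h5
  rw [integral_add (h1.const_mul 2) (h2.const_mul 2), integral_const_mul, integral_const_mul,
    integral_innovation_sq] at h5
  have h6 := integral_noiseEstimateError_sq_le hα m
  have h7 : 1 / ((m : ℝ) + 1) ≤ 1 := by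
    rw [div_le_one (by positivity)]
    have : (0 : ℝ) ≤ m := by positivity
    linarith
  linarith

/-! ### Power and error of delayed filter codes -/

theorem arInput_add_mul (β σ x a : ℝ) (u v : ℕ → ℝ) (k : ℕ) :
    arInput β σ x (fun j => u j - v j * a) k = arInput β σ x u k - arInput β σ 0 v k * a := by
  induction k with
  | zero => simp [arInput]
  | succ k ih => simp only [arInput, ih]; ring

/-- Stability of the autoregression: the response to the correction sequence is bounded uniformly in
time, so a small estimation error adds little power at every index. -/
theorem abs_arInput_zero_le {β σ : ℝ} (hβ : |β| < 1) {v : ℕ → ℝ} (hv : ∀ j, |v j| ≤ 1) (k : ℕ) :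
    |arInput β σ 0 v k| ≤ |σ| / (1 - |β|) := by
  have h1 : 0 < 1 - |β| := by linarith
  induction k with
  | zero => simp only [arInput, abs_zero]; positivity
  | succ k ih =>
    simp only [arInput]
    calc |β * arInput β σ 0 v k + σ * v (k + 1)|
        ≤ |β| * |arInput β σ 0 v k| + |σ| * |v (k + 1)| := by
          rw [← abs_mul, ← abs_mul]; exact abs_add_le _ _
      _ ≤ |β| * (|σ| / (1 - |β|)) + |σ| * 1 := by gcongr; exact hv _
      _ = |σ| / (1 - |β|) := by field_simp; ring

theorem integral_shift_sq (f : (ℕ → ℝ) → ℝ) (hf : Measurable f) (m : ℕ) :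
    ∫ u, f (fun k => u (m + k)) ^ 2 ∂innovationLaw = ∫ u, f u ^ 2 ∂innovationLaw := by
  conv_rhs => rw [← innovationLaw_map_shift m]
  have hm : Measurable fun (u : ℕ → ℝ) (k : ℕ) => u (m + k) := by fun_prop
  rw [integral_map hm.aemeasurable (hf.pow_const 2).aestronglyMeasurable]

theorem memLp_shift {f : (ℕ → ℝ) → ℝ} (hf : MemLp f 2 innovationLaw) (m : ℕ) :
    MemLp (fun u => f fun k => u (m + k)) 2 innovationLaw := by
  have h : MeasurePreserving (fun (u : ℕ → ℝ) k => u (m + k)) innovationLaw innovationLaw :=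
    ⟨by fun_prop, innovationLaw_map_shift m⟩
  exact hf.comp_measurePreserving h

/-- The power of the filter scheme with an estimated initial innovation. -/
theorem FilterRelations.exists_delay {α P x β σ : ℝ} (h : FilterRelations α P x β σ) {Q : ℝ}
    (hQ : P < Q) : ∃ m : ℕ, ∀ (θ : ℝ) (k : ℕ), θ ^ 2 ≤ P →
      MemLp (fun u => arInput β σ θ (shiftedInnovation α m u) k) 2 innovationLaw ∧
      ∫ u, arInput β σ θ (shiftedInnovation α m u) k ^ 2 ∂innovationLaw ≤ Q := by
  have hP := h.power_pos
  set B := |σ| / (1 - |β|) with hB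
  -- Chosen so that (1 + η)P = (Q + P)/2. The main term then uses half of the slack Q - P, and m
  -- below is chosen so that the error term uses at most the other half.
  set η := (Q - P) / (2 * P) with hη
  have hηpos : 0 < η := div_pos (by linarith) (by linarith)
  obtain ⟨m, hm⟩ := exists_nat_ge ((1 + 1 / η) * B ^ 2 / ((Q - P) / 2))
  refine ⟨m, fun θ k hθ => ?_⟩
  set A : (ℕ → ℝ) → ℝ := fun u => arInput β σ θ (fun k => u (m + k)) k with hA
  set b := arInput β σ 0 (fun j => (-α) ^ j) k
  have heq : ∀ u, arInput β σ θ (shiftedInnovation α m u) k = A u - b * noiseEstimateError α m u :=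
    fun u => arInput_add_mul β σ θ _ _ _ k
  have hAL : MemLp A 2 innovationLaw := memLp_shift (integral_arInput_sq β σ θ k).1 m
  have heL := memLp_noiseEstimateError α m
  have hb : b ^ 2 ≤ B ^ 2 := by
    rw [← sq_abs]
    refine pow_le_pow_left₀ (abs_nonneg _) (abs_arInput_zero_le ?_ ?_ k) 2
    · rw [h.abs_coeff]; exact h.lt_one
    · intro j
      rw [abs_pow, abs_neg]
      exact pow_le_one₀ (abs_nonneg α) h.abs_le
  simp only [heq]
  have hL := hAL.sub (heL.const_mul b)
  refine ⟨hL, ?_⟩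
  have hpt : ∀ u, (A u - b * noiseEstimateError α m u) ^ 2 ≤
      (1 + η) * A u ^ 2 + (1 + 1 / η) * B ^ 2 * noiseEstimateError α m u ^ 2 := by
    intro u
    have h1 : (A u - b * noiseEstimateError α m u) ^ 2 ≤
        (1 + η) * A u ^ 2 + (1 + 1 / η) * (b * noiseEstimateError α m u) ^ 2 := by
      have h2 : 0 ≤ (η * A u + b * noiseEstimateError α m u) ^ 2 / η := by positivity
      have h3 : (η * A u + b * noiseEstimateError α m u) ^ 2 / η =
          (1 + η) * A u ^ 2 + (1 + 1 / η) * (b * noiseEstimateError α m u) ^ 2 -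
            (A u - b * noiseEstimateError α m u) ^ 2 := by field_simp; ring
      linarith
    refine h1.trans (add_le_add_right ?_ _)
    rw [mul_pow, ← mul_assoc]
    gcongr
  have h4 := integral_mono hL.integrable_sq
    ((hAL.integrable_sq.const_mul (1 + η)).add (heL.integrable_sq.const_mul ((1 + 1 / η) * B ^ 2)))
    hpt
  simp only [Pi.add_apply] at h4
  rw [integral_add (hAL.integrable_sq.const_mul _) (heL.integrable_sq.const_mul _),
    integral_const_mul, integral_const_mul] at h4
  refine h4.trans ?_
  have h5 : ∫ u, A u ^ 2 ∂innovationLaw ≤ P := by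
    rw [hA, integral_shift_sq (fun u => arInput β σ θ u k) (measurable_arInput β σ θ k) m]
    exact h.integral_arInput_sq_le hθ k
  have h6 := integral_noiseEstimateError_sq_le h.abs_le m
  have h7 : (1 + η) * ∫ u, A u ^ 2 ∂innovationLaw ≤ (Q + P) / 2 := by
    calc (1 + η) * ∫ u, A u ^ 2 ∂innovationLaw ≤ (1 + η) * P := by gcongr
      _ = (Q + P) / 2 := by rw [hη]; field_simp; ring
  have h8 : (1 + 1 / η) * B ^ 2 * ∫ u, noiseEstimateError α m u ^ 2 ∂innovationLaw ≤
      (Q - P) / 2 := by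
    calc (1 + 1 / η) * B ^ 2 * ∫ u, noiseEstimateError α m u ^ 2 ∂innovationLaw
        ≤ (1 + 1 / η) * B ^ 2 * (1 / ((m : ℝ) + 1)) := by gcongr
      _ ≤ (Q - P) / 2 := by
        rw [mul_one_div, div_le_iff₀ (by positivity)]
        rw [div_le_iff₀ (by linarith)] at hm
        nlinarith
  linarith

/-- The shifted innovations are neither independent nor standard, so only Cauchy–Schwarz and their
second moments are used. The loss of a factor of order N is harmless against exponentially growing
spacing. -/
theorem integral_estimateNoise_shifted_sq_le {α : ℝ} (hα : |α| ≤ 1) (β σ : ℝ) (m N : ℕ) :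
    MemLp (fun u => estimateNoise α β σ N (shiftedInnovation α m u)) 2 innovationLaw ∧
    ∫ u, estimateNoise α β σ N (shiftedInnovation α m u) ^ 2 ∂innovationLaw ≤
      4 * N * precision α β σ N := by
  have hL : MemLp (fun u => estimateNoise α β σ N (shiftedInnovation α m u)) 2 innovationLaw :=
    memLp_finsetSum _ fun i _ => (memLp_shiftedInnovation α m _).const_mul _
  refine ⟨hL, ?_⟩
  have hD : 0 ≤ precision α β σ N := Finset.sum_nonneg fun i _ => sq_nonneg _
  have hi : ∀ i : Fin N, Integrable
      (fun u => shiftedInnovation α m u ((i : ℕ) + 1) ^ 2) innovationLaw :=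
    fun i => (memLp_shiftedInnovation α m _).integrable_sq
  have h1 : ∀ u, estimateNoise α β σ N (shiftedInnovation α m u) ^ 2 ≤
      precision α β σ N * ∑ i : Fin N, shiftedInnovation α m u ((i : ℕ) + 1) ^ 2 :=
    fun u => Finset.sum_mul_sq_le_sq_mul_sq _ _ _
  have h2 := integral_mono hL.integrable_sq
    ((integrable_finsetSum _ fun i _ => hi i).const_mul (precision α β σ N)) h1
  rw [integral_const_mul, integral_finsetSum _ fun i _ => hi i] at h2
  have h3 : ∑ i : Fin N, ∫ u, shiftedInnovation α m u ((i : ℕ) + 1) ^ 2 ∂innovationLaw ≤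
      N * 4 := by
    refine (Finset.sum_le_sum fun i _ => integral_shiftedInnovation_sq_le hα m _).trans ?_
    simp
  calc _ ≤ _ := h2
    _ ≤ precision α β σ N * (N * 4) := by gcongr
    _ = _ := by ring

theorem FilterRelations.errorProb_delayed_le {α P x β σ : ℝ} (h : FilterRelations α P x β σ)
    {M n m : ℕ} (hM : 2 ≤ M) (hmn : m + 1 ≤ n) {c : FeedbackCode ℝ M (n - m)}
    (hc : IsFilterCode α P β σ c) :
    (delayedCode m (noiseEstimate α m) (measurable_noiseEstimate α m) c).errorProb noSide α ≤
      4 * n / normalizedSpacing α β σ P M (n - m) ^ 2 := by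
  have hN : 1 ≤ n - m := by omega
  have hD : 0 < precision α β σ (n - m) := one_pos.trans_le (one_le_precision α β σ hN)
  have hs := signalSpacing_pos h.power_pos hM
  have hM0 : (0 : ℝ) < M := by positivity
  obtain ⟨hL, hI⟩ := integral_estimateNoise_shifted_sq_le h.abs_le β σ m (n - m)
  set ρ2 := normalizedSpacing α β σ P M (n - m) ^ 2 with hρ2
  have hρ : ρ2 = (signalSpacing P M / 2) ^ 2 * precision α β σ (n - m) := by
    rw [hρ2, normalizedSpacing, mul_pow, Real.sq_sqrt hD.le]
  have hρpos : 0 < ρ2 := by rw [hρ]; positivity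
  have key : ∀ w : Fin M, innovationLaw.real
      {u | (delayedCode m (noiseEstimate α m) (measurable_noiseEstimate α m) c).dec (noSide u)
        (fun i : Fin n => (delayedCode m (noiseEstimate α m) (measurable_noiseEstimate α m)
          c).output w (noSide u) (maNoise α u) i) ≠ w} ≤ 4 * n / ρ2 := by
    intro w
    have hsub : {u | (delayedCode m (noiseEstimate α m) (measurable_noiseEstimate α m) c).dec
        (noSide u) (fun i : Fin n => (delayedCode m (noiseEstimate α m)
          (measurable_noiseEstimate α m) c).output w (noSide u) (maNoise α u) i) ≠ w} ⊆
        {u | ρ2 * precision α β σ (n - m) ≤ estimateNoise α β σ (n - m) (shiftedInnovation α m u) ^ 2} := by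
      intro u hu
      have hu' : c.dec (revealed (shiftedInnovation α m u)) (fun i : Fin (n - m) =>
          c.output w (revealed (shiftedInnovation α m u))
            (maNoise α (shiftedInnovation α m u)) i) ≠ w := by
        rw [revealed_shiftedInnovation, maNoise_shiftedInnovation]
        rw [← delayedCode_dec (hest := measurable_noiseEstimate α m) (by omega)
          fun y y' => noiseEstimate_congr α]
        exact hu
      have h1 := hc.spacing_le_of_error h.power_pos hM hN hu'
      have h2 := pow_le_pow_left₀ (half_pos hs).le h1 2
      rw [sq_abs, div_pow (estimateNoise _ _ _ _ _), le_div_iff₀ (by positivity)] at h2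
      change ρ2 * precision α β σ (n - m) ≤ _
      rw [hρ]
      linarith
    refine (measureReal_mono hsub).trans ?_
    have h3 := mul_meas_ge_le_integral_of_nonneg (μ := innovationLaw)
      (f := fun u => estimateNoise α β σ (n - m) (shiftedInnovation α m u) ^ 2)
      (ae_of_all _ fun u => sq_nonneg _) hL.integrable_sq (ρ2 * precision α β σ (n - m))
    have h4 := h3.trans hI
    rw [le_div_iff₀ hρpos]
    have hNn : ((n - m : ℕ) : ℝ) ≤ n := by exact_mod_cast Nat.sub_le n m
    refine le_of_mul_le_mul_right ?_ hD
    calc _ = ρ2 * precision α β σ (n - m) * innovationLaw.real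
          {u | ρ2 * precision α β σ (n - m) ≤ estimateNoise α β σ (n - m) (shiftedInnovation α m u) ^ 2} := by
          ring
      _ ≤ 4 * ((n - m : ℕ) : ℝ) * precision α β σ (n - m) := h4
      _ ≤ 4 * n * precision α β σ (n - m) := by gcongr
  unfold FeedbackCode.errorProb
  rw [inv_mul_le_iff₀ hM0]
  refine (Finset.sum_le_sum fun w _ => key w).trans (le_of_eq ?_)
  simp

/-- The code which always sends zero. -/
def silentCode {M : ℕ} (n : ℕ) (w₀ : Fin M) : FeedbackCode Unit M n where
  enc _ _ _ _ := 0
  dec _ _ := w₀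
  measurable_enc _ _ := measurable_const
  measurable_dec := measurable_const

/-- The delayed filter code is designed for a smaller power Q < P whose capacity still exceeds the
rate. The surplus P - Q pays for the estimated initial innovation, and the fixed delay m costs only
a constant factor in the error bound. -/
theorem FilterRelations.achievable {α P x β σ : ℝ} (h : FilterRelations α P x β σ) {ε : ℝ}
    (hε : 0 < ε) : ∃ (M : ℕ → ℕ) (c : ∀ n, FeedbackCode Unit (M n) n),
      (∀ n : ℕ, 1 ≤ n → (2 : ℝ) ^ (n * (-Real.logb 2 x - ε)) ≤ M n ∧
        (c n).PowerConstraint noSide α P) ∧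
      Tendsto (fun n => (c n).errorProb noSide α) atTop (𝓝 0) := by
  have hx := h.pos
  have hC : 0 < -Real.logb 2 x := by
    rw [neg_pos]; exact Real.logb_neg (by norm_num) hx h.lt_one
  set C := -Real.logb 2 x with hCdef
  -- The rate is C - ε, but never below C/2, so that it is positive even for large ε. The midpoint
  -- C' of R and C is the capacity at the design power, with root y = 2^(-C').
  set R := C - min ε (C / 2) with hRdef
  have hR0 : 0 < R := by have := min_le_right ε (C / 2); linarith
  have hRC : R < C := by have := lt_min hε (half_pos hC); linarith
  have hRε : C - ε ≤ R := by have := min_le_left ε (C / 2); linarith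
  set C' := (R + C) / 2 with hC'
  set y := (2 : ℝ) ^ (-C') with hy
  have hy0 : 0 < y := by positivity
  have hy1 : y < 1 := Real.rpow_lt_one_of_one_lt_of_neg one_lt_two (by linarith)
  have hlogy : -Real.logb 2 y = C' := by
    rw [hy, Real.logb_rpow two_pos (by norm_num), neg_neg]
  have hxy : x < y := by
    rw [← Real.logb_lt_logb_iff one_lt_two hx hy0]
    linarith
  have hPx : P = rootPower α x := (isPositiveRoot_iff.mp ⟨hx, h.power_eq⟩).2
  set Q := rootPower α y with hQ
  have hQP : Q < P := by rw [hPx]; exact rootPower_lt h.abs_le hx hxy hy1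
  have hQ0 : 0 < Q := rootPower_pos h.abs_le hy0 hy1
  have hroot : IsPositiveRoot α Q y := isPositiveRoot_iff.mpr ⟨hy0, rfl⟩
  have h' := hroot.filterRelations h.abs_le hQ0
  set β' := filterCoeff α y
  set σ' := filterGain α Q y
  obtain ⟨m, hm⟩ := h'.exists_delay hQP
  obtain ⟨A, B, hA, hB, hAB⟩ := h'.normalizedSpacing_bounds
  have hex : ∀ n : ℕ, ∃ c : FeedbackCode Unit (numMessages R n) n, c.PowerConstraint noSide α P ∧
      (m + 1 ≤ n → c.errorProb noSide α ≤
        4 * n / (A * (2 : ℝ) ^ (2 * (((n - m : ℕ) : ℝ) * C' - n * R)))) := by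
    intro n
    have hM0 : numMessages R n ≠ 0 := (Nat.ceil_pos.mpr (by positivity)).ne'
    by_cases hn : m + 1 ≤ n
    · have hr : 0 < (n : ℝ) * R := mul_pos (by exact_mod_cast (by omega : 0 < n)) hR0
      have hM : 2 ≤ numMessages R n := two_le_ceil_rpow hr
      obtain ⟨c, hc⟩ := exists_isFilterCode (M := numMessages R n) (n := n - m) α Q β' σ'
        (by omega) (by omega)
      refine ⟨delayedCode m (noiseEstimate α m) (measurable_noiseEstimate α m) c, ?_, fun _ => ?_⟩
      · refine powerConstraint_of_forall_le hM0 fun w i hi => ?_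
        rcases lt_or_ge i m with him | him
        · simp only [noSide, delayedCode_input_of_lt w _ him]
          simp
        · obtain ⟨k, rfl⟩ := Nat.exists_eq_add_of_le him
          have hk : k < n - m := by omega
          simp only [noSide, delayedCode_input_add fun y y' => noiseEstimate_congr α]
          simp only [← revealed_shiftedInnovation, ← maNoise_shiftedInnovation, hc.1 w _ k hk]
          obtain ⟨h1, h2⟩ := hm (signalPoint Q (numMessages R n) w) k (signalPoint_sq_le hQ0 hM w)
          exact lintegral_sq_le_of_integral_le h1 h2
      · refine (h'.errorProb_delayed_le hM hn hc).trans ?_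
        have h1 := (hAB (n * R) (n - m) hr (by omega)).1
        rw [hlogy] at h1
        exact div_le_div_of_nonneg_left (by positivity) (by positivity) h1
    -- Block lengths n ≤ m leave no room for transmission; their error is irrelevant in the limit.
    · refine ⟨silentCode n ⟨0, Nat.pos_of_ne_zero hM0⟩, ?_, fun h => absurd h hn⟩
      refine powerConstraint_of_forall_le hM0 fun w i hi => ?_
      simp [FeedbackCode.input, silentCode]
  choose c hcP hcE using hex
  refine ⟨numMessages R, c, fun n hn => ⟨?_, hcP n⟩, ?_⟩
  · refine le_trans ?_ (Nat.le_ceil _)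
    exact Real.rpow_le_rpow_of_exponent_le one_le_two
      (mul_le_mul_of_nonneg_left hRε (by positivity))
  · have hb : 1 < (2 : ℝ) ^ (2 * (C' - R)) := Real.one_lt_rpow one_lt_two (by linarith)
    set b := (2 : ℝ) ^ (2 * (C' - R)) with hbdef
    have hlim : Tendsto (fun n : ℕ => 4 / A * (2 : ℝ) ^ (2 * (m : ℝ) * C') * ((n : ℝ) / b ^ n))
        atTop (𝓝 0) := by
      have := (tendsto_pow_const_div_const_pow_of_one_lt 1 hb).const_mul
        (4 / A * (2 : ℝ) ^ (2 * (m : ℝ) * C'))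
      simpa using this
    refine squeeze_zero' (Eventually.of_forall fun n => ?_) ?_ hlim
    · exact mul_nonneg (by positivity) (Finset.sum_nonneg fun w _ => measureReal_nonneg)
    · filter_upwards [eventually_ge_atTop (m + 1)] with n hn
      refine (hcE n hn).trans (le_of_eq ?_)
      have h1 : (2 : ℝ) ^ (2 * (((n - m : ℕ) : ℝ) * C' - n * R)) =
          b ^ n / (2 : ℝ) ^ (2 * (m : ℝ) * C') := by
        rw [hbdef, ← Real.rpow_natCast, ← Real.rpow_mul zero_le_two, ← Real.rpow_sub two_pos,
          Nat.cast_sub (by omega)]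
        congr 1; ring
      rw [h1]
      have hbn : 0 < b ^ n := by positivity
      field_simp

end MA1Feedback

namespace MA1Feedback

/-! ### The output process -/

theorem zeroExtend_add {n : ℕ} (v w : Fin n → ℝ) : zeroExtend (v + w) = zeroExtend v + zeroExtend w := by
  funext k
  by_cases h : k < n <;> simp [zeroExtend, h]

theorem zeroExtend_smul {n : ℕ} (c : ℝ) (v : Fin n → ℝ) :
    zeroExtend (c • v) = c • zeroExtend v := by
  funext k
  by_cases h : k < n <;> simp [zeroExtend, h]

theorem arInput_add (β σ x y : ℝ) (u v : ℕ → ℝ) (k : ℕ) :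
    arInput β σ (x + y) (u + v) k = arInput β σ x u k + arInput β σ y v k := by
  induction k with
  | zero => rfl
  | succ k ih => simp only [arInput, ih, Pi.add_apply]; ring

theorem arInput_smul (β σ c x : ℝ) (u : ℕ → ℝ) (k : ℕ) :
    arInput β σ (c * x) (c • u) k = c * arInput β σ x u k := by
  induction k with
  | zero => rfl
  | succ k ih => simp only [arInput, ih, Pi.smul_apply, smul_eq_mul]; ring

/-- The autoregressive inputs as a linear function of the first input and the innovations. -/
noncomputable def arInputLinear (β σ : ℝ) : ℝ × (ℕ → ℝ) →ₗ[ℝ] ℕ → ℝ where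
  toFun q := arInput β σ q.1 q.2
  map_add' p q := by funext k; exact arInput_add β σ _ _ _ _ k
  map_smul' c q := by funext k; exact arInput_smul β σ c _ _ k

/-- The outputs as a linear function of the first input and the innovations. -/
noncomputable def arOutputLinear (α β σ : ℝ) : ℝ × (ℕ → ℝ) →ₗ[ℝ] ℕ → ℝ where
  toFun q := arOutput α β σ q.1 q.2
  map_add' p q := by
    funext k
    simp only [arOutput, maNoise, Prod.fst_add, Prod.snd_add, arInput_add, Pi.add_apply]; ring
  map_smul' c q := by
    funext k
    simp only [arOutput, maNoise, Prod.smul_fst, Prod.smul_snd, smul_eq_mul, arInput_smul,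
      Pi.smul_apply, RingHom.id_apply]
    ring

theorem exists_coeff {ι : Type*} [Fintype ι] (L : StrongDual ℝ (ι → ℝ)) :
    ∃ a : ι → ℝ, ∀ x, L x = ∑ i, a i * x i := by
  classical
  refine ⟨fun i => L (Pi.single i 1), fun x => ?_⟩
  conv_lhs => rw [pi_eq_sum_univ' x]
  simp only [map_sum, map_smul, smul_eq_mul]
  exact Finset.sum_congr rfl fun i _ => mul_comm _ _

section Gaussian

variable {Ω : Type*} [MeasurableSpace Ω] {μ : Measure Ω}

/-- Gaussian processes with the same means and covariances have the same law. -/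
theorem identDistrib_of_isGaussianProcess [IsProbabilityMeasure μ] {X Y : ℕ → Ω → ℝ} (hX : IsGaussianProcess X μ)
    (hY : IsGaussianProcess Y μ) (hm : ∀ k, ∫ ω, X k ω ∂μ = ∫ ω, Y k ω ∂μ)
    (hc : ∀ j k, cov[X j, X k; μ] = cov[Y j, Y k; μ]) :
    IdentDistrib (fun ω k => X k ω) (fun ω k => Y k ω) μ μ := by
  have hXL : ∀ k, MemLp (X k) 2 μ := fun k => (hX.hasGaussianLaw_eval k).memLp_two
  have hYL : ∀ k, MemLp (Y k) 2 μ := fun k => (hY.hasGaussianLaw_eval k).memLp_two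
  rw [identDistrib_iff_forall_finset_identDistrib (aemeasurable_pi_lambda _ hX.aemeasurable)
    (aemeasurable_pi_lambda _ hY.aemeasurable)]
  intro I
  have hXI := hX.hasGaussianLaw I
  have hYI := hY.hasGaussianLaw I
  refine ⟨hXI.aemeasurable, hYI.aemeasurable, ?_⟩
  have := hXI.isGaussian_map
  have := hYI.isGaussian_map
  refine Measure.ext_of_charFunDual ?_
  funext L
  rw [hXI.charFunDual_map_eq_fun, hYI.charFunDual_map_eq_fun]
  obtain ⟨a, hL⟩ := exists_coeff L
  have e1 : ∀ Z : ℕ → Ω → ℝ, (∀ k, MemLp (Z k) 2 μ) →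
      ∫ ω, L (I.restrict (Z · ω)) ∂μ = ∑ i : I, a i * ∫ ω, Z i ω ∂μ := by
    intro Z hZ
    simp only [hL, Finset.restrict_def]
    have hi : ∀ i : I, Integrable (fun ω => a i * Z i ω) μ :=
      fun i => ((hZ i).integrable (by norm_num)).const_mul _
    rw [integral_finsetSum _ fun i _ => hi i]
    simp only [integral_const_mul]
  have e2 : ∀ Z : ℕ → Ω → ℝ, (∀ k, MemLp (Z k) 2 μ) →
      Var[fun ω => L (I.restrict (Z · ω)); μ] = ∑ i : I, ∑ j : I,
        a i * (a j * cov[Z i, Z j; μ]) := by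
    intro Z hZ
    have hZ' : ∀ i : I, MemLp (fun ω => a i * Z i ω) 2 μ :=
      fun i => (hZ i).const_mul _
    simp only [hL, Finset.restrict_def]
    rw [← covariance_self (memLp_finsetSum _ fun i _ => hZ' i).1.aemeasurable,
      covariance_fun_sum_fun_sum hZ' hZ']
    simp only [covariance_const_mul_left, covariance_const_mul_right, mul_left_comm]
  rw [e1 X hXL, e1 Y hYL, e2 X hXL, e2 Y hYL]
  simp only [hm, hc]

variable {U : ℕ → Ω → ℝ} {X₁ : Ω → ℝ} {p : NNReal}

/-- Finitely many values of F involve X_1 and finitely many innovations, a Gaussian vector. The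
window k + 2 is there because the output at index k reads the innovations up to index k + 1. -/
theorem isGaussianProcess_of_linear (hU : ∀ k, HasLaw (U k) (gaussianReal 0 1) μ)
    (hUindep : iIndepFun U μ) (hX₁ : HasLaw X₁ (gaussianReal 0 p) μ)
    (hX₁U : IndepFun X₁ (fun ω k => U k ω) μ) (F : ℝ × (ℕ → ℝ) →ₗ[ℝ] ℕ → ℝ)
    (hF : ∀ k x u v, (∀ j < k + 2, u j = v j) → F (x, u) k = F (x, v) k) :
    IsGaussianProcess (fun k ω => F (X₁ ω, fun j => U j ω) k) μ where
  hasGaussianLaw I := by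
    set N := I.sup id + 2 with hN
    have h1 : HasGaussianLaw (fun ω (i : Fin N) => U i ω) μ :=
      iIndepFun.hasGaussianLaw (fun i => (hU i).hasGaussianLaw)
        (hUindep.precomp Fin.val_injective)
    have h2 : HasGaussianLaw (fun ω => (X₁ ω, fun i : Fin N => U i ω)) μ := by
      refine IndepFun.hasGaussianLaw hX₁.hasGaussianLaw h1 ?_
      exact hX₁U.comp measurable_id (ψ := fun (u : ℕ → ℝ) (i : Fin N) => u i)
        (measurable_pi_lambda _ fun i => measurable_pi_apply _)
    let L : ℝ × (Fin N → ℝ) →ₗ[ℝ] I → ℝ :=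
      { toFun := fun q i => F (q.1, zeroExtend q.2) i
        map_add' := fun p q => by
          funext i
          have := congrFun (map_add F (p.1, zeroExtend p.2) (q.1, zeroExtend q.2)) i
          simpa [zeroExtend_add] using this
        map_smul' := fun c q => by
          funext i
          have := congrFun (map_smul F c (q.1, zeroExtend q.2)) i
          simpa [zeroExtend_smul] using this }
    have h3 := h2.map_fun L.toContinuousLinearMap
    have h4 : (fun ω => I.restrict fun k => F (X₁ ω, fun j => U j ω) k) =
        fun ω => L.toContinuousLinearMap (X₁ ω, fun i : Fin N => U i ω) := by
      funext ω i
      refine hF i _ _ _ fun j hj => ?_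
      have : (i : ℕ) ≤ I.sup id := Finset.le_sup (f := id) i.2
      rw [zeroExtend_of_lt _ (by omega)]
    rw [h4]
    exact h3

variable {α β σ : ℝ}

theorem isGaussianProcess_arInput (hU : ∀ k, HasLaw (U k) (gaussianReal 0 1) μ)
    (hUindep : iIndepFun U μ) (hX₁ : HasLaw X₁ (gaussianReal 0 p) μ)
    (hX₁U : IndepFun X₁ (fun ω k => U k ω) μ) :
    IsGaussianProcess (fun k ω => arInput β σ (X₁ ω) (fun j => U j ω) k) μ :=
  isGaussianProcess_of_linear hU hUindep hX₁ hX₁U (arInputLinear β σ)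
    fun k _ _ _ h => arInput_congr fun j _ hj => h j (by omega)

theorem isGaussianProcess_arOutput (hU : ∀ k, HasLaw (U k) (gaussianReal 0 1) μ)
    (hUindep : iIndepFun U μ) (hX₁ : HasLaw X₁ (gaussianReal 0 p) μ)
    (hX₁U : IndepFun X₁ (fun ω k => U k ω) μ) :
    IsGaussianProcess (fun k ω => arOutput α β σ (X₁ ω) (fun j => U j ω) k) μ := by
  refine isGaussianProcess_of_linear hU hUindep hX₁ hX₁U (arOutputLinear α β σ)
    fun k x u v h => ?_
  simp only [arOutputLinear, LinearMap.coe_mk, AddHom.coe_mk, arOutput, maNoise,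
    h k (by omega), h (k + 1) (by omega)]
  rw [arInput_congr fun j _ hj => h j (by omega)]

/-- The second order structure of the autoregressive inputs `X` driven by white noise `U`. -/
structure IsArProcess (μ : Measure Ω) (β σ P : ℝ) (X U : ℕ → Ω → ℝ) : Prop where
  memLp_input : ∀ k, MemLp (X k) 2 μ
  memLp_noise : ∀ k, MemLp (U k) 2 μ
  recurrence : ∀ k, X (k + 1) = β • X k + σ • U (k + 1)
  cov_noise : ∀ k, cov[U k, U k; μ] = 1
  cov_noise_of_ne : ∀ j k, j ≠ k → cov[U j, U k; μ] = 0
  cov_zero : ∀ k, cov[X 0, U k; μ] = 0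
  cov_zero_self : cov[X 0, X 0; μ] = P

namespace IsArProcess

variable {P x : ℝ} {X : ℕ → Ω → ℝ}

theorem cov_input_noise [IsProbabilityMeasure μ] (hX : IsArProcess μ β σ P X U) {j k : ℕ} (hjk : j < k) :
    cov[X j, U k; μ] = 0 := by
  induction j with
  | zero => exact hX.cov_zero k
  | succ j ih =>
    rw [hX.recurrence, covariance_add_left ((hX.memLp_input _).const_smul _)
      ((hX.memLp_noise _).const_smul _) (hX.memLp_noise _), covariance_smul_left,
      covariance_smul_left, ih (by omega), hX.cov_noise_of_ne _ _ hjk.ne]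
    simp

theorem cov_input_self [IsProbabilityMeasure μ] (hX : IsArProcess μ β σ P X U) (hP : σ ^ 2 = P * (1 - β ^ 2)) (k : ℕ) :
    cov[X k, X k; μ] = P := by
  induction k with
  | zero => exact hX.cov_zero_self
  | succ k ih =>
    have h1 := (hX.memLp_input k).const_smul β
    have h2 := (hX.memLp_noise (k + 1)).const_smul σ
    rw [hX.recurrence, covariance_add_left h1 h2 (h1.add h2), covariance_add_right h1 h1 h2,
      covariance_add_right h2 h1 h2]
    simp only [covariance_smul_left, covariance_smul_right]
    rw [covariance_comm (U (k + 1)) (X k), hX.cov_input_noise k.lt_succ_self, ih, hX.cov_noise]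
    linear_combination hP

/-- The covariance with a later output. -/
theorem cov_output [IsProbabilityMeasure μ] (hX : IsArProcess μ β σ P X U) {Y : ℕ → Ω → ℝ}
    (hY : ∀ k, Y k = X k + (α • U k + U (k + 1))) {W : Ω → ℝ} (hW : MemLp W 2 μ) (k : ℕ) :
    cov[W, Y k; μ] = cov[W, X k; μ] + (α * cov[W, U k; μ] + cov[W, U (k + 1); μ]) := by
  have h1 := (hX.memLp_noise k).const_smul α
  rw [hY, covariance_add_right hW (hX.memLp_input k) (h1.add (hX.memLp_noise (k + 1))),
    covariance_add_right hW h1 (hX.memLp_noise _), covariance_smul_right]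

theorem memLp_output (hX : IsArProcess μ β σ P X U) {Y : ℕ → Ω → ℝ}
    (hY : ∀ k, Y k = X k + (α • U k + U (k + 1))) (k : ℕ) : MemLp (Y k) 2 μ := by
  rw [hY]
  exact (hX.memLp_input k).add (((hX.memLp_noise k).const_smul α).add (hX.memLp_noise (k + 1)))

/-- From the second one on, the outputs are correlated as a moving average of order one. -/
theorem cov_output_add [IsProbabilityMeasure μ] (hX : IsArProcess μ β σ P X U) (h : FilterRelations α P x β σ)
    {Y : ℕ → Ω → ℝ} (hY : ∀ k, Y k = X k + (α • U k + U (k + 1))) (j m : ℕ) :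
    cov[Y (j + 1), Y (j + 1 + m); μ] =
      if m = 0 then (β ^ 2)⁻¹ + α ^ 2 * β ^ 2 else if m = 1 then α else 0 := by
  set W := Y (j + 1) with hW
  have hWL : MemLp W 2 μ := hX.memLp_output hY (j + 1)
  have hexp : ∀ V : Ω → ℝ, MemLp V 2 μ → cov[W, V; μ] =
      β * cov[X j, V; μ] + (σ + α) * cov[U (j + 1), V; μ] + cov[U (j + 2), V; μ] := by
    intro V hV
    rw [covariance_comm, hX.cov_output hY hV, covariance_comm V (X (j + 1)), hX.recurrence,
      covariance_add_left ((hX.memLp_input _).const_smul _) ((hX.memLp_noise _).const_smul _) hV,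
      covariance_smul_left, covariance_smul_left, covariance_comm V, covariance_comm V]
    ring
  have hU1 : cov[W, U (j + 1); μ] = σ + α := by
    rw [hexp _ (hX.memLp_noise _), hX.cov_input_noise j.lt_succ_self, hX.cov_noise,
      hX.cov_noise_of_ne _ _ (by omega)]
    ring
  have hU2 : cov[W, U (j + 2); μ] = 1 := by
    rw [hexp _ (hX.memLp_noise _), hX.cov_input_noise (by omega), hX.cov_noise,
      hX.cov_noise_of_ne _ _ (by omega)]
    ring
  have hU3 : ∀ k, cov[W, U (j + 3 + k); μ] = 0 := by
    intro k
    rw [hexp _ (hX.memLp_noise _), hX.cov_input_noise (by omega),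
      hX.cov_noise_of_ne _ _ (by omega), hX.cov_noise_of_ne _ _ (by omega)]
    ring
  have hrec : ∀ k, cov[W, X (k + 1); μ] = β * cov[W, X k; μ] + σ * cov[W, U (k + 1); μ] := by
    intro k
    rw [hX.recurrence, covariance_add_right hWL ((hX.memLp_input _).const_smul _)
      ((hX.memLp_noise _).const_smul _), covariance_smul_right, covariance_smul_right]
  have hX0 : cov[W, X j; μ] = β * P := by
    rw [hexp _ (hX.memLp_input _), hX.cov_input_self h.gain_sq, covariance_comm,
      hX.cov_input_noise j.lt_succ_self, covariance_comm, hX.cov_input_noise (by omega)]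
    ring
  -- Later inputs are uncorrelated with this output: the first covariance is βP + σ(1 + αβ) = 0, and
  -- the autoregression propagates it because the later innovations are uncorrelated with W as well.
  -- Only the common innovation at lag one survives.
  have hX2 : ∀ k, cov[W, X (j + 2 + k); μ] = 0 := by
    intro k
    induction k with
    | zero =>
      rw [add_zero, hrec, hrec, hX0, hU1, hU2]
      linear_combination h.power_add + β * h.gain_sq
    | succ k ih =>
      rw [← add_assoc, hrec, ih, show j + 2 + k + 1 = j + 3 + k by omega, hU3]
      ring
  rw [hX.cov_output hY hWL]
  rcases m with _ | _ | m
  · rw [if_pos rfl, add_zero, hrec, hX0, hU1, hU2]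
    have hb := h.coeff_ne_zero
    have hg := h.gain_eq
    have hbi : β * β⁻¹ = 1 := mul_inv_cancel₀ hb
    have hp : β * (β * P) = -β * σ * (1 + α * β) := by linear_combination β * h.power_add
    rw [← inv_pow, hp, hg]
    clear hp
    generalize β⁻¹ = b at *
    linear_combination (-1 - α * β) * hbi
  · rw [if_neg (by omega), if_pos rfl, zero_add, show j + 1 + 1 = j + 2 + 0 by omega, hX2,
      add_zero, hU2, show j + 2 + 1 = j + 3 + 0 by omega, hU3]
    ring
  · rw [if_neg (by omega), if_neg (by omega), show j + 1 + (m + 1 + 1) = j + 2 + (m + 1) by omega,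
      hX2, show j + 2 + (m + 1) = j + 3 + m by omega, hU3, add_assoc, hU3]
    ring

end IsArProcess

theorem integral_eq_zero_of_hasLaw {V : Ω → ℝ} {v : NNReal} (hV : HasLaw V (gaussianReal 0 v) μ) :
    ∫ ω, V ω ∂μ = 0 := by
  rw [hV.integral_eq, integral_id_gaussianReal]

theorem covariance_self_of_hasLaw {V : Ω → ℝ} {v : NNReal} (hV : HasLaw V (gaussianReal 0 v) μ) :
    cov[V, V; μ] = v := by
  rw [covariance_self hV.aemeasurable, hV.variance_eq, variance_id_gaussianReal]

theorem isArProcess_arInput (hU : ∀ k, HasLaw (U k) (gaussianReal 0 1) μ)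
    (hUindep : iIndepFun U μ) (hX₁ : HasLaw X₁ (gaussianReal 0 p) μ)
    (hX₁U : IndepFun X₁ (fun ω k => U k ω) μ) :
    IsArProcess μ β σ p (fun k ω => arInput β σ (X₁ ω) (fun j => U j ω) k) U where
  memLp_input k :=
    ((isGaussianProcess_arInput hU hUindep hX₁ hX₁U).hasGaussianLaw_eval k).memLp_two
  memLp_noise k := (hU k).hasGaussianLaw.memLp_two
  recurrence k := rfl
  cov_noise k := by rw [covariance_self_of_hasLaw (hU k)]; rfl
  cov_noise_of_ne j k hjk := (hUindep.indepFun hjk).covariance_eq_zero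
    (hU j).hasGaussianLaw.memLp_two (hU k).hasGaussianLaw.memLp_two
  cov_zero k := by
    have h : IndepFun X₁ (U k) μ := hX₁U.comp measurable_id (measurable_pi_apply k)
    exact h.covariance_eq_zero hX₁.hasGaussianLaw.memLp_two (hU k).hasGaussianLaw.memLp_two
  cov_zero_self := covariance_self_of_hasLaw hX₁

theorem integral_arInput_process [IsProbabilityMeasure μ]
    (hU : ∀ k, HasLaw (U k) (gaussianReal 0 1) μ)
    (hUindep : iIndepFun U μ) (hX₁ : HasLaw X₁ (gaussianReal 0 p) μ)
    (hX₁U : IndepFun X₁ (fun ω k => U k ω) μ) (k : ℕ) :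
    ∫ ω, arInput β σ (X₁ ω) (fun j => U j ω) k ∂μ = 0 := by
  have hX := isArProcess_arInput (β := β) (σ := σ) hU hUindep hX₁ hX₁U
  induction k with
  | zero => exact integral_eq_zero_of_hasLaw hX₁
  | succ k ih =>
    have h1 : Integrable (fun ω => β * arInput β σ (X₁ ω) (fun j => U j ω) k) μ :=
      ((hX.memLp_input k).integrable (by norm_num)).const_mul _
    have h2 : Integrable (fun ω => σ * U (k + 1) ω) μ :=
      ((hX.memLp_noise (k + 1)).integrable (by norm_num)).const_mul _
    simp only [arInput]
    rw [integral_add h1 h2, integral_const_mul, integral_const_mul, ih,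
      integral_eq_zero_of_hasLaw (hU _)]
    simp

theorem integral_arOutput_process [IsProbabilityMeasure μ]
    (hU : ∀ k, HasLaw (U k) (gaussianReal 0 1) μ)
    (hUindep : iIndepFun U μ) (hX₁ : HasLaw X₁ (gaussianReal 0 p) μ)
    (hX₁U : IndepFun X₁ (fun ω k => U k ω) μ) (k : ℕ) :
    ∫ ω, arOutput α β σ (X₁ ω) (fun j => U j ω) k ∂μ = 0 := by
  have hX := isArProcess_arInput (β := β) (σ := σ) hU hUindep hX₁ hX₁U
  have h0 : Integrable (fun ω => arInput β σ (X₁ ω) (fun j => U j ω) k) μ :=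
    (hX.memLp_input k).integrable (by norm_num)
  have h1 : Integrable (fun ω => α * U k ω) μ :=
    ((hX.memLp_noise k).integrable (by norm_num)).const_mul _
  have h2 : Integrable (fun ω => U (k + 1) ω) μ :=
    (hX.memLp_noise (k + 1)).integrable (by norm_num)
  have h3 : Integrable (fun ω => α * U k ω + U (k + 1) ω) μ := h1.add h2
  simp only [arOutput, maNoise]
  rw [integral_add h0 h3, integral_add h1 h2, integral_const_mul,
    integral_arInput_process hU hUindep hX₁ hX₁U, integral_eq_zero_of_hasLaw (hU _),
    integral_eq_zero_of_hasLaw (hU _)]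
  simp

variable {P x : ℝ}

theorem FilterRelations.hasLaw_arInput [IsProbabilityMeasure μ] (h : FilterRelations α P x β σ)
    (hU : ∀ k, HasLaw (U k) (gaussianReal 0 1) μ)
    (hUindep : iIndepFun U μ) (hX₁ : HasLaw X₁ (gaussianReal 0 P.toNNReal) μ)
    (hX₁U : IndepFun X₁ (fun ω k => U k ω) μ) (k : ℕ) :
    HasLaw (fun ω => arInput β σ (X₁ ω) (fun j => U j ω) k) (gaussianReal 0 P.toNNReal) μ := by
  have hX := isArProcess_arInput (β := β) (σ := σ) hU hUindep hX₁ hX₁U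
  have hG := (isGaussianProcess_arInput (β := β) (σ := σ) hU hUindep hX₁ hX₁U).hasGaussianLaw_eval k
  rw [Real.coe_toNNReal _ h.power_pos.le] at hX
  have hv := hX.cov_input_self h.gain_sq k
  rw [covariance_self hG.aemeasurable] at hv
  refine ⟨hG.aemeasurable, ?_⟩
  rw [hG.map_eq_gaussianReal, hv, integral_arInput_process hU hUindep hX₁ hX₁U]

theorem FilterRelations.cov_arOutput [IsProbabilityMeasure μ] (h : FilterRelations α P x β σ)
    (hU : ∀ k, HasLaw (U k) (gaussianReal 0 1) μ)
    (hUindep : iIndepFun U μ) (hX₁ : HasLaw X₁ (gaussianReal 0 P.toNNReal) μ)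
    (hX₁U : IndepFun X₁ (fun ω k => U k ω) μ) (j k : ℕ) :
    cov[fun ω => arOutput α β σ (X₁ ω) (fun i => U i ω) (j + 1),
        fun ω => arOutput α β σ (X₁ ω) (fun i => U i ω) (k + 1); μ] =
      if j = k then (β ^ 2)⁻¹ + α ^ 2 * β ^ 2 else if j + 1 = k ∨ k + 1 = j then α else 0 := by
  have hX := isArProcess_arInput (β := β) (σ := σ) hU hUindep hX₁ hX₁U
  rw [Real.coe_toNNReal _ h.power_pos.le] at hX
  have hY := hX.cov_output_add h (Y := fun k ω => arOutput α β σ (X₁ ω) (fun i => U i ω) k)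
    fun k => rfl
  rcases le_total j k with hjk | hjk
  · obtain ⟨m, rfl⟩ := Nat.exists_eq_add_of_le hjk
    rw [show j + m + 1 = j + 1 + m by omega, hY j m]
    congr 1
    · simp
    · congr 1
      simp only [eq_iff_iff]; omega
  · obtain ⟨m, rfl⟩ := Nat.exists_eq_add_of_le hjk
    rw [show k + m + 1 = k + 1 + m by omega, covariance_comm, hY k m]
    congr 1
    · simp
    · congr 1
      simp only [eq_iff_iff]; omega

/-- The process is Gaussian with mean zero and its covariances depend on the lag only, so weak
stationarity gives strict stationarity. -/
theorem FilterRelations.stationaryProcess [IsProbabilityMeasure μ]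
    (h : FilterRelations α P x β σ) (hU : ∀ k, HasLaw (U k) (gaussianReal 0 1) μ)
    (hUindep : iIndepFun U μ) (hX₁ : HasLaw X₁ (gaussianReal 0 P.toNNReal) μ)
    (hX₁U : IndepFun X₁ (fun ω k => U k ω) μ) :
    StationaryProcess (fun k ω => arOutput α β σ (X₁ ω) (fun j => U j ω) (k + 1)) μ := by
  intro m
  have hG := isGaussianProcess_arOutput (α := α) (β := β) (σ := σ) hU hUindep hX₁ hX₁U
  refine identDistrib_of_isGaussianProcess (hG.comp_right fun k => k + m + 1)
    (hG.comp_right fun k => k + 1) (fun k => ?_) (fun j k => ?_)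
  · simp only
    rw [integral_arOutput_process hU hUindep hX₁ hX₁U, integral_arOutput_process hU hUindep hX₁ hX₁U]
  · refine (h.cov_arOutput hU hUindep hX₁ hX₁U (j + m) (k + m)).trans
      (Eq.trans ?_ (h.cov_arOutput hU hUindep hX₁ hX₁U j k).symm)
    congr 1
    · simp
    · congr 1
      simp only [eq_iff_iff]; omega

end Gaussian

end MA1Feedback

namespace MA1Feedback

/-! ### The power spectral density of the output -/

theorem integral_exp_int_mul (n : ℤ) :
    ∫ t in (-Real.pi)..Real.pi, Complex.exp (Complex.I * (n : ℂ) * (t : ℂ)) =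
      if n = 0 then 2 * (Real.pi : ℂ) else 0 := by
  split_ifs with hn
  · subst hn
    simp
    ring
  · have hc : Complex.I * (n : ℂ) ≠ 0 := mul_ne_zero Complex.I_ne_zero (by exact_mod_cast hn)
    rw [integral_exp_mul_complex hc, div_eq_zero_iff]
    left
    rw [sub_eq_zero, Complex.exp_eq_exp_iff_exists_int]
    exact ⟨n, by push_cast; ring⟩

/-- The power spectral density of the moving average of order one with coefficient `α * β ^ 2`. -/
noncomputable def maSpectrum (α β t : ℝ) : ℝ :=
  (β ^ 2)⁻¹ * ‖1 + (α : ℂ) * (β : ℂ) ^ 2 * Complex.exp (-Complex.I * t)‖ ^ 2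

theorem maSpectrum_eq {α β : ℝ} (hβ : β ≠ 0) (t : ℝ) :
    (maSpectrum α β t : ℂ) = ((β ^ 2)⁻¹ + α ^ 2 * β ^ 2 : ℝ) +
      α * (Complex.exp (Complex.I * t) + Complex.exp (-Complex.I * t)) := by
  have hβ' : (β : ℂ) ≠ 0 := by exact_mod_cast hβ
  have h1 : (starRingEnd ℂ) (1 + (α : ℂ) * (β : ℂ) ^ 2 * Complex.exp (-Complex.I * t)) =
      1 + (α : ℂ) * (β : ℂ) ^ 2 * Complex.exp (Complex.I * t) := by
    simp [← Complex.exp_conj]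
  have h2 : Complex.exp (-Complex.I * t) * Complex.exp (Complex.I * t) = 1 := by
    rw [← Complex.exp_add]; simp
  rw [maSpectrum]
  push_cast
  rw [← Complex.mul_conj', h1]
  generalize Complex.exp (-Complex.I * t) = z at *
  generalize Complex.exp (Complex.I * t) = w at *
  field_simp
  linear_combination (α : ℂ) ^ 2 * (β : ℂ) ^ 4 * h2

theorem continuous_maSpectrum (α β : ℝ) : Continuous (maSpectrum α β) := by
  unfold maSpectrum; fun_prop

theorem integral_maSpectrum_mul_exp {α β : ℝ} (hβ : β ≠ 0) (n : ℤ) :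
    (2 * (Real.pi : ℂ))⁻¹ * ∫ t in (-Real.pi)..Real.pi,
      (maSpectrum α β t : ℂ) * Complex.exp (Complex.I * (n : ℂ) * (t : ℂ)) =
    ((if n = 0 then (β ^ 2)⁻¹ + α ^ 2 * β ^ 2 else if n = -1 ∨ n = 1 then α else 0 : ℝ) : ℂ) := by
  have hpi : (2 * (Real.pi : ℂ)) ≠ 0 := by
    simp [Real.pi_ne_zero]
  have h1 : ∀ t : ℝ, (maSpectrum α β t : ℂ) * Complex.exp (Complex.I * (n : ℂ) * (t : ℂ)) =
      (((β ^ 2)⁻¹ + α ^ 2 * β ^ 2 : ℝ) : ℂ) * Complex.exp (Complex.I * (n : ℂ) * (t : ℂ)) +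
      α * Complex.exp (Complex.I * ((n + 1 : ℤ) : ℂ) * (t : ℂ)) +
      α * Complex.exp (Complex.I * ((n - 1 : ℤ) : ℂ) * (t : ℂ)) := by
    intro t
    rw [maSpectrum_eq hβ]
    have h2 : Complex.exp (Complex.I * ((n + 1 : ℤ) : ℂ) * (t : ℂ)) =
        Complex.exp (Complex.I * (n : ℂ) * (t : ℂ)) * Complex.exp (Complex.I * t) := by
      rw [← Complex.exp_add]; push_cast; ring_nf
    have h3 : Complex.exp (Complex.I * ((n - 1 : ℤ) : ℂ) * (t : ℂ)) =
        Complex.exp (Complex.I * (n : ℂ) * (t : ℂ)) * Complex.exp (-Complex.I * t) := by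
      rw [← Complex.exp_add]; push_cast; ring_nf
    rw [h2, h3]
    ring
  have hc : ∀ (a : ℂ) (m : ℤ), IntervalIntegrable
      (fun t : ℝ => a * Complex.exp (Complex.I * (m : ℂ) * (t : ℂ))) volume (-Real.pi) Real.pi :=
    fun a m => Continuous.intervalIntegrable (by fun_prop) _ _
  simp only [h1]
  rw [intervalIntegral.integral_add ((hc _ _).add (hc _ _)) (hc _ _),
    intervalIntegral.integral_add (hc _ _) (hc _ _), intervalIntegral.integral_const_mul,
    intervalIntegral.integral_const_mul, intervalIntegral.integral_const_mul,
    integral_exp_int_mul, integral_exp_int_mul, integral_exp_int_mul]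
  by_cases h0 : n = 0
  · subst h0
    simp
    field_simp
  · by_cases hm : n = -1
    · subst hm
      simp
      field_simp
    · by_cases hp : n = 1
      · subst hp
        simp
        field_simp
      · simp [h0, hm, hp, show n + 1 ≠ 0 by omega, show n - 1 ≠ 0 by omega]

theorem FilterRelations.hasSpectralDensity {Ω : Type*} [MeasurableSpace Ω] {μ : Measure Ω}
    [IsProbabilityMeasure μ] {U : ℕ → Ω → ℝ} {X₁ : Ω → ℝ} {α P x β σ : ℝ}
    (h : FilterRelations α P x β σ) (hU : ∀ k, HasLaw (U k) (gaussianReal 0 1) μ)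
    (hUindep : iIndepFun U μ) (hX₁ : HasLaw X₁ (gaussianReal 0 P.toNNReal) μ)
    (hX₁U : IndepFun X₁ (fun ω k => U k ω) μ) :
    HasSpectralDensity (fun k ω => arOutput α β σ (X₁ ω) (fun j => U j ω) (k + 1))
      (maSpectrum α β) μ := by
  have hG := isGaussianProcess_arOutput (α := α) (β := β) (σ := σ) hU hUindep hX₁ hX₁U
  refine ⟨fun k => (hG.hasGaussianLaw_eval (k + 1)).memLp_two,
    fun k => integral_arOutput_process hU hUindep hX₁ hX₁U (k + 1),
    fun t => by unfold maSpectrum; positivity,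
    (continuous_maSpectrum α β).intervalIntegrable _ _, fun j k => ?_⟩
  have h1 := integral_maSpectrum_mul_exp (α := α) h.coeff_ne_zero ((j : ℤ) - k)
  push_cast at h1
  rw [h1, h.cov_arOutput hU hUindep hX₁ hX₁U]
  congr 2
  · simp only [eq_iff_iff]; omega
  · congr 1
    simp only [eq_iff_iff]; omega

/-- The zero of the transfer function outside the disc is reflected by an all-pass factor. -/
theorem FilterRelations.outputSpectrum_eq {α P x β σ : ℝ} (h : FilterRelations α P x β σ) (t : ℝ) :
    outputSpectrum α β σ t = maSpectrum α β t := by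
  rw [outputSpectrum, maSpectrum]
  set z := Complex.exp (-Complex.I * t) with hz
  have hzn : ‖z‖ = 1 := by
    rw [hz, show -Complex.I * (t : ℂ) = ((-t : ℝ) : ℂ) * Complex.I by push_cast; ring]
    exact Complex.norm_exp_ofReal_mul_I _
  have hb : (β : ℂ) ≠ 0 := by exact_mod_cast h.coeff_ne_zero
  have hbz : ‖(β : ℂ) * z‖ < 1 := by
    rw [norm_mul, hzn, mul_one, Complex.norm_real, Real.norm_eq_abs, h.abs_coeff]
    exact h.lt_one
  have hne : 1 - (β : ℂ) * z ≠ 0 := by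
    intro h0
    rw [← sub_eq_zero.mp h0] at hbz
    simp at hbz
  have hg : (σ : ℂ) * β = α * β ^ 3 - 1 - α * β + β ^ 2 := by exact_mod_cast h.gain_mul
  have hallpass : ‖(β : ℂ) - z‖ = ‖1 - (β : ℂ) * z‖ := by
    have h1 : (β : ℂ) - z = -z * (starRingEnd ℂ) (1 - (β : ℂ) * z) := by
      have h2 : z * (starRingEnd ℂ) z = 1 := by rw [Complex.mul_conj', hzn]; simp
      simp only [map_sub, map_one, map_mul, Complex.conj_ofReal]
      linear_combination (-(β : ℂ)) * h2
    rw [h1, norm_mul, norm_neg, hzn, one_mul, Complex.norm_conj]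
  -- The numerator of the transfer function factors by the formula for σβ. Its zero z = β is
  -- reflected by (β - z)/(1 - βz), which has modulus one on the circle, leaving the factor 1 + αβ²z
  -- without zeros in the closed disc.
  have hfac : 1 + (α : ℂ) * z + σ * z / (1 - β * z) =
      (β : ℂ)⁻¹ * ((β - z) / (1 - β * z)) * (1 + α * β ^ 2 * z) := by
    rw [mul_div_assoc', mul_comm _ (_ + _ : ℂ), mul_div_assoc', eq_div_iff hne, add_mul,
      div_mul_cancel₀ _ hne]
    field_simp
    linear_combination z * hg
  rw [hfac, norm_mul, norm_mul, norm_div, hallpass, div_self (norm_ne_zero_iff.mpr hne), mul_one,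
    mul_pow, norm_inv, inv_pow, Complex.norm_real, Real.norm_eq_abs, sq_abs]

/-! ### The integral of the logarithm of the spectrum -/

theorem norm_one_add_mul_exp (a t : ℝ) :
    ‖1 + (a : ℂ) * Complex.exp (-Complex.I * t)‖ = ‖circleMap 0 1 t - (-a : ℂ)‖ := by
  have h1 : circleMap 0 1 t = Complex.exp (Complex.I * t) := by
    simp [circleMap, mul_comm]
  have h2 : ‖Complex.exp (Complex.I * t)‖ = 1 := by
    rw [mul_comm]; exact Complex.norm_exp_ofReal_mul_I _
  have h3 : Complex.exp (Complex.I * t) * Complex.exp (-Complex.I * t) = 1 := by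
    rw [← Complex.exp_add]; simp
  rw [h1, ← one_mul ‖1 + _‖, ← h2, ← norm_mul]
  congr 1
  linear_combination (a : ℂ) * h3

/-- Jensen's formula: 1 + az has no zero in the closed unit disc and equals 1 at the origin. In the
entropy integral only the constant x⁻² therefore survives. -/
theorem integral_log_norm_one_add_mul_exp {a : ℝ} (ha : |a| < 1) :
    ∫ t in (-Real.pi)..Real.pi, Real.log ‖1 + (a : ℂ) * Complex.exp (-Complex.I * t)‖ = 0 := by
  simp only [norm_one_add_mul_exp]
  have ha' : ‖(-a : ℂ)‖ < 1 := by simpa using ha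
  have h1 := circleAverage_log_norm_sub_const₀ ha'
  rw [Real.circleAverage, smul_eq_mul, mul_eq_zero] at h1
  have h2 := h1.resolve_left (by positivity)
  have hper : Function.Periodic (fun t => Real.log ‖circleMap 0 1 t - (-a : ℂ)‖) (2 * Real.pi) :=
    fun t => by simp only [periodic_circleMap 0 1 t]
  have h3 := hper.intervalIntegral_add_eq (-Real.pi) 0
  rw [show -Real.pi + 2 * Real.pi = Real.pi by ring, zero_add] at h3
  rw [h3]
  exact h2

theorem one_add_mul_exp_ne_zero {a : ℝ} (ha : |a| < 1) (t : ℝ) :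
    1 + (a : ℂ) * Complex.exp (-Complex.I * t) ≠ 0 := by
  intro h
  have h1 : ‖(a : ℂ) * Complex.exp (-Complex.I * t)‖ = 1 := by
    rw [← norm_neg, ← eq_neg_of_add_eq_zero_left h, norm_one]
  rw [norm_mul, show -Complex.I * (t : ℂ) = ((-t : ℝ) : ℂ) * Complex.I by push_cast; ring,
    Complex.norm_exp_ofReal_mul_I, mul_one, Complex.norm_real, Real.norm_eq_abs] at h1
  exact ha.ne h1

theorem continuous_log_norm_one_add_mul_exp {a : ℝ} (ha : |a| < 1) :
    Continuous fun t : ℝ => Real.log ‖1 + (a : ℂ) * Complex.exp (-Complex.I * t)‖ :=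
  Continuous.log (by fun_prop) fun t => norm_ne_zero_iff.mpr (one_add_mul_exp_ne_zero ha t)

theorem FilterRelations.abs_mul_sq_lt {α P x β σ : ℝ} (h : FilterRelations α P x β σ) :
    |α * β ^ 2| < 1 := by
  rw [abs_mul, abs_sq, h.coeff_sq]
  calc |α| * x ^ 2 ≤ 1 * x ^ 2 := by gcongr; exact h.abs_le
    _ < 1 := by rw [one_mul]; exact h.sq_lt_one

theorem FilterRelations.integral_logb_outputSpectrum {α P x β σ : ℝ}
    (h : FilterRelations α P x β σ) :
    (4 * Real.pi)⁻¹ * (∫ t in (-Real.pi)..Real.pi,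
        Real.logb 2 (2 * Real.pi * Real.exp 1 * outputSpectrum α β σ t)) =
      1 / 2 * Real.logb 2 (2 * Real.pi * Real.exp 1 * (x ^ 2)⁻¹) := by
  have ha := h.abs_mul_sq_lt
  set L : ℝ → ℝ := fun t => Real.log ‖1 + ((α * β ^ 2 : ℝ) : ℂ) * Complex.exp (-Complex.I * t)‖
    with hL
  have hx2 : 0 < x ^ 2 := pow_pos h.pos 2
  have h1 : ∀ t : ℝ, Real.logb 2 (2 * Real.pi * Real.exp 1 * outputSpectrum α β σ t) =
      Real.logb 2 (2 * Real.pi * Real.exp 1 * (x ^ 2)⁻¹) + 2 / Real.log 2 * L t := by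
    intro t
    have hne := norm_ne_zero_iff.mpr (one_add_mul_exp_ne_zero ha t)
    rw [h.outputSpectrum_eq, maSpectrum, h.coeff_sq, ← mul_assoc,
      Real.logb_mul (by positivity) (by push_cast at hne; positivity), Real.logb_pow, hL]
    simp only [Real.logb]
    push_cast
    ring
  simp only [h1]
  rw [intervalIntegral.integral_add (by simp)
    (((continuous_log_norm_one_add_mul_exp ha).const_mul _).intervalIntegrable _ _),
    intervalIntegral.integral_const_mul, integral_log_norm_one_add_mul_exp ha]
  simp only [intervalIntegral.integral_const, smul_eq_mul]
  field_simp
  ring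

theorem logb_entropy_sub {x : ℝ} (hx : 0 < x) :
    1 / 2 * Real.logb 2 (2 * Real.pi * Real.exp 1 * (x ^ 2)⁻¹) -
      1 / 2 * Real.logb 2 (2 * Real.pi * Real.exp 1) = -Real.logb 2 x := by
  rw [Real.logb_mul (by positivity) (by positivity), Real.logb_inv, Real.logb_pow]
  push_cast
  ring

end MA1Feedback

namespace MA1Feedback

/-! ### Differential entropy of linear images of Gaussian vectors -/

theorem logb_gaussianPDFReal (x : ℝ) : Real.logb 2 (gaussianPDFReal 0 1 x) =
    -(1 / 2 * Real.log (2 * Real.pi) / Real.log 2) - 1 / (2 * Real.log 2) * x ^ 2 := by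
  rw [gaussianPDFReal, Real.logb, Real.log_mul (by positivity) (Real.exp_pos _).ne', Real.log_inv,
    Real.log_sqrt (by positivity), Real.log_exp]
  simp only [NNReal.coe_one, mul_one, sub_zero]
  have : Real.log 2 ≠ 0 := (Real.log_pos one_lt_two).ne'
  field_simp
  ring

theorem integrable_sq_gaussianReal : Integrable (fun x : ℝ => x ^ 2) (gaussianReal 0 1) :=
  (memLp_id_gaussianReal' 2 (by simp)).integrable_sq

theorem integrable_logb_gaussianPDFReal :
    Integrable (fun x => Real.logb 2 (gaussianPDFReal 0 1 x)) (gaussianReal 0 1) := by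
  simp only [logb_gaussianPDFReal]
  exact (integrable_const _).sub (integrable_sq_gaussianReal.const_mul _)

theorem integral_logb_gaussianPDFReal :
    ∫ x, Real.logb 2 (gaussianPDFReal 0 1 x) ∂gaussianReal 0 1 =
      -(1 / 2 * Real.logb 2 (2 * Real.pi * Real.exp 1)) := by
  have h := variance_fun_id_gaussianReal (μ := 0) (v := 1)
  rw [variance_of_integral_eq_zero (by fun_prop) integral_id_gaussianReal] at h
  simp only [logb_gaussianPDFReal]
  rw [integral_sub (integrable_const _) (integrable_sq_gaussianReal.const_mul _),
    integral_const_mul, h, Real.logb, Real.log_mul (by positivity) (Real.exp_pos _).ne',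
    Real.log_exp]
  simp only [integral_const, probReal_univ, smul_eq_mul, NNReal.coe_one]
  have : Real.log 2 ≠ 0 := (Real.log_pos one_lt_two).ne'
  field_simp
  ring

/-- Here c is the reciprocal of the Jacobian. The density of the image is c times the Gaussian
density at the preimage, so the entropy shifts by -log c; a measurable left inverse is all that is
needed. -/
theorem hasDiffEntropy_map {n : ℕ} {Φ S : (Fin n → ℝ) → Fin n → ℝ} (hΦ : Measurable Φ)
    (hS : Measurable S) (hSΦ : ∀ v, S (Φ v) = v) {c : ℝ} (hc : 0 < c)
    (hvol : (volume : Measure (Fin n → ℝ)).map Φ = ENNReal.ofReal c • volume) :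
    HasDiffEntropy ((Measure.pi fun _ : Fin n => gaussianReal 0 1).map Φ)
      (n * (1 / 2 * Real.logb 2 (2 * Real.pi * Real.exp 1)) - Real.logb 2 c) := by
  set γ := Measure.pi fun _ : Fin n => gaussianReal 0 1 with hγ
  set g : (Fin n → ℝ) → ENNReal := fun y => ENNReal.ofReal c * ∏ i, gaussianPDF 0 1 (S y i)
  have hf := measurable_prod_gaussianPDF (n := n) 0 1
  have hfS : Measurable fun y => ∏ i, gaussianPDF 0 1 (S y i) := hf.comp hS
  have hg : Measurable g := hfS.const_mul _
  have hdens : γ.map Φ = volume.withDensity g := by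
    ext s hs
    rw [Measure.map_apply hΦ hs, hγ, pi_gaussianReal_eq_withDensity n 0 one_ne_zero,
      withDensity_apply _ (hΦ hs), withDensity_apply _ hs]
    have h1 : ∫⁻ y in s, ∏ i, gaussianPDF 0 1 (S y i) ∂(volume.map Φ) =
        ∫⁻ v in Φ ⁻¹' s, ∏ i, gaussianPDF 0 1 (v i) := by
      rw [setLIntegral_map hs hfS hΦ]
      simp only [hSΦ]
    rw [← h1, hvol, Measure.restrict_smul, lintegral_smul_measure, lintegral_const_mul _ hfS]
    rfl
  have hrn : ∀ᵐ y ∂γ.map Φ, (γ.map Φ).rnDeriv volume y = g y := by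
    rw [hdens]
    exact (withDensity_absolutelyContinuous _ _).ae_le (Measure.rnDeriv_withDensity _ hg)
  have hlog : ∀ y, Real.logb 2 (g y).toReal =
      Real.logb 2 c + ∑ i, Real.logb 2 (gaussianPDFReal 0 1 (S y i)) := by
    intro y
    have hpos : ∀ i, gaussianPDFReal 0 1 (S y i) ≠ 0 :=
      fun i => (gaussianPDFReal_pos _ _ _ one_ne_zero).ne'
    simp only [g, ENNReal.toReal_mul, ENNReal.toReal_ofReal hc.le, ENNReal.toReal_prod,
      toReal_gaussianPDF]
    rw [Real.logb_mul hc.ne' (Finset.prod_ne_zero_iff.mpr fun i _ => hpos i),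
      Real.logb_prod _ _ fun i _ => hpos i]
  have hlogm : Measurable fun y : Fin n → ℝ =>
      Real.logb 2 c + ∑ i, Real.logb 2 (gaussianPDFReal 0 1 (S y i)) := by
    refine measurable_const.add (Finset.measurable_fun_sum _ fun i _ => ?_)
    have h1 : Measurable fun y => S y i := (measurable_pi_apply i).comp hS
    exact (Real.measurable_log.comp ((measurable_gaussianPDFReal 0 1).comp h1)).div_const _
  have hint : ∀ i, Integrable (fun v : Fin n → ℝ => Real.logb 2 (gaussianPDFReal 0 1 (v i))) γ :=
    fun i => integrable_comp_eval (μ := fun _ : Fin n => gaussianReal 0 1)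
      integrable_logb_gaussianPDFReal
  have hsum : Integrable (fun v : Fin n → ℝ =>
      ∑ i, Real.logb 2 (gaussianPDFReal 0 1 (v i))) γ := integrable_finsetSum _ fun i _ => hint i
  have hae : (fun y => Real.logb 2 ((γ.map Φ).rnDeriv volume y).toReal) =ᵐ[γ.map Φ]
      fun y => Real.logb 2 c + ∑ i, Real.logb 2 (gaussianPDFReal 0 1 (S y i)) := by
    filter_upwards [hrn] with y hy
    rw [hy, hlog]
  refine ⟨?_, ?_, ?_⟩
  · rw [hdens]; exact withDensity_absolutelyContinuous _ _
  · rw [integrable_congr hae, integrable_map_measure hlogm.aestronglyMeasurable hΦ.aemeasurable]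
    simp only [Function.comp_def, hSΦ]
    exact (integrable_const _).add hsum
  · rw [integral_congr_ae hae, integral_map hΦ.aemeasurable hlogm.aestronglyMeasurable]
    simp only [hSΦ]
    rw [integral_add (integrable_const _) hsum, integral_finsetSum _ fun i _ => hint i]
    have h1 : ∀ i, ∫ v : Fin n → ℝ, Real.logb 2 (gaussianPDFReal 0 1 (v i)) ∂γ =
        -(1 / 2 * Real.logb 2 (2 * Real.pi * Real.exp 1)) := fun i => by
      rw [← integral_logb_gaussianPDFReal]
      exact integral_comp_eval (μ := fun _ : Fin n => gaussianReal 0 1)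
        integrable_logb_gaussianPDFReal.aestronglyMeasurable
    simp only [h1, integral_const, probReal_univ, Finset.sum_const, Finset.card_univ,
      Fintype.card_fin, smul_eq_mul, nsmul_eq_mul]
    ring

/-! ### Symmetric rank one perturbations of the identity -/

section RankOne

variable {n : ℕ}

/-- The linear map `1 + κ w wᵀ`. -/
noncomputable def rankOne (κ : ℝ) (w v : Fin n → ℝ) : Fin n → ℝ :=
  v + (κ * ∑ i, w i * v i) • w

theorem measurable_rankOne (κ : ℝ) (w : Fin n → ℝ) : Measurable (rankOne κ w) := by
  unfold rankOne; fun_prop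

theorem sum_mul_rankOne (κ : ℝ) (w a v : Fin n → ℝ) :
    ∑ i, a i * rankOne κ w v i = ∑ i, a i * v i + κ * (∑ i, w i * a i) * ∑ i, w i * v i := by
  simp only [rankOne, Pi.add_apply, Pi.smul_apply, smul_eq_mul, mul_add, Finset.sum_add_distrib]
  congr 1
  rw [mul_right_comm]
  generalize κ * ∑ i, w i * v i = c
  rw [Finset.mul_sum]
  exact Finset.sum_congr rfl fun i _ => by ring

theorem sum_mul_rankOne_comm (κ : ℝ) (w a v : Fin n → ℝ) :
    ∑ i, a i * rankOne κ w v i = ∑ i, rankOne κ w a i * v i := by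
  rw [sum_mul_rankOne]
  simp only [mul_comm (rankOne κ w a _)]
  rw [sum_mul_rankOne, mul_right_comm]
  congr 1
  exact Finset.sum_congr rfl fun i _ => mul_comm _ _

theorem sum_rankOne_sq (κ : ℝ) (w v : Fin n → ℝ) :
    ∑ i, rankOne κ w v i ^ 2 =
      ∑ i, v i ^ 2 + (2 * κ + κ ^ 2 * ∑ i, w i ^ 2) * (∑ i, w i * v i) ^ 2 := by
  have h1 : ∑ i, w i * rankOne κ w v i = ∑ i, w i * v i + κ * (∑ i, w i ^ 2) * ∑ i, w i * v i := by
    rw [sum_mul_rankOne]; simp only [sq]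
  have h2 : ∑ i, v i * rankOne κ w v i = ∑ i, v i ^ 2 + κ * (∑ i, w i * v i) ^ 2 := by
    rw [sum_mul_rankOne]; simp only [sq, mul_assoc]
  have h3 : ∀ i, rankOne κ w v i ^ 2 = v i * rankOne κ w v i +
      (κ * ∑ i, w i * v i) * (w i * rankOne κ w v i) := by
    intro i
    conv_lhs => rw [sq]; arg 1; rw [rankOne]
    simp only [Pi.add_apply, Pi.smul_apply, smul_eq_mul]
    ring
  simp only [h3, Finset.sum_add_distrib, ← Finset.mul_sum]
  rw [h1, h2]
  ring

theorem rankOne_rankOne {κ κ' : ℝ} {w : Fin n → ℝ} (h : κ + κ' + κ * κ' * ∑ i, w i ^ 2 = 0)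
    (v : Fin n → ℝ) : rankOne κ w (rankOne κ' w v) = v := by
  have h1 := sum_mul_rankOne κ' w w v
  conv_lhs => rw [rankOne]
  rw [h1, rankOne]
  funext i
  simp only [Pi.add_apply, Pi.smul_apply, smul_eq_mul, ← sq]
  linear_combination (w i * ∑ i, w i * v i) * h

/-- The matrix determinant lemma: det(1 + κ w wᵀ) = 1 + κ|w|². -/
theorem map_rankOne_volume {κ : ℝ} {w : Fin n → ℝ} (h : 0 < 1 + κ * ∑ i, w i ^ 2) :
    (volume : Measure (Fin n → ℝ)).map (rankOne κ w) =
      ENNReal.ofReal (1 + κ * ∑ i, w i ^ 2)⁻¹ • volume := by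
  let M : Matrix (Fin n) (Fin n) ℝ :=
    1 + Matrix.replicateCol Unit (κ • w) * Matrix.replicateRow Unit w
  have hdet : M.det = 1 + κ * ∑ i, w i ^ 2 := by
    rw [Matrix.det_one_add_replicateCol_mul_replicateRow]
    simp only [dotProduct, Pi.smul_apply, smul_eq_mul, Finset.mul_sum]
    congr 1
    exact Finset.sum_congr rfl fun i _ => by ring
  have hM : rankOne κ w = Matrix.toLin' M := by
    funext v i
    simp only [M, rankOne, Matrix.toLin'_apply, Matrix.add_mulVec, Matrix.one_mulVec,
      Pi.add_apply, Pi.smul_apply, smul_eq_mul]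
    congr 1
    simp only [Matrix.mulVec, dotProduct, Matrix.mul_apply, Matrix.replicateCol_apply,
      Matrix.replicateRow_apply, Finset.univ_unique, Finset.sum_singleton, Pi.smul_apply,
      smul_eq_mul, Finset.mul_sum, Finset.sum_mul]
    exact Finset.sum_congr rfl fun j _ => by ring
  rw [hM, Real.map_matrix_volume_pi_eq_smul_volume_pi (by rw [hdet]; exact h.ne'), hdet,
    abs_of_pos (inv_pos.mpr h)]

theorem integral_exp_sum_pi {ι : Type*} [Fintype ι] (a : ι → ℝ) :
    ∫ v : ι → ℝ, Complex.exp ((∑ i, a i * v i : ℝ) * Complex.I)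
      ∂Measure.pi (fun _ => gaussianReal 0 1) = Complex.exp (-(∑ i, a i ^ 2 : ℝ) / 2) := by
  have h1 : ∀ v : ι → ℝ, Complex.exp ((∑ i, a i * v i : ℝ) * Complex.I) =
      ∏ i, Complex.exp (a i * v i * Complex.I) := by
    intro v
    rw [← Complex.exp_sum]
    push_cast
    rw [Finset.sum_mul]
  simp only [h1]
  rw [integral_fintype_prod_eq_prod (f := fun i (x : ℝ) => Complex.exp (a i * x * Complex.I))]
  have h2 : ∀ i, ∫ x : ℝ, Complex.exp (a i * x * Complex.I) ∂gaussianReal 0 1 =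
      Complex.exp (-(a i ^ 2 : ℝ) / 2) := by
    intro i
    rw [← charFun_apply_real, charFun_gaussianReal]
    congr 1
    push_cast
    ring
  simp only [h2, ← Complex.exp_sum]
  congr 1
  push_cast
  rw [← Finset.sum_div, Finset.sum_neg_distrib]

theorem integral_exp_gaussianReal (p : NNReal) (b : ℝ) :
    ∫ x : ℝ, Complex.exp ((b * x : ℝ) * Complex.I) ∂gaussianReal 0 p =
      Complex.exp (-(p * b ^ 2 : ℝ) / 2) := by
  have h := charFun_gaussianReal (μ := 0) (v := p) b
  rw [charFun_apply_real] at h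
  push_cast
  rw [h]
  congr 1
  push_cast
  ring

/-- Two independent Gaussian multiples of fixed vectors, added to a standard Gaussian vector, act
as two rank one perturbations. -/
theorem map_add_mul_add_mul {p : NNReal} {w w' w'' : Fin n → ℝ} {κ κ' : ℝ}
    (h : 2 * κ + κ ^ 2 * ∑ i, w i ^ 2 = p) (h' : 2 * κ' + κ' ^ 2 * ∑ i, w'' i ^ 2 = 1)
    (hw : rankOne κ w w'' = w') :
    ((gaussianReal 0 p).prod innovationLaw).map
        (fun q (i : Fin n) => q.2 ((i : ℕ) + 1) + q.1 * w i + q.2 0 * w' i) =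
      (Measure.pi fun _ : Fin n => gaussianReal 0 1).map (rankOne κ w ∘ rankOne κ' w'') := by
  have hm : Measurable fun (q : ℝ × (ℕ → ℝ)) (i : Fin n) =>
      q.2 ((i : ℕ) + 1) + q.1 * w i + q.2 0 * w' i := by
    refine measurable_pi_lambda _ fun i => ?_
    have h1 : ∀ k, Measurable fun q : ℝ × (ℕ → ℝ) => q.2 k :=
      fun k => (measurable_pi_apply k).comp measurable_snd
    exact ((h1 _).add (measurable_fst.mul_const _)).add ((h1 0).mul_const _)
  have hm' : Measurable (rankOne κ w ∘ rankOne κ' w'') :=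
    (measurable_rankOne κ w).comp (measurable_rankOne κ' w'')
  have := Measure.isProbabilityMeasure_map
    (μ := (gaussianReal 0 p).prod innovationLaw) hm.aemeasurable
  have := Measure.isProbabilityMeasure_map
    (μ := Measure.pi fun _ : Fin n => gaussianReal 0 1) hm'.aemeasurable
  refine Measure.ext_of_charFunDual ?_
  funext L
  obtain ⟨a, hL⟩ := exists_coeff L
  rw [charFunDual_apply, charFunDual_apply, integral_map hm.aemeasurable (by fun_prop),
    integral_map hm'.aemeasurable (by fun_prop)]
  set s := ∑ i, a i * w i with hs
  set s' := ∑ i, a i * w' i with hs'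
  have hR : ∀ v : Fin n → ℝ, L ((rankOne κ w ∘ rankOne κ' w'') v) =
      ∑ i, rankOne κ' w'' (rankOne κ w a) i * v i := by
    intro v
    rw [hL, Function.comp, sum_mul_rankOne_comm, sum_mul_rankOne_comm]
  -- Equality of covariances: with A = 1 + κ w wᵀ symmetric, A² = 1 + p w wᵀ and A w'' = w', the
  -- composite has covariance A(1 + w'' w''ᵀ)A = 1 + p w wᵀ + w' w'ᵀ.
  have hsq : ∑ i, rankOne κ' w'' (rankOne κ w a) i ^ 2 = ∑ i, a i ^ 2 + p * s ^ 2 + s' ^ 2 := by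
    rw [sum_rankOne_sq, h', sum_rankOne_sq, h, sum_mul_rankOne_comm, hw]
    simp only [mul_comm (w _), mul_comm (w' _), one_mul, hs, hs']
  simp only [hR]
  rw [integral_exp_sum_pi, hsq]
  have hl : ∀ q : ℝ × (ℕ → ℝ), L (fun i => q.2 ((i : ℕ) + 1) + q.1 * w i + q.2 0 * w' i) =
      s * q.1 + ∑ j : Fin (n + 1), (Fin.cons s' a : Fin (n + 1) → ℝ) j * q.2 j := by
    intro q
    rw [hL, Fin.sum_univ_succ]
    simp only [Fin.cons_zero, Fin.cons_succ, mul_add, Finset.sum_add_distrib, Fin.val_zero,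
      Fin.val_succ, hs, hs', Finset.sum_mul]
    have e1 : ∀ i, a i * (q.1 * w i) = a i * w i * q.1 := fun i => by ring
    have e2 : ∀ i, a i * (q.2 0 * w' i) = a i * w' i * q.2 0 := fun i => by ring
    simp only [e1, e2]
    ring
  simp only [hl, Complex.ofReal_add, add_mul, Complex.exp_add]
  rw [integral_prod_mul (f := fun x : ℝ => Complex.exp ((s * x : ℝ) * Complex.I))
    (g := fun u : ℕ → ℝ => Complex.exp
      ((∑ j : Fin (n + 1), (Fin.cons s' a : Fin (n + 1) → ℝ) j * u j : ℝ) * Complex.I)),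
    integral_exp_gaussianReal]
  have hpi := innovationLaw_map_comp (f := fun j : Fin (n + 1) => (j : ℕ)) Fin.val_injective
  have hmi : Measurable fun (u : ℕ → ℝ) (j : Fin (n + 1)) => u (j : ℕ) :=
    measurable_pi_lambda _ fun j => measurable_pi_apply _
  have hI := integral_exp_sum_pi (Fin.cons s' a : Fin (n + 1) → ℝ)
  rw [← hpi, integral_map hmi.aemeasurable
    (Continuous.aestronglyMeasurable (by fun_prop))] at hI
  rw [hI, ← Complex.exp_add, Fin.sum_univ_succ]
  simp only [Fin.cons_zero, Fin.cons_succ]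
  congr 1
  push_cast
  ring

end RankOne

end MA1Feedback

namespace MA1Feedback

/-! ### The entropy rate of the output -/

theorem arInput_filterState (α β σ : ℝ) (y : ℕ → ℝ) (k : ℕ) :
    arInput β σ 0 (consSeq 0 fun j => (filterState α β σ 0 0 y (j + 1)).2) k =
      (filterState α β σ 0 0 y k).1 := by
  induction k with
  | zero => rfl
  | succ k ih =>
    rw [arInput, ih]
    simp only [consSeq, filterState]

theorem arOutput_filterState (α β σ : ℝ) (y : ℕ → ℝ) (k : ℕ) :
    arOutput α β σ 0 (consSeq 0 fun j => (filterState α β σ 0 0 y (j + 1)).2) k = y k := by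
  rw [arOutput, arInput_filterState, maNoise]
  cases k with
  | zero => simp only [consSeq, filterState]; ring
  | succ k => simp only [consSeq, filterState]; ring

/-- The outputs are a causal shear of the innovations, shifted by the first input and the
time-zero innovation along fixed directions. -/
theorem arOutput_eq_truncate (α β σ x : ℝ) (u : ℕ → ℝ) (n : ℕ) :
    (fun i : Fin n => arOutput α β σ x u i) =
      truncate (fun v => arOutput α β σ 0 (consSeq 0 v)) n fun i : Fin n =>
        u ((i : ℕ) + 1) + x * -inputSensitivity α β σ ((i : ℕ) + 1) +
          u 0 * -initialSensitivity α β σ ((i : ℕ) + 1) := by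
  funext i
  have hT := isCausalShear_arOutput α β σ 0 0
  rw [hT.truncate_apply_of_eq
    (u := fun j => (filterState α β σ 0 0 (arOutput α β σ x u) (j + 1)).2)]
  · exact (arOutput_filterState α β σ (arOutput α β σ x u) i).symm
  · intro j
    have h1 := congrArg Prod.snd (filterState_eq_add α β σ x (u 0) (arOutput α β σ x u) (j + 1))
    rw [filterState_arOutput] at h1
    simp only [Prod.snd_add, Prod.smul_snd, smul_eq_mul] at h1
    rw [h1, inputSensitivity, initialSensitivity]
    ring

/-- The size of the rank one perturbation which produces the variance `p` in direction `w`. -/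
theorem exists_rankOne_coeff {s p : ℝ} (hs : 0 ≤ s) (hp : 0 ≤ p) :
    ∃ κ, 1 + κ * s = Real.sqrt (1 + p * s) ∧ 2 * κ + κ ^ 2 * s = p := by
  set r := Real.sqrt (1 + p * s) with hr
  have hr0 : 0 ≤ r := Real.sqrt_nonneg _
  have hr2 : r ^ 2 = 1 + p * s := Real.sq_sqrt (by positivity)
  have hne : 1 + r ≠ 0 := by positivity
  -- The solution (r - 1)/s in rationalized form, which also covers s = 0.
  refine ⟨p / (1 + r), ?_, ?_⟩
  · field_simp
    linear_combination -hr2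
  · field_simp
    linear_combination -p * hr2

/-- The energy of a vector after the inverse perturbation. -/
theorem sum_rankOne_inv_sq_le {n : ℕ} {p κ c : ℝ} (hp : 0 ≤ p) (hc : p ≠ 0 ∨ c = 0)
    {w v : Fin n → ℝ} (h1 : 0 < 1 + κ * ∑ i, w i ^ 2) (h2 : 2 * κ + κ ^ 2 * ∑ i, w i ^ 2 = p) :
    ∑ i, rankOne (-κ / (1 + κ * ∑ i, w i ^ 2)) w v i ^ 2 ≤
      ∑ i, (v i - c * w i) ^ 2 + c ^ 2 / p := by
  set s := ∑ i, w i ^ 2 with hs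
  set q := ∑ i, w i * v i with hq
  have hs0 : 0 ≤ s := Finset.sum_nonneg fun i _ => sq_nonneg _
  have hr : (1 + κ * s) ^ 2 = 1 + p * s := by rw [← h2]; ring
  have hr0 : 0 < 1 + p * s := by positivity
  have e1 : 2 * (-κ / (1 + κ * s)) + (-κ / (1 + κ * s)) ^ 2 * s = -(p / (1 + p * s)) := by
    rw [← hr, ← h2]
    field_simp
    ring
  have e2 : ∑ i, (v i - c * w i) ^ 2 = ∑ i, v i ^ 2 - 2 * c * q + c ^ 2 * s := by
    rw [hq, hs, Finset.mul_sum, Finset.mul_sum, ← Finset.sum_sub_distrib, ← Finset.sum_add_distrib]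
    exact Finset.sum_congr rfl fun i _ => by ring
  rw [sum_rankOne_sq, e1, e2]
  rcases hc with hc | rfl
  · have hp' : 0 < p := lt_of_le_of_ne hp (Ne.symm hc)
    -- The left side of the lemma is the minimum over c of the regularized least squares functional
    -- on the right; this is the completed square. For p = 0 division by zero gives c²/p = 0, which
    -- is why c = 0 is then required.
    have e3 : -2 * c * q + c ^ 2 * s + c ^ 2 / p + p / (1 + p * s) * q ^ 2 =
        (c * (1 + p * s) - p * q) ^ 2 / (p * (1 + p * s)) := by
      field_simp
      ring
    have e4 : 0 ≤ (c * (1 + p * s) - p * q) ^ 2 / (p * (1 + p * s)) := by positivity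
    linarith
  · have e4 : 0 ≤ p / (1 + p * s) * q ^ 2 := by positivity
    simp only [ne_eq, OfNat.ofNat_ne_zero, not_false_eq_true, zero_pow, zero_div, zero_mul, mul_zero]
    linarith

/-- The causal shear preserves volume, so the entropy is that of a Gaussian vector with covariance 1
+ p w wᵀ + w' w'ᵀ, where w and w' are the negated sensitivities. Its determinant is (1 + p|w|²)(1 +
ρ), where ρ is the energy of w' after undoing the first perturbation. The bound with free c says
that ρ is small as soon as w' is nearly parallel to w. -/
theorem exists_hasDiffEntropy_arOutput (α β σ : ℝ) (p : NNReal) (n : ℕ) :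
    ∃ ρ : ℝ, 0 ≤ ρ ∧
      (∀ c : ℝ, (p : ℝ) ≠ 0 ∨ c = 0 → ρ ≤ ∑ i : Fin n, (initialSensitivity α β σ ((i : ℕ) + 1) -
        c * inputSensitivity α β σ ((i : ℕ) + 1)) ^ 2 + c ^ 2 / p) ∧
      HasDiffEntropy (((gaussianReal 0 p).prod innovationLaw).map
          fun q (i : Fin n) => arOutput α β σ q.1 q.2 i)
        (n * (1 / 2 * Real.logb 2 (2 * Real.pi * Real.exp 1)) +
          1 / 2 * Real.logb 2 (1 + p * precision α β σ n) + 1 / 2 * Real.logb 2 (1 + ρ)) := by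
  set w : Fin n → ℝ := fun i => -inputSensitivity α β σ ((i : ℕ) + 1) with hw
  set w' : Fin n → ℝ := fun i => -initialSensitivity α β σ ((i : ℕ) + 1) with hw'
  have hs : ∑ i, w i ^ 2 = precision α β σ n := by simp only [hw, neg_sq, precision]
  have hs0 : 0 ≤ precision α β σ n := Finset.sum_nonneg fun i _ => sq_nonneg _
  obtain ⟨κ, hκ, hκp⟩ := exists_rankOne_coeff hs0 p.coe_nonneg
  rw [← hs] at hκ hκp
  have hpos : 0 < 1 + κ * ∑ i, w i ^ 2 := by
    rw [hκ, hs]; exact Real.sqrt_pos.mpr (by positivity)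
  set w'' := rankOne (-κ / (1 + κ * ∑ i, w i ^ 2)) w w' with hw''
  set ρ := ∑ i, w'' i ^ 2 with hρ
  have hρ0 : 0 ≤ ρ := Finset.sum_nonneg fun i _ => sq_nonneg _
  obtain ⟨κ', hκ', hκp'⟩ := exists_rankOne_coeff hρ0 zero_le_one
  have hpos' : 0 < 1 + κ' * ρ := by rw [hκ']; exact Real.sqrt_pos.mpr (by positivity)
  have hcancel : ∀ {κ s : ℝ}, 0 < 1 + κ * s → -κ / (1 + κ * s) + κ + -κ / (1 + κ * s) * κ * s = 0 := by
    intro κ s h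
    field_simp
    ring
  have hinv : ∀ v, rankOne (-κ / (1 + κ * ∑ i, w i ^ 2)) w (rankOne κ w v) = v :=
    rankOne_rankOne (hcancel hpos)
  have hinv' : ∀ v, rankOne (-κ' / (1 + κ' * ρ)) w'' (rankOne κ' w'' v) = v :=
    rankOne_rankOne (hcancel hpos')
  have hww : rankOne κ w w'' = w' := rankOne_rankOne (by linarith [hcancel hpos]) w'
  refine ⟨ρ, hρ0, fun c hc => ?_, ?_⟩
  · refine (sum_rankOne_inv_sq_le p.coe_nonneg hc hpos hκp).trans_eq ?_
    congr 1
    exact Finset.sum_congr rfl fun i _ => by simp only [hw, hw']; ring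
  have hT := isCausalShear_arOutput α β σ 0 0
  set T := fun v => arOutput α β σ 0 (consSeq 0 v) with hTdef
  have hTm := hT.measurable_truncate n
  have hm1 := measurable_rankOne κ w
  have hm2 := measurable_rankOne κ' w''
  have hA : Measurable fun (q : ℝ × (ℕ → ℝ)) (i : Fin n) =>
      q.2 ((i : ℕ) + 1) + q.1 * w i + q.2 0 * w' i := by
    refine measurable_pi_lambda _ fun i => ?_
    have h1 : ∀ k, Measurable fun q : ℝ × (ℕ → ℝ) => q.2 k :=
      fun k => (measurable_pi_apply k).comp measurable_snd
    exact ((h1 _).add (measurable_fst.mul_const _)).add ((h1 0).mul_const _)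
  have hlaw : ((gaussianReal 0 p).prod innovationLaw).map
      (fun q (i : Fin n) => arOutput α β σ q.1 q.2 i) =
      (Measure.pi fun _ : Fin n => gaussianReal 0 1).map
        (truncate T n ∘ (rankOne κ w ∘ rankOne κ' w'')) := by
    have h1 : (fun (q : ℝ × (ℕ → ℝ)) (i : Fin n) => arOutput α β σ q.1 q.2 i) =
        truncate T n ∘ fun q i => q.2 ((i : ℕ) + 1) + q.1 * w i + q.2 0 * w' i :=
      funext fun q => arOutput_eq_truncate α β σ q.1 q.2 n
    rw [h1, ← Measure.map_map hTm (hm1.comp hm2), ← map_add_mul_add_mul hκp hκp' hww,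
      Measure.map_map hTm hA]
  have hS : Measurable fun (y : Fin n → ℝ) (i : Fin n) =>
      (filterState α β σ 0 0 (zeroExtend y) ((i : ℕ) + 1)).2 :=
    measurable_pi_lambda _ fun i =>
      (measurable_filterState measurable_const measurable_zeroExtend _).snd
  have hvol : (volume : Measure (Fin n → ℝ)).map (truncate T n ∘ (rankOne κ w ∘ rankOne κ' w'')) =
      ENNReal.ofReal ((1 + κ' * ρ)⁻¹ * (1 + κ * ∑ i, w i ^ 2)⁻¹) • volume := by
    rw [← Measure.map_map hTm (hm1.comp hm2), ← Measure.map_map hm1 hm2, map_rankOne_volume hpos',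
      Measure.map_smul, map_rankOne_volume hpos, smul_smul, Measure.map_smul,
      (hT.measurePreserving_truncate n).map_eq, ENNReal.ofReal_mul (inv_nonneg.mpr hpos'.le)]
  have hent := hasDiffEntropy_map (hTm.comp (hm1.comp hm2))
    ((measurable_rankOne (-κ' / (1 + κ' * ρ)) w'').comp
      ((measurable_rankOne (-κ / (1 + κ * ∑ i, w i ^ 2)) w).comp hS))
    (fun v => by
      simp only [Function.comp]
      rw [filterState_truncate, hinv, hinv']) (by positivity) hvol
  rw [hlaw]
  convert hent using 1
  rw [Real.logb_mul (inv_pos.mpr hpos').ne' (inv_pos.mpr hpos).ne', Real.logb_inv, Real.logb_inv,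
    hκ, hκ', hs, one_mul]
  have hsqrt : ∀ {y : ℝ}, 0 ≤ y → Real.logb 2 (Real.sqrt y) = 1 / 2 * Real.logb 2 y := by
    intro y hy
    rw [Real.logb, Real.log_sqrt hy, Real.logb]
    ring
  rw [hsqrt (by positivity), hsqrt (by positivity)]
  ring

/-! ### From finite-block entropies to entropy rates. -/

section Rate

variable {Ω : Type*} [MeasurableSpace Ω] {μ : Measure Ω} [IsProbabilityMeasure μ]
  {U : ℕ → Ω → ℝ} {X₁ : Ω → ℝ} {p : NNReal} {α β σ : ℝ}

theorem hasLaw_prod_innovationLaw (hU : ∀ k, HasLaw (U k) (gaussianReal 0 1) μ)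
    (hUindep : iIndepFun U μ) (hX₁ : HasLaw X₁ (gaussianReal 0 p) μ)
    (hX₁U : IndepFun X₁ (fun ω k => U k ω) μ) :
    HasLaw (fun ω => (X₁ ω, fun k => U k ω)) ((gaussianReal 0 p).prod innovationLaw) μ :=
  (indepFun_iff_hasLaw_prodMk_prod hX₁ (hUindep.hasLaw_infinitePi hU
    (aemeasurable_pi_lambda _ fun k => (hU k).aemeasurable))).mp hX₁U

theorem measurable_arOutput_vector (α β σ : ℝ) (n : ℕ) :
    Measurable fun (q : ℝ × (ℕ → ℝ)) (i : Fin n) => arOutput α β σ q.1 q.2 i := by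
  have h0 : ∀ k, Measurable fun q : ℝ × (ℕ → ℝ) => q.2 k :=
    fun k => (measurable_pi_apply k).comp measurable_snd
  have h1 : ∀ k, Measurable fun q : ℝ × (ℕ → ℝ) => arInput β σ q.1 q.2 k := by
    intro k
    induction k with
    | zero => exact measurable_fst
    | succ k ih => exact (ih.const_mul _).add ((h0 _).const_mul _)
  exact measurable_pi_lambda _ fun i => (h1 _).add (((h0 _).const_mul _).add (h0 _))

theorem tendsto_logb_div_zero {ρ : ℕ → ℝ} {D : ℝ} (hD : 0 ≤ D) (h0 : ∀ n, 0 ≤ ρ n)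
    (h1 : ∀ n, ρ n ≤ n + D) : Tendsto (fun n : ℕ => Real.logb 2 (1 + ρ n) / n) atTop (𝓝 0) := by
  have hlog2 : 0 < Real.log 2 := Real.log_pos one_lt_two
  have hn : Tendsto (fun n : ℕ => Real.log n / n) atTop (𝓝 0) :=
    Real.isLittleO_log_id_atTop.tendsto_div_nhds_zero.comp tendsto_natCast_atTop_atTop
  have hu : Tendsto (fun n : ℕ => (Real.log (2 * (1 + D)) / n + Real.log n / n) / Real.log 2)
      atTop (𝓝 0) := by
    simpa using ((tendsto_const_div_atTop_nhds_zero_nat (Real.log (2 * (1 + D)))).add hn).div_const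
      (Real.log 2)
  refine tendsto_of_tendsto_of_tendsto_of_le_of_le' tendsto_const_nhds hu ?_ ?_
  · exact Eventually.of_forall fun n => div_nonneg
      (Real.logb_nonneg one_lt_two (by linarith [h0 n])) n.cast_nonneg
  · filter_upwards [eventually_ge_atTop 1] with n hn1
    have hn0 : (1 : ℝ) ≤ n := by exact_mod_cast hn1
    have hle : 1 + ρ n ≤ 2 * (1 + D) * n := by nlinarith [h1 n, mul_nonneg hD (sub_nonneg.mpr hn0)]
    have hlog : Real.log (1 + ρ n) ≤ Real.log (2 * (1 + D)) + Real.log n := by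
      rw [← Real.log_mul (by positivity) (by positivity)]
      exact Real.log_le_log (by linarith [h0 n]) hle
    rw [Real.logb, div_right_comm, ← add_div]
    gcongr

/-- If the sensitivity to U 0 is a multiple c of that to X_1 up to a bounded remainder, then ρ is at
most linear in n and its logarithm disappears after division by n. -/
theorem hasEntropyRate_arOutput (hU : ∀ k, HasLaw (U k) (gaussianReal 0 1) μ)
    (hUindep : iIndepFun U μ) (hX₁ : HasLaw X₁ (gaussianReal 0 p) μ)
    (hX₁U : IndepFun X₁ (fun ω k => U k ω) μ) {c C : ℝ} (hc : (p : ℝ) ≠ 0 ∨ c = 0)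
    (hres : ∀ k, (initialSensitivity α β σ k - c * inputSensitivity α β σ k) ^ 2 ≤ 1)
    (hC : Tendsto (fun n : ℕ => 1 / 2 * Real.logb 2 (1 + p * precision α β σ n) / n) atTop (𝓝 C)) :
    HasEntropyRate (fun k ω => arOutput α β σ (X₁ ω) (fun j => U j ω) k)
      (1 / 2 * Real.logb 2 (2 * Real.pi * Real.exp 1) + C) μ := by
  choose ρ hρ0 hρ hent using exists_hasDiffEntropy_arOutput α β σ p
  refine ⟨fun n => n * (1 / 2 * Real.logb 2 (2 * Real.pi * Real.exp 1)) +
    1 / 2 * Real.logb 2 (1 + p * precision α β σ n) + 1 / 2 * Real.logb 2 (1 + ρ n),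
    fun n _ => ?_, ?_⟩
  · have hlaw := hasLaw_prod_innovationLaw hU hUindep hX₁ hX₁U
    have hmap : μ.map (fun ω (i : Fin n) => arOutput α β σ (X₁ ω) (fun j => U j ω) i) =
        ((gaussianReal 0 p).prod innovationLaw).map
          (fun q (i : Fin n) => arOutput α β σ q.1 q.2 i) := by
      rw [← hlaw.map_eq, AEMeasurable.map_map_of_aemeasurable
        (measurable_arOutput_vector α β σ n).aemeasurable hlaw.aemeasurable]
      rfl
    rw [hmap]
    exact hent n
  · have h1 : ∀ n, ρ n ≤ n + c ^ 2 / p := by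
      intro n
      refine (hρ n c hc).trans (add_le_add ?_ le_rfl)
      calc _ ≤ ∑ _i : Fin n, (1 : ℝ) := Finset.sum_le_sum fun i _ => hres _
        _ = n := by simp
    have h2 := tendsto_logb_div_zero (by positivity) hρ0 h1
    have h3 : Tendsto (fun n : ℕ => 1 / 2 * Real.logb 2 (2 * Real.pi * Real.exp 1) +
        1 / 2 * Real.logb 2 (1 + p * precision α β σ n) / n +
          1 / 2 * (Real.logb 2 (1 + ρ n) / n)) atTop
        (𝓝 (1 / 2 * Real.logb 2 (2 * Real.pi * Real.exp 1) + C + 1 / 2 * 0)) :=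
      (tendsto_const_nhds.add hC).add (h2.const_mul _)
    rw [mul_zero, add_zero] at h3
    refine h3.congr' ?_
    filter_upwards [eventually_ge_atTop 1] with n hn
    have hn0 : (n : ℝ) ≠ 0 := by positivity
    field_simp

/-- The precision lies between constant multiples of x^(-2n), so half its logarithm grows at the
rate -log x per output; this is the excess of the output entropy rate over that of the noise. -/
theorem FilterRelations.tendsto_logb_precision {P x : ℝ} (h : FilterRelations α P x β σ) :
    Tendsto (fun n : ℕ => 1 / 2 * Real.logb 2 (1 + P * precision α β σ n) / n) atTop
      (𝓝 (-Real.logb 2 x)) := by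
  obtain ⟨K, hK, hKn⟩ := h.precision_le
  have hP := h.power_pos
  have hx := h.pos
  have hlim : ∀ a : ℝ, Tendsto (fun n : ℕ => 1 / 2 * Real.logb 2 a / n + -Real.logb 2 x) atTop
      (𝓝 (-Real.logb 2 x)) := fun a => by
    simpa using (tendsto_const_div_atTop_nhds_zero_nat (1 / 2 * Real.logb 2 a)).add_const
      (-Real.logb 2 x)
  have hexp : ∀ {a : ℝ}, 0 < a → ∀ {n : ℕ}, 1 ≤ n →
      1 / 2 * Real.logb 2 (a * (x⁻¹ ^ n) ^ 2) / n = 1 / 2 * Real.logb 2 a / n + -Real.logb 2 x := by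
    intro a ha n hn
    have hn0 : (n : ℝ) ≠ 0 := by positivity
    rw [Real.logb_mul ha.ne' (by positivity), Real.logb_pow, Real.logb_pow, Real.logb_inv]
    push_cast
    field_simp
  refine tendsto_of_tendsto_of_tendsto_of_le_of_le' (hlim (P * x ^ 2)) (hlim (1 + P * K)) ?_ ?_
  · filter_upwards [eventually_ge_atTop 1] with n hn
    rw [← hexp (by positivity) hn]
    have h1 := h.le_precision hn
    have h2 : P * x ^ 2 * (x⁻¹ ^ n) ^ 2 ≤ 1 + P * precision α β σ n := by
      have := mul_le_mul_of_nonneg_left h1 hP.le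
      linarith
    have := Real.logb_le_logb_of_le one_lt_two (by positivity) h2
    gcongr
  · filter_upwards [eventually_ge_atTop 1] with n hn
    rw [← hexp (by positivity) hn]
    have h1 : 1 ≤ (x⁻¹ ^ n) ^ 2 :=
      one_le_pow₀ (one_le_pow₀ ((one_le_inv₀ hx).mpr h.lt_one.le))
    have h2 : 1 + P * precision α β σ n ≤ (1 + P * K) * (x⁻¹ ^ n) ^ 2 := by
      have := mul_le_mul_of_nonneg_left (hKn n) hP.le
      linarith
    have h3 : 0 ≤ precision α β σ n := Finset.sum_nonneg fun i _ => sq_nonneg _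
    have := Real.logb_le_logb_of_le one_lt_two (by positivity) h2
    gcongr

theorem FilterRelations.hasEntropyRate_output {P x : ℝ} (h : FilterRelations α P x β σ)
    (hU : ∀ k, HasLaw (U k) (gaussianReal 0 1) μ) (hUindep : iIndepFun U μ)
    (hX₁ : HasLaw X₁ (gaussianReal 0 P.toNNReal) μ) (hX₁U : IndepFun X₁ (fun ω k => U k ω) μ) :
    HasEntropyRate (fun k ω => arOutput α β σ (X₁ ω) (fun j => U j ω) k)
      (1 / 2 * Real.logb 2 (2 * Real.pi * Real.exp 1 * (x ^ 2)⁻¹)) μ := by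
  have hP : ((P.toNNReal : NNReal) : ℝ) = P := Real.coe_toNNReal _ h.power_pos.le
  have hC := h.tendsto_logb_precision
  rw [← hP] at hC
  have hres : ∀ k, (initialSensitivity α β σ k -
      (α - α * β ^ 2) * inputSensitivity α β σ k) ^ 2 ≤ 1 := by
    intro k
    rw [h.initialSensitivity_eq, add_sub_cancel_right, sq_le_one_iff_abs_le_one, abs_pow, abs_neg]
    exact pow_le_one₀ (abs_nonneg _) h.abs_mul_sq_lt.le
  have := hasEntropyRate_arOutput hU hUindep hX₁ hX₁U
    (Or.inl (by rw [hP]; exact h.power_pos.ne')) hres hC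
  rwa [← logb_entropy_sub h.pos, add_sub_cancel] at this

/-- The degenerate case β = σ = 0 with first input zero, i.e. p = 0 and c = 0. The sensitivity to U
0 is then (-α)^k, bounded even for |α| = 1. -/
theorem hasEntropyRate_maNoise (hα : |α| ≤ 1) (hU : ∀ k, HasLaw (U k) (gaussianReal 0 1) μ)
    (hUindep : iIndepFun U μ) :
    HasEntropyRate (fun k ω => maNoise α (fun j => U j ω) k)
      (1 / 2 * Real.logb 2 (2 * Real.pi * Real.exp 1)) μ := by
  have hzero : ∀ u k, arInput 0 0 0 u k = 0 := by
    intro u k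
    cases k <;> simp [arInput]
  have hstate : ∀ k, filterState α 0 0 0 1 0 k = (0, (-α) ^ k) := by
    intro k
    induction k with
    | zero => simp [filterState]
    | succ k ih => simp [filterState, ih, pow_succ, mul_comm]
  have hX : HasLaw (fun _ : Ω => (0 : ℝ)) (gaussianReal 0 0) μ :=
    ⟨aemeasurable_const, by rw [Measure.map_const]; simp⟩
  have h := hasEntropyRate_arOutput (α := α) (β := 0) (σ := 0) (c := 0) (C := 0) hU hUindep hX
    (indepFun_const_left _ _) (Or.inr rfl) (fun k => ?_) (by simp)
  · simpa only [arOutput, hzero, zero_add, add_zero] using h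
  · rw [initialSensitivity, hstate, zero_mul, sub_zero, sq_le_one_iff_abs_le_one, abs_pow, abs_neg]
    exact pow_le_one₀ (abs_nonneg _) hα

end Rate

end MA1Feedback

namespace MA1Feedback

/-! ### The feedback capacity -/

/-- A code without side information is one that ignores it, so the converse for revealed U 0 and the
achievability without it settle both channels. -/
theorem FilterRelations.isFeedbackCapacity_noSide {α P x β σ : ℝ}
    (h : FilterRelations α P x β σ) : IsFeedbackCapacity noSide α P (-Real.logb 2 x) := by
  refine ⟨fun _ => -Real.logb 2 x, ⟨fun ε hε => h.achievable hε, fun ε hε M c hc => ?_⟩,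
    tendsto_const_nhds⟩
  obtain ⟨δ, hδ, hle⟩ := h.converse hε M (fun n => (c n).forget) fun n hn =>
    ⟨(hc n hn).1, ((c n).forget_powerConstraint revealed α P).mpr (hc n hn).2⟩
  exact ⟨δ, hδ, fun n hn => by rw [← (c n).forget_errorProb revealed α]; exact hle n hn⟩

theorem FilterRelations.isFeedbackCapacity_revealed {α P x β σ : ℝ}
    (h : FilterRelations α P x β σ) : IsFeedbackCapacity revealed α P (-Real.logb 2 x) := by
  refine ⟨fun _ => -Real.logb 2 x, ⟨fun ε hε => ?_, fun ε hε M c hc => h.converse hε M c hc⟩,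
    tendsto_const_nhds⟩
  obtain ⟨M, c, hc, hlim⟩ := h.achievable hε
  refine ⟨M, fun n => (c n).forget, fun n hn =>
    ⟨(hc n hn).1, ((c n).forget_powerConstraint revealed α P).mpr (hc n hn).2⟩, ?_⟩
  simpa only [FeedbackCode.forget_errorProb] using hlim

end MA1Feedback

/-! ### The main theorem. -/

theorem mainTheorem3 {Ω : Type*} [MeasurableSpace Ω] (μ : Measure Ω) [IsProbabilityMeasure μ]
    (α P x₀ β σ : ℝ) (hα : |α| ≤ 1) (hP : 0 < P) (hx₀ : IsPositiveRoot α P x₀)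
    (hβ : β = filterCoeff α x₀) (hσ : σ = filterGain α P x₀)
    (U : ℕ → Ω → ℝ) (X₁ : Ω → ℝ)
    (hU : ∀ k, HasLaw (U k) (gaussianReal 0 1) μ) (hUindep : iIndepFun U μ)
    (hX₁ : HasLaw X₁ (gaussianReal 0 P.toNNReal) μ)
    (hX₁U : IndepFun X₁ (fun ω k => U k ω) μ)
    (X Y Z : ℕ → Ω → ℝ)
    (hX : X = fun k ω => arInput β σ (X₁ ω) (fun j => U j ω) k)
    (hZ : Z = fun k ω => maNoise α (fun j => U j ω) k)
    (hY : Y = fun k ω => X k ω + Z k ω) :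
    -- the positive root is unique
    (∃! x, IsPositiveRoot α P x) ∧
    -- the inputs use exactly the power `P`
    (∀ k, HasLaw (X k) (gaussianReal 0 P.toNNReal) μ) ∧
    -- the output is a stationary Gaussian process from time two on, with the stated spectrum
    IsGaussianProcess Y μ ∧
    StationaryProcess (fun k => Y (k + 1)) μ ∧
    HasSpectralDensity (fun k => Y (k + 1))
      (fun t => (β ^ 2)⁻¹ * ‖1 + (α : ℂ) * (β : ℂ) ^ 2 * Complex.exp (-Complex.I * t)‖ ^ 2) μ ∧
    (∀ t : ℝ, outputSpectrum α β σ t =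
      (β ^ 2)⁻¹ * ‖1 + (α : ℂ) * (β : ℂ) ^ 2 * Complex.exp (-Complex.I * t)‖ ^ 2) ∧
    -- the entropy rates of output and noise, which differ by the feedback capacity
    HasEntropyRate Y (1 / 2 * Real.logb 2 (2 * Real.pi * Real.exp 1 * (x₀ ^ 2)⁻¹)) μ ∧
    (4 * Real.pi)⁻¹ * (∫ t in (-Real.pi)..Real.pi,
        Real.logb 2 (2 * Real.pi * Real.exp 1 * outputSpectrum α β σ t)) =
      1 / 2 * Real.logb 2 (2 * Real.pi * Real.exp 1 * (x₀ ^ 2)⁻¹) ∧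
    HasEntropyRate Z (1 / 2 * Real.logb 2 (2 * Real.pi * Real.exp 1)) μ ∧
    1 / 2 * Real.logb 2 (2 * Real.pi * Real.exp 1 * (x₀ ^ 2)⁻¹) -
      1 / 2 * Real.logb 2 (2 * Real.pi * Real.exp 1) = -Real.logb 2 x₀ ∧
    IsFeedbackCapacity noSide α P (-Real.logb 2 x₀) ∧
    IsFeedbackCapacity revealed α P (-Real.logb 2 x₀) ∧
    -- `likelihood` is the density of the outputs given the first input and `U 0`, and it has a
    -- unique maximizer
    (∀ (n : ℕ) (x s : ℝ),
      innovationLaw.map (fun u (i : Fin n) => arOutput α β σ x (Function.update u 0 s) i) =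
        volume.withDensity (fun y => ENNReal.ofReal (likelihood α β σ x s y))) ∧
    (∀ (n : ℕ) (s : ℝ) (y : Fin n → ℝ), 1 ≤ n → ∃! t, IsMLEstimate α β σ s y t) ∧
    -- coding at every rate below capacity, with doubly exponentially decaying error
    (∀ R : ℝ, 0 < R → R < -Real.logb 2 x₀ →
      (∀ n : ℕ, 1 ≤ n →
        (∃ c : FeedbackCode ℝ (numMessages R n) n, IsFilterCode α P β σ c) ∧
        ∀ c : FeedbackCode ℝ (numMessages R n) n, IsFilterCode α P β σ c →
          c.PowerConstraint revealed α P) ∧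
      ∃ a b : ℝ, 0 < a ∧ 0 < b ∧ ∀ᶠ n : ℕ in atTop,
        ∀ c : FeedbackCode ℝ (numMessages R n) n, IsFilterCode α P β σ c →
          Real.exp (-(b * (2 : ℝ) ^ (2 * (n : ℝ) * (-Real.logb 2 x₀ - R)))) ≤
              c.errorProb revealed α ∧
          c.errorProb revealed α ≤
            Real.exp (-(a * (2 : ℝ) ^ (2 * (n : ℝ) * (-Real.logb 2 x₀ - R))))) := by
  have hR := hx₀.filterRelations hα hP
  rw [← hβ, ← hσ] at hR
  subst hX hZ
  have hY' : Y = fun k ω => arOutput α β σ (X₁ ω) (fun j => U j ω) k := hY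
  subst hY'
  refine ⟨hx₀.existsUnique hα hP, hR.hasLaw_arInput hU hUindep hX₁ hX₁U,
    isGaussianProcess_arOutput hU hUindep hX₁ hX₁U,
    hR.stationaryProcess hU hUindep hX₁ hX₁U, hR.hasSpectralDensity hU hUindep hX₁ hX₁U,
    hR.outputSpectrum_eq, hR.hasEntropyRate_output hU hUindep hX₁ hX₁U,
    hR.integral_logb_outputSpectrum, hasEntropyRate_maNoise hα hU hUindep,
    logb_entropy_sub hR.pos, hR.isFeedbackCapacity_noSide, hR.isFeedbackCapacity_revealed,
    map_arOutput_eq_withDensity α β σ, fun n s y hn => existsUnique_isMLEstimate hn s y,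
    fun R hR0 hRC => ⟨fun n hn => ?_, hR.doubly_exponential hR0 hRC⟩⟩
  have hM : 2 ≤ numMessages R n := two_le_ceil_rpow (mul_pos (by exact_mod_cast hn) hR0)
  exact ⟨exists_isFilterCode α P β σ (by omega) hn, fun c hc => hR.powerConstraint hM hc⟩
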